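/- Let $\mathbb F$ be an algebraically closed field of characteristic zero and let $\mathcal C$ be a braided tensor category (BTC) over $\mathbb F$: an $\mathbb F$-linear semisimple abelian category with finite dimensional Hom-spaces, with a bilinear tensor product, a braiding $c$, duals and a ribbon twist $\theta$, such that $\mathrm{End}\,\mathbf 1=\mathbb F\,\mathrm{id}_{\mathbf 1}$. Let $\mathcal S\subset\mathcal C$ be a full subcategory that contains $\mathbf 1$ and is closed under tensor products and, up to isomorphism, under duals, finite direct sums and direct summands, such that $c_{Y,X}\circ c_{X,Y}=\mathrm{id}$ for all $X,Y\in\mathcal S$ and such that $\mathcal S$ has finitely many isomorphism classes of simple objects. Assume that $\mathcal S$ is admissible: either $\mathbb F=\mathbb C$, $\mathcal S$ has a positive $*$-operation and $\theta_X=\mathrm{id}_X$ for all $X\in\mathcal S$, or the dimension $d(X)$ is a non-negative integer for all $X\in\mathcal S$. Let $G$ be a finite group and $E:\mathrm{Rep}_{\mathbb F}\,G\to\mathcal S$ an $\mathbb F$-linear braided monoidal equivalence. It is not assumed that the objects of $\mathcal S$ have trivial monodromy with all objects of $\mathcal C$. Let $\Gamma\in\mathcal C$ be the image under $E$ of the left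 regular representation of $G$ on the functions $G\to\mathbb F$, with the induced commutative multiplication $m$ and unit $\eta$ (pointwise multiplication, constant function $1$), the induced cocommutative comultiplication $\Delta$ and counit $\varepsilon$ ($\Delta\delta_x=|G|\,\delta_x\otimes\delta_x$, $\varepsilon(f)=|G|^{-1}\sum_x f(x)$), and with the action of $G$ on $\Gamma$ given by the right translations $(gf)(x)=f(xg)$. Let $\tilde{\mathcal C}$ be the category with the objects of $\mathcal C$, $\mathrm{Hom}_{\tilde{\mathcal C}}(X,Y)=\mathrm{Hom}_{\mathcal C}(\Gamma\otimes X,Y)$, the composition $t\,\tilde\circ\,s=t\circ(\mathrm{id}_\Gamma\otimes s)\circ(\Delta\otimes\mathrm{id}_X)$, the identities $\varepsilon\otimes\mathrm{id}_X$, the tensor product of $\mathcal C$ on objects and, for $s:X\to Y$ and $t:Z\to T$, $s\,\tilde\otimes\,t=(s\otimes t)\circ(\mathrm{id}_\Gamma\otimes c_{\Gamma,X}\otimes\mathrm{id}_Z)\circ(\Delta\otimes\mathrm{id}_X\otimes\mathrm{id}_Z)$. Let $\iota:\mathcal C\to\tilde{\mathcal C}$ be the functor $X\mapsto X$, $s\mapsto\varepsilon\otimes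 s$. The Galois extension $\mathcal C\rtimes\mathcal S$ is the idempotent completion of $\tilde{\mathcal C}$ with the tensor product $(X,p)\otimes(Y,q)=(X\otimes Y,p\,\tilde\otimes\,q)$. For $g\in G$ let $\gamma_g:\mathcal C\rtimes\mathcal S\to\mathcal C\rtimes\mathcal S$ be the functor with $\gamma_g(X,p)=(X,\gamma_g(p))$ and $\gamma_g(s)=s\circ(g^{-1}\otimes\mathrm{id}_X)$. A simple object $(X,p)$ of $\mathcal C\rtimes\mathcal S$ has grade $\partial(X,p)=g\in G$ if there is $\partial'\in\mathrm{End}_{\tilde{\mathcal C}}(\Gamma)=\mathrm{Hom}_{\mathcal C}(\Gamma\otimes\Gamma,\Gamma)$ with $$\iota\big((c_{X,\Gamma}\circ c_{\Gamma,X})^{-1}\big)\,\tilde\circ\,(\mathrm{id}_\Gamma\,\tilde\otimes\,p)=\partial'\,\tilde\otimes\,p$$ and such that $\partial'\circ\Delta:\Gamma\to\Gamma$ is the action of $g$. An object is homogeneous of grade $g$ if it is isomorphic to a non-empty finite direct sum of simple objects of grade $g$. Then: 1. $g\mapsto(g:\Gamma\to\Gamma)$ is a bijection from $G$ onto the set of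 endomorphisms of the monoid $(\Gamma,m,\eta)$. 2. Every homogeneous object $X$ has exactly one grade $\partial X$, and $\mathcal C\rtimes\mathcal S$ with its homogeneous objects, $\partial$ and $\gamma$ is a crossed $G$-category: the homogeneous objects contain the unit object and are closed under $\otimes$; $\partial$ is constant on isomorphism classes; $\gamma_{1}=\mathrm{id}$, $\gamma_{gh}=\gamma_g\gamma_h$, and each $\gamma_g$ is a strict tensor functor; $\partial(X\otimes Y)=\partial X\,\partial Y$ for homogeneous $X,Y$; if $X$ is homogeneous then so is $\gamma_g(X)$, and $\partial\gamma_g(X)=g\,\partial X\,g^{-1}$; every object is a finite direct sum of homogeneous objects. 3. Write ${}^X\!Y=\gamma_{\partial X}(Y)$ and ${}^X t=\gamma_{\partial X}(t)$. For every homogeneous $X=(X_0,p)$ and every $Y=(Y_0,q)$, the morphism $c_{X,Y}=\iota(c_{X_0,Y_0})\,\tilde\circ\,(p\,\tilde\otimes\,q)$ is an isomorphism $X\otimes Y\to{}^X\!Y\otimes X$ of $\mathcal C\rtimes\mathcal S$, and these isomorphisms are a braiding of the crossed $G$-category, respected by the action of $G$. That is: there are no non-zero morphisms between homogeneous objects of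 different grades; for $s:X\to X'$ with $X,X'$ homogeneous of the same grade and $t:Y\to Y'$ one has $c_{X',Y'}\circ(s\otimes t)=({}^X t\otimes s)\circ c_{X,Y}$; and, up to the associativity isomorphisms, $$c_{X,Z\otimes T}=(\mathrm{id}_{{}^X\!Z}\otimes c_{X,T})\circ(c_{X,Z}\otimes\mathrm{id}_T),\qquad c_{X\otimes Y,Z}=(c_{X,{}^Y\!Z}\otimes\mathrm{id}_Y)\circ(\mathrm{id}_X\otimes c_{Y,Z}),\qquad \gamma_g(c_{X,Z})=c_{\gamma_g(X),\gamma_g(Z)}$$ for all $g\in G$, all homogeneous $X,Y$ and all objects $Z,T$. -/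

import Mathlib

open CategoryTheory MonoidalCategory Limits Idempotents

universe v u w

set_option linter.unusedSectionVars false

namespace GaloisExt

open scoped ComonObj

section Free

variable {C : Type u} [Category.{v} C] [MonoidalCategory C]

/-- The objects of the category `C̃_Γ` attached to a comonoid `Γ` in `C`: the objects of `C`. -/
structure Pre (Γ : C) where
  /-- the underlying object of `C` -/
  obj : C

namespace Pre

variable {Γ : C}

/-- `Hom_{C̃_Γ}(X, Y) = Hom_C(Γ ⊗ X, Y)`. -/
@[ext]
structure Hom (X Y : Pre Γ) where
  /-- the underlying morphism of `C` -/
  hom : Γ ⊗ X.obj ⟶ Y.obj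

variable [ComonObj Γ]

/-- `t ∘̃ s = t ∘ (id_Γ ⊗ s) ∘ (Δ ⊗ id_X)`, and the identity of `X` is `ε ⊗ id_X`. -/
instance : Category (Pre Γ) where
  Hom := Hom
  id X := ⟨ε[Γ] ▷ X.obj ≫ (λ_ X.obj).hom⟩
  comp {X _ _} s t := ⟨Δ[Γ] ▷ X.obj ≫ (α_ Γ Γ X.obj).hom ≫ Γ ◁ s.hom ≫ t.hom⟩
  id_comp {X Y} s := by
    ext
    change Δ[Γ] ▷ X.obj ≫ (α_ Γ Γ X.obj).hom ≫ Γ ◁ (ε[Γ] ▷ X.obj ≫ (λ_ X.obj).hom) ≫ s.hom = s.hom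
    have := ComonObj.comul_counit Γ
    rw [MonoidalCategory.whiskerLeft_comp, Category.assoc, ← associator_naturality_middle_assoc,
      ← comp_whiskerRight_assoc, this]
    simp
  comp_id {X Y} s := by
    ext
    change Δ[Γ] ▷ X.obj ≫ (α_ Γ Γ X.obj).hom ≫ Γ ◁ s.hom ≫ (ε[Γ] ▷ Y.obj ≫ (λ_ Y.obj).hom) = s.hom
    have := ComonObj.counit_comul Γ
    rw [whisker_exchange_assoc, ← associator_naturality_left_assoc,
      ← comp_whiskerRight_assoc, this]
    simp
  assoc {X Y Z T} r s t := by
    ext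
    change Δ[Γ] ▷ X.obj ≫ (α_ Γ Γ X.obj).hom ≫
        Γ ◁ (Δ[Γ] ▷ X.obj ≫ (α_ Γ Γ X.obj).hom ≫ Γ ◁ r.hom ≫ s.hom) ≫ t.hom =
      Δ[Γ] ▷ X.obj ≫ (α_ Γ Γ X.obj).hom ≫ Γ ◁ r.hom ≫
        (Δ[Γ] ▷ Y.obj ≫ (α_ Γ Γ Y.obj).hom ≫ Γ ◁ s.hom ≫ t.hom)
    have := ComonObj.comul_assoc Γ
    rw [whisker_exchange_assoc]
    simp only [MonoidalCategory.whiskerLeft_comp, Category.assoc]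
    rw [← associator_naturality_middle_assoc, ← associator_naturality_left_assoc,
      ← comp_whiskerRight_assoc, ← comp_whiskerRight_assoc, this]
    simp

@[ext]
lemma hom_ext {X Y : Pre Γ} {s t : X ⟶ Y} (h : s.hom = t.hom) : s = t := Hom.ext h

@[simp]
lemma id_hom (X : Pre Γ) : Hom.hom (𝟙 X) = ε[Γ] ▷ X.obj ≫ (λ_ X.obj).hom := rfl

@[simp]
lemma comp_hom {X Y Z : Pre Γ} (s : X ⟶ Y) (t : Y ⟶ Z) :
    Hom.hom (s ≫ t) = Δ[Γ] ▷ X.obj ≫ (α_ Γ Γ X.obj).hom ≫ Γ ◁ s.hom ≫ t.hom := rfl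

variable (Γ) in
/-- The functor `ι : C ⥤ C̃_Γ`, `X ↦ X`, `s ↦ ε ⊗ s`. -/
def incl : C ⥤ Pre Γ where
  obj X := ⟨X⟩
  map {X Y} s := ⟨ε[Γ] ▷ X ≫ (λ_ X).hom ≫ s⟩
  map_id X := by ext; simp
  map_comp {X Y Z} s t := by
    ext
    have := ComonObj.comul_counit Γ
    change ε[Γ] ▷ X ≫ (λ_ X).hom ≫ s ≫ t = Δ[Γ] ▷ X ≫ (α_ Γ Γ X).hom ≫
      Γ ◁ (ε[Γ] ▷ X ≫ (λ_ X).hom ≫ s) ≫ (ε[Γ] ▷ Y ≫ (λ_ Y).hom ≫ t)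
    rw [MonoidalCategory.whiskerLeft_comp, Category.assoc, ← associator_naturality_middle_assoc,
      ← comp_whiskerRight_assoc, this, whisker_exchange_assoc]
    simp

@[simp] lemma incl_obj_obj (X : C) : ((incl Γ).obj X).obj = X := rfl

@[simp] lemma incl_map_hom {X Y : C} (s : X ⟶ Y) :
    ((incl Γ).map s).hom = ε[Γ] ▷ X ≫ (λ_ X).hom ≫ s := rfl

/-- `ι(s)`, for objects of `C̃_Γ`. -/
def ofHom {X Y : Pre Γ} (s : X.obj ⟶ Y.obj) : X ⟶ Y := (incl Γ).map s

lemma comp_incl_map_hom {X Y : Pre Γ} {Z : C} (s : X ⟶ Y) (t : Y.obj ⟶ Z) :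
    Hom.hom (s ≫ ((incl Γ).map t : Y ⟶ (incl Γ).obj Z)) = s.hom ≫ t := by
  have := ComonObj.counit_comul Γ
  change Δ[Γ] ▷ X.obj ≫ (α_ Γ Γ X.obj).hom ≫ Γ ◁ s.hom ≫ (ε[Γ] ▷ Y.obj ≫ (λ_ Y.obj).hom ≫ t) = _
  rw [whisker_exchange_assoc, ← associator_naturality_left_assoc,
      ← comp_whiskerRight_assoc, this]
  simp

lemma incl_map_comp_hom {X : C} {Y Z : Pre Γ} (s : X ⟶ Y.obj) (t : Y ⟶ Z) :
    Hom.hom (((incl Γ).map s : (incl Γ).obj X ⟶ Y) ≫ t) = Γ ◁ s ≫ t.hom := by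
  have := ComonObj.comul_counit Γ
  change Δ[Γ] ▷ X ≫ (α_ Γ Γ X).hom ≫ Γ ◁ (ε[Γ] ▷ X ≫ (λ_ X).hom ≫ s) ≫ t.hom = _
  rw [MonoidalCategory.whiskerLeft_comp, Category.assoc, ← associator_naturality_middle_assoc,
      ← comp_whiskerRight_assoc, this]
  simp

section Preadditive

variable [Preadditive C] [MonoidalPreadditive C]

instance (X Y : Pre Γ) : Zero (X ⟶ Y) := ⟨⟨0⟩⟩
instance (X Y : Pre Γ) : Add (X ⟶ Y) := ⟨fun s t => ⟨s.hom + t.hom⟩⟩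
instance (X Y : Pre Γ) : Neg (X ⟶ Y) := ⟨fun s => ⟨-s.hom⟩⟩

@[simp] lemma zero_hom (X Y : Pre Γ) : Hom.hom (0 : X ⟶ Y) = 0 := rfl
@[simp] lemma add_hom {X Y : Pre Γ} (s t : X ⟶ Y) : Hom.hom (s + t) = s.hom + t.hom := rfl
@[simp] lemma neg_hom {X Y : Pre Γ} (s : X ⟶ Y) : Hom.hom (-s) = -s.hom := rfl

instance (X Y : Pre Γ) : AddCommGroup (X ⟶ Y) where
  add_assoc a b c := by ext; simp [add_assoc]
  zero_add a := by ext; simp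
  add_zero a := by ext; simp
  add_comm a b := by ext; simp [add_comm]
  neg_add_cancel a := by ext; simp
  nsmul := nsmulRec
  zsmul := zsmulRec

instance : Preadditive (Pre Γ) where
  add_comp X Y Z s s' t := by ext; simp
  comp_add X Y Z s t t' := by ext; simp

end Preadditive

end Pre

end Free

section Monoidal

variable {C : Type u} [Category.{v} C] [MonoidalCategory C] [BraidedCategory C]
variable {Γ : C} [ComonObj Γ]

namespace Pre

/-- `s ⊗̃ t = (s ⊗ t) ∘ (id_Γ ⊗ c_{Γ,X} ⊗ id_Z) ∘ (Δ ⊗ id_X ⊗ id_Z)`. -/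
def tensorHom {X Y Z T : Pre Γ} (s : X ⟶ Y) (t : Z ⟶ T) :
    (⟨X.obj ⊗ Z.obj⟩ : Pre Γ) ⟶ ⟨Y.obj ⊗ T.obj⟩ :=
  ⟨Δ[Γ] ▷ (X.obj ⊗ Z.obj) ≫ tensorμ Γ Γ X.obj Z.obj ≫ (s.hom ⊗ₘ t.hom)⟩

instance : MonoidalCategoryStruct (Pre Γ) where
  tensorObj X Y := ⟨X.obj ⊗ Y.obj⟩
  tensorHom := tensorHom
  whiskerLeft X _ _ t := tensorHom (𝟙 X) t
  whiskerRight s Y := tensorHom s (𝟙 Y)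
  tensorUnit := ⟨𝟙_ C⟩
  associator X Y Z := (incl Γ).mapIso (α_ X.obj Y.obj Z.obj)
  leftUnitor X := (incl Γ).mapIso (λ_ X.obj)
  rightUnitor X := (incl Γ).mapIso (ρ_ X.obj)

@[simp] lemma tensorObj_obj (X Y : Pre Γ) : (X ⊗ Y).obj = X.obj ⊗ Y.obj := rfl
@[simp] lemma tensorUnit_obj : (𝟙_ (Pre Γ)).obj = 𝟙_ C := rfl
lemma tensorHom_hom {X Y Z T : Pre Γ} (s : X ⟶ Y) (t : Z ⟶ T) :
    Hom.hom (s ⊗ₘ t) =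
      Δ[Γ] ▷ (X.obj ⊗ Z.obj) ≫ tensorμ Γ Γ X.obj Z.obj ≫ (s.hom ⊗ₘ t.hom) := rfl

lemma incl_map_tensor {X Y Z T : C} (s : X ⟶ Y) (t : Z ⟶ T) :
    ((incl Γ).map s ⊗ₘ (incl Γ).map t : (incl Γ).obj X ⊗ (incl Γ).obj Z ⟶ _) =
      ((incl Γ).map (s ⊗ₘ t) : (incl Γ).obj (X ⊗ Z) ⟶ (incl Γ).obj (Y ⊗ T)) := by
  ext
  change Δ[Γ] ▷ (X ⊗ Z) ≫ tensorμ Γ Γ X Z ≫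
    ((ε[Γ] ▷ X ≫ (λ_ X).hom ≫ s) ⊗ₘ (ε[Γ] ▷ Z ≫ (λ_ Z).hom ≫ t)) = _
  have h : Δ[Γ] ≫ (ε[Γ] ⊗ₘ ε[Γ]) = ε[Γ] ≫ (λ_ (𝟙_ C)).inv := by simp [unitors_inv_equal]
  rw [← tensorHom_comp_tensorHom, ← tensorHom_comp_tensorHom, ← tensorμ_natural_left_assoc,
    ← comp_whiskerRight_assoc, h, comp_whiskerRight_assoc, ← tensor_left_unitality_assoc]
  rfl

variable [IsCommComonObj Γ]

variable (Γ) in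
lemma comul_comul_tensorμ :
    Δ[Γ] ≫ (Δ[Γ] ⊗ₘ Δ[Γ]) ≫ tensorμ Γ Γ Γ Γ = Δ[Γ] ≫ (Δ[Γ] ⊗ₘ Δ[Γ]) := by
  have h1 : Δ[Γ] ≫ (Δ[Γ] ⊗ₘ Δ[Γ]) ≫ (α_ Γ Γ (Γ ⊗ Γ)).hom = Δ[Γ] ≫ Γ ◁ (Δ[Γ] ≫ Γ ◁ Δ[Γ]) := by
    rw [MonoidalCategory.tensorHom_def, Category.assoc, associator_naturality_right,
      MonoidalCategory.whiskerLeft_comp, ← Category.assoc, ← Category.assoc, Category.assoc Δ[Γ],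
      ← ComonObj.comul_assoc, Category.assoc]
  have h2 : (Δ[Γ] ≫ Γ ◁ Δ[Γ]) ≫ (α_ Γ Γ Γ).inv ≫ (β_ Γ Γ).hom ▷ Γ ≫ (α_ Γ Γ Γ).hom =
      Δ[Γ] ≫ Γ ◁ Δ[Γ] := by
    rw [Category.assoc, ← ComonObj.comul_assoc_flip_assoc, ← comp_whiskerRight_assoc,
      IsCommComonObj.comul_comm, ComonObj.comul_assoc]
  rw [tensorμ, reassoc_of% h1]
  simp only [← MonoidalCategory.whiskerLeft_comp_assoc]
  rw [h2, ← Category.assoc, ← h1]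
  simp

/-- The interchange law. -/
lemma interchange {X₁ Y₁ Z₁ X₂ Y₂ Z₂ : Pre Γ} (f₁ : X₁ ⟶ Y₁) (f₂ : X₂ ⟶ Y₂) (g₁ : Y₁ ⟶ Z₁)
    (g₂ : Y₂ ⟶ Z₂) : (f₁ ⊗ₘ f₂) ≫ (g₁ ⊗ₘ g₂) = (f₁ ≫ g₁) ⊗ₘ (f₂ ≫ g₂) := by
  ext
  simp only [comp_hom, tensorHom_hom, tensorObj_obj]
  obtain ⟨X₁⟩ := X₁; obtain ⟨X₂⟩ := X₂; obtain ⟨Y₁⟩ := Y₁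
  obtain ⟨Y₂⟩ := Y₂; obtain ⟨Z₁⟩ := Z₁; obtain ⟨Z₂⟩ := Z₂
  dsimp only
  have h : Δ[Γ] ▷ (X₁ ⊗ X₂) ≫ (α_ Γ Γ (X₁ ⊗ X₂)).hom ≫
      Γ ◁ (Δ[Γ] ▷ (X₁ ⊗ X₂) ≫ tensorμ Γ Γ X₁ X₂) ≫
        Δ[Γ] ▷ ((Γ ⊗ X₁) ⊗ (Γ ⊗ X₂)) ≫ tensorμ Γ Γ (Γ ⊗ X₁) (Γ ⊗ X₂) =
      Δ[Γ] ▷ (X₁ ⊗ X₂) ≫ tensorμ Γ Γ X₁ X₂ ≫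
        ((Δ[Γ] ▷ X₁ ≫ (α_ Γ Γ X₁).hom) ⊗ₘ (Δ[Γ] ▷ X₂ ≫ (α_ Γ Γ X₂).hom)) := by
    rw [← tensorHom_comp_tensorHom, ← tensorμ_natural_left_assoc, ← comp_whiskerRight_assoc,
      ← comul_comul_tensorμ, comp_whiskerRight_assoc, comp_whiskerRight_assoc,
      tensor_associativity, MonoidalCategory.whiskerLeft_comp_assoc, whisker_exchange_assoc,
      ← associator_naturality_middle_assoc, ← associator_naturality_left_assoc,
      MonoidalCategory.tensorHom_def', comp_whiskerRight_assoc]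
  rw [← Category.assoc (Δ[Γ] ▷ (X₁ ⊗ X₂)) (tensorμ Γ Γ X₁ X₂), MonoidalCategory.whiskerLeft_comp,
    Category.assoc, whisker_exchange_assoc, tensorμ_natural_right_assoc, reassoc_of% h]
  simp only [tensorHom_comp_tensorHom, Category.assoc]

instance : MonoidalCategory (Pre Γ) := .ofTensorHom
  (id_tensorHom_id := fun X Y => by
    have := incl_map_tensor (Γ := Γ) (𝟙 X.obj) (𝟙 Y.obj)
    rw [id_tensorHom_id] at this
    simp only [CategoryTheory.Functor.map_id] at this
    exact this)
  (id_tensorHom := fun _ _ _ _ => rfl)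
  (tensorHom_id := fun _ _ => rfl)
  (tensorHom_comp_tensorHom := interchange)
  (associator_naturality := fun {X₁ X₂ X₃ Y₁ Y₂ Y₃} f₁ f₂ f₃ => by
    obtain ⟨X₁⟩ := X₁; obtain ⟨X₂⟩ := X₂; obtain ⟨Y₁⟩ := Y₁
    obtain ⟨Y₂⟩ := Y₂; obtain ⟨X₃⟩ := X₃; obtain ⟨Y₃⟩ := Y₃
    ext
    refine (comp_incl_map_hom _ _).trans (.trans ?_ (incl_map_comp_hom _ _).symm)
    simp only [tensorHom_hom, tensorObj_obj]
    have h1 : Δ[Γ] ▷ ((X₁ ⊗ X₂) ⊗ X₃) ≫ tensorμ Γ Γ (X₁ ⊗ X₂) X₃ ≫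
        (Δ[Γ] ▷ (X₁ ⊗ X₂)) ▷ (Γ ⊗ X₃) ≫ tensorμ Γ Γ X₁ X₂ ▷ (Γ ⊗ X₃) ≫
          (α_ (Γ ⊗ X₁) (Γ ⊗ X₂) (Γ ⊗ X₃)).hom =
        Γ ◁ (α_ X₁ X₂ X₃).hom ≫ Δ[Γ] ▷ (X₁ ⊗ X₂ ⊗ X₃) ≫ tensorμ Γ Γ X₁ (X₂ ⊗ X₃) ≫
          (Γ ⊗ X₁) ◁ (Δ[Γ] ▷ (X₂ ⊗ X₃) ≫ tensorμ Γ Γ X₂ X₃) := by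
      have e1 := tensorμ_natural_left Δ[Γ] (𝟙 Γ) (X₁ ⊗ X₂) X₃
      have e2 := tensorμ_natural_left (𝟙 Γ) Δ[Γ] X₁ (X₂ ⊗ X₃)
      simp only [tensorHom_id, id_tensorHom, id_whiskerRight] at e1 e2
      rw [← reassoc_of% e1, associator_monoidal, MonoidalCategory.whiskerLeft_comp,
        ← reassoc_of% e2, MonoidalCategory.tensorHom_def, Category.assoc,
        ← comp_whiskerRight_assoc, ← comp_whiskerRight_assoc, Category.assoc,
        ← ComonObj.comul_assoc, comp_whiskerRight_assoc]
      simp only [whisker_exchange_assoc]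
    have h2 : ∀ {A B : C} (a : A ⟶ B) (b : B ⟶ (Γ ⊗ X₁) ⊗ (Γ ⊗ X₂)),
        ((a ≫ b ≫ (f₁.hom ⊗ₘ f₂.hom)) ⊗ₘ f₃.hom) =
          a ▷ _ ≫ b ▷ _ ≫ ((f₁.hom ⊗ₘ f₂.hom) ⊗ₘ f₃.hom) := by
      intros; simp [MonoidalCategory.tensorHom_def]
    have h3 : ∀ {A B : C} (a : A ⟶ B) (b : B ⟶ (Γ ⊗ X₂) ⊗ (Γ ⊗ X₃)),
        (f₁.hom ⊗ₘ (a ≫ b ≫ (f₂.hom ⊗ₘ f₃.hom))) =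
          _ ◁ (a ≫ b) ≫ (f₁.hom ⊗ₘ f₂.hom ⊗ₘ f₃.hom) := by
      intros; simp [MonoidalCategory.tensorHom_def']
    rw [h2, h3]
    simp only [Category.assoc]
    rw [associator_naturality, reassoc_of% h1]
    rfl)
  (leftUnitor_naturality := fun {X Y} f => by
    ext
    refine (comp_incl_map_hom _ _).trans (.trans ?_ (incl_map_comp_hom _ _).symm)
    simp only [tensorHom_hom, tensorUnit_obj, id_hom]
    obtain ⟨X⟩ := X; obtain ⟨Y⟩ := Y
    dsimp only
    have e1 := tensorμ_natural_left ε[Γ] (𝟙 Γ) (𝟙_ C) X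
    simp only [tensorHom_id, id_whiskerRight] at e1
    have e2 : (((ε[Γ] ▷ 𝟙_ C ≫ (λ_ (𝟙_ C)).hom) ⊗ₘ f.hom) ≫ (λ_ Y).hom) =
        (ε[Γ] ▷ 𝟙_ C) ▷ (Γ ⊗ X) ≫ ((λ_ (𝟙_ C)).hom ▷ (Γ ⊗ X)) ≫ (λ_ (Γ ⊗ X)).hom ≫ f.hom := by
      rw [MonoidalCategory.tensorHom_def, comp_whiskerRight, Category.assoc, Category.assoc,
        leftUnitor_naturality]
    rw [Category.assoc, Category.assoc, e2, ← reassoc_of% e1, ← leftUnitor_monoidal_assoc,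
      ← comp_whiskerRight_assoc, ComonObj.counit_comul, MonoidalCategory.tensorHom_def,
      Category.assoc, ← comp_whiskerRight_assoc]
    simp)
  (rightUnitor_naturality := fun {X Y} f => by
    ext
    refine (comp_incl_map_hom _ _).trans (.trans ?_ (incl_map_comp_hom _ _).symm)
    simp only [tensorHom_hom, tensorUnit_obj, id_hom]
    obtain ⟨X⟩ := X; obtain ⟨Y⟩ := Y
    dsimp only
    have e1 := tensorμ_natural_left (𝟙 Γ) ε[Γ] X (𝟙_ C)
    simp only [id_tensorHom, id_whiskerRight] at e1
    have e2 : ((f.hom ⊗ₘ (ε[Γ] ▷ 𝟙_ C ≫ (λ_ (𝟙_ C)).hom)) ≫ (ρ_ Y).hom) =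
        (Γ ⊗ X) ◁ (ε[Γ] ▷ 𝟙_ C) ≫ ((Γ ⊗ X) ◁ (λ_ (𝟙_ C)).hom) ≫ (ρ_ (Γ ⊗ X)).hom ≫ f.hom := by
      simp [MonoidalCategory.tensorHom_def']
    rw [Category.assoc, Category.assoc, e2, ← reassoc_of% e1, ← rightUnitor_monoidal_assoc,
      ← comp_whiskerRight_assoc, ComonObj.comul_counit, MonoidalCategory.tensorHom_def,
      Category.assoc, ← comp_whiskerRight_assoc]
    simp)
  (pentagon := fun W X Y Z => by
    have h := congrArg (incl Γ).map (MonoidalCategory.pentagon W.obj X.obj Y.obj Z.obj)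
    simp only [CategoryTheory.Functor.map_comp, ← tensorHom_id, ← id_tensorHom] at h
    rw [← incl_map_tensor, ← incl_map_tensor] at h
    simp only [CategoryTheory.Functor.map_id] at h
    exact h)
  (triangle := fun X Y => by
    have h := congrArg (incl Γ).map (MonoidalCategory.triangle X.obj Y.obj)
    simp only [CategoryTheory.Functor.map_comp, ← tensorHom_id, ← id_tensorHom] at h
    rw [← incl_map_tensor, ← incl_map_tensor] at h
    simp only [CategoryTheory.Functor.map_id] at h
    exact h)

end Pre

end Monoidal

section Regular

open TannakaDuality.FiniteGroup
open scoped TensorProduct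

variable (F : Type u) [Field F] (G : Type u) [Group G] [Fintype G]

/-- The left regular representation of `G` on `G → F`, `(g f)(x) = f (g⁻¹ x)`. -/
noncomputable def regular : FDRep F G := FDRep.of (leftRegular (k := F) (G := G))

variable {F G}

noncomputable def regOne : 𝟙_ (FDRep F G) ⟶ regular F G where
  hom := InducedCategory.homMk (ModuleCat.ofHom (Algebra.linearMap F (G → F)))
  comm := by
    intro g
    ext
    rfl

noncomputable def regMul : regular F G ⊗ regular F G ⟶ regular F G where
  hom := InducedCategory.homMk (ModuleCat.ofHom (LinearMap.mul' F (G → F)))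
  comm := by
    intro g
    ext u
    refine TensorProduct.induction_on u rfl (fun _ _ ↦ rfl) (fun _ _ hx hy ↦ ?_)
    simp only [map_add, hx, hy]

noncomputable def counitLin : (G → F) →ₗ[F] F :=
  (Fintype.card G : F)⁻¹ • ∑ x : G, LinearMap.proj x

open Classical in
noncomputable def comulLin : (G → F) →ₗ[F] (G → F) ⊗[F] (G → F) :=
  (Fintype.card G : F) • ∑ x : G,
    (LinearMap.proj x).smulRight ((Pi.single x 1 : G → F) ⊗ₜ[F] (Pi.single x 1 : G → F))

lemma card_cast_ne_zero [CharZero F] : (Fintype.card G : F) ≠ 0 :=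
  Nat.cast_ne_zero.mpr Fintype.card_ne_zero

open Classical in
lemma counitLin_single (x : G) : counitLin (Pi.single x 1 : G → F) = (Fintype.card G : F)⁻¹ := by
  simp [counitLin]

open Classical in
lemma comulLin_single (x : G) : comulLin (Pi.single x 1 : G → F) =
    (Fintype.card G : F) • ((Pi.single x 1 : G → F) ⊗ₜ[F] (Pi.single x 1 : G → F)) := by
  simp [comulLin, Pi.single_apply, ite_smul]

open Classical in
lemma linearMap_ext {M : Type*} [AddCommGroup M] [Module F M] {a b : (G → F) →ₗ[F] M}
    (h : ∀ x, a (Pi.single x 1) = b (Pi.single x 1)) : a = b :=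
  (Pi.basisFun F G).ext (fun x => by simpa using h x)

open Classical in
lemma leftRegular_single (g x : G) :
    leftRegular g (Pi.single x 1 : G → F) = Pi.single (g * x) 1 := by
  ext y
  simp [Pi.single_apply, inv_mul_eq_iff_eq_mul]

open Classical in
lemma rightRegular_single (g x : G) :
    rightRegular g (Pi.single x 1 : G → F) = Pi.single (x * g⁻¹) 1 := by
  ext y
  simp [Pi.single_apply, eq_mul_inv_iff_mul_eq]

lemma counitLin_leftRegular (g : G) :
    counitLin ∘ₗ leftRegular g = (counitLin : (G → F) →ₗ[F] F) :=
  linearMap_ext fun x => by simp [leftRegular_single, counitLin_single]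

lemma comulLin_leftRegular (g : G) : comulLin ∘ₗ leftRegular g =
    TensorProduct.map (leftRegular g) (leftRegular g) ∘ₗ (comulLin : (G → F) →ₗ[F] _) :=
  linearMap_ext fun x => by simp [leftRegular_single, comulLin_single]

lemma counitLin_rightRegular (g : G) :
    counitLin ∘ₗ rightRegular g = (counitLin : (G → F) →ₗ[F] F) :=
  linearMap_ext fun x => by simp [rightRegular_single, counitLin_single]

lemma comulLin_rightRegular (g : G) : comulLin ∘ₗ rightRegular g =
    TensorProduct.map (rightRegular g) (rightRegular g) ∘ₗ (comulLin : (G → F) →ₗ[F] _) :=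
  linearMap_ext fun x => by simp [rightRegular_single, comulLin_single]

lemma counitLin_comulLin [CharZero F] :
    counitLin.rTensor (G → F) ∘ₗ comulLin = TensorProduct.mk F F (G → F) 1 :=
  linearMap_ext fun x => by
    simp [comulLin_single, counitLin_single, TensorProduct.smul_tmul']

lemma comulLin_counitLin [CharZero F] :
    counitLin.lTensor (G → F) ∘ₗ comulLin = (TensorProduct.mk F (G → F) F).flip 1 :=
  linearMap_ext fun x => by
    simp [comulLin_single, counitLin_single, ← TensorProduct.tmul_smul]

lemma comulLin_coassoc :
    comulLin.lTensor (G → F) ∘ₗ comulLin =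
      (TensorProduct.assoc F (G → F) (G → F) (G → F)).toLinearMap ∘ₗ
        comulLin.rTensor (G → F) ∘ₗ comulLin :=
  linearMap_ext fun x => by
    simp [comulLin_single, ← TensorProduct.smul_tmul']

lemma comulLin_comm :
    (TensorProduct.comm F (G → F) (G → F)).toLinearMap ∘ₗ comulLin = comulLin :=
  linearMap_ext fun x => by simp [comulLin_single]

noncomputable def regCounit : regular F G ⟶ 𝟙_ (FDRep F G) where
  hom := InducedCategory.homMk (ModuleCat.ofHom counitLin)
  comm g := FGModuleCat.hom_ext (counitLin_leftRegular g)

noncomputable def regComul : regular F G ⟶ regular F G ⊗ regular F G where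
  hom := InducedCategory.homMk (ModuleCat.ofHom comulLin)
  comm g := FGModuleCat.hom_ext (comulLin_leftRegular g)

/-- `m(f ⊗ f') = f f'` and `η(1) = 1`. -/
noncomputable instance : MonObj (regular F G) where
  one := regOne
  mul := regMul
  one_mul := by
    apply Action.Hom.ext; apply FGModuleCat.hom_ext
    apply TensorProduct.ext'
    intro a f
    exact (Algebra.smul_def (A := G → F) a f).symm
  mul_one := by
    apply Action.Hom.ext; apply FGModuleCat.hom_ext
    apply TensorProduct.ext'
    intro f a
    exact (mul_comm (G := G → F) _ _).trans (Algebra.smul_def (A := G → F) a f).symm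
  mul_assoc := by
    apply Action.Hom.ext; apply FGModuleCat.hom_ext
    apply TensorProduct.ext_threefold
    intro a b c
    exact mul_assoc (G := G → F) a b c

/-- `Δ(δ_x) = |G| δ_x ⊗ δ_x` and `ε(f) = |G|⁻¹ ∑ f(x)`. -/
noncomputable instance [CharZero F] : ComonObj (regular F G) where
  counit := regCounit
  comul := regComul
  counit_comul := Action.Hom.ext (FGModuleCat.hom_ext counitLin_comulLin)
  comul_counit := Action.Hom.ext (FGModuleCat.hom_ext comulLin_counitLin)
  comul_assoc := by
    apply Action.Hom.ext
    rw [Action.comp_hom, Action.comp_hom, Action.comp_hom, Action.associator_hom_hom,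
      Action.whiskerLeft_hom, Action.whiskerRight_hom]
    exact FGModuleCat.hom_ext comulLin_coassoc

instance [CharZero F] : IsCommComonObj (regular F G) where
  comul_comm := by
    apply Action.Hom.ext
    rw [Action.comp_hom, Action.β_hom_hom]
    exact FGModuleCat.hom_ext comulLin_comm

/-- Right translation by `g`, `f ↦ (x ↦ f (x g))`: an automorphism of the left regular
representation. -/
noncomputable def regTranslate (g : G) : regular F G ⟶ regular F G where
  hom := InducedCategory.homMk (ModuleCat.ofHom (rightRegular g))
  comm h := by
    apply FGModuleCat.hom_ext
    apply linearMap_ext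
    intro x
    classical
    change rightRegular g (leftRegular h (Pi.single x 1 : G → F)) =
      leftRegular h (rightRegular g (Pi.single x 1 : G → F))
    simp [leftRegular_single, rightRegular_single, mul_assoc]

instance [CharZero F] (g : G) : IsComonHom (regTranslate (F := F) g) where
  hom_counit := Action.Hom.ext (FGModuleCat.hom_ext (counitLin_rightRegular g))
  hom_comul := by
    apply Action.Hom.ext
    rw [Action.comp_hom, Action.comp_hom, Action.tensorHom_hom]
    exact FGModuleCat.hom_ext (comulLin_rightRegular g)

end Regular
section Karoubi

variable {D : Type u} [Category.{v} D] [MonoidalCategory D]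

lemma karoubi_associator_aux (P Q R : Karoubi D) :
    (α_ P.X Q.X R.X).inv ≫ ((P.p ⊗ₘ Q.p) ⊗ₘ R.p) =
      (P.p ⊗ₘ Q.p ⊗ₘ R.p) ≫ (α_ P.X Q.X R.X).inv :=
  (associator_inv_naturality _ _ _).symm

lemma karoubi_idem₃ (P Q R : Karoubi D) :
    (P.p ⊗ₘ Q.p ⊗ₘ R.p) ≫ (P.p ⊗ₘ Q.p ⊗ₘ R.p) = (P.p ⊗ₘ Q.p ⊗ₘ R.p) := by
  simp only [tensorHom_comp_tensorHom, Karoubi.idem]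

lemma karoubi_idem₃' (P Q R : Karoubi D) :
    ((P.p ⊗ₘ Q.p) ⊗ₘ R.p) ≫ ((P.p ⊗ₘ Q.p) ⊗ₘ R.p) = ((P.p ⊗ₘ Q.p) ⊗ₘ R.p) := by
  simp only [tensorHom_comp_tensorHom, Karoubi.idem]

lemma karoubi_associator_comm (P Q R : Karoubi D) :
    ((P.p ⊗ₘ Q.p) ⊗ₘ R.p) ≫ (((P.p ⊗ₘ Q.p) ⊗ₘ R.p) ≫ (α_ P.X Q.X R.X).hom) ≫
      (P.p ⊗ₘ Q.p ⊗ₘ R.p) = ((P.p ⊗ₘ Q.p) ⊗ₘ R.p) ≫ (α_ P.X Q.X R.X).hom := by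
  rw [Category.assoc, ← associator_naturality, reassoc_of% (karoubi_idem₃' P Q R),
    reassoc_of% (karoubi_idem₃' P Q R)]

lemma karoubi_associator_inv_comm (P Q R : Karoubi D) :
    (P.p ⊗ₘ Q.p ⊗ₘ R.p) ≫ ((P.p ⊗ₘ Q.p ⊗ₘ R.p) ≫ (α_ P.X Q.X R.X).inv) ≫
      ((P.p ⊗ₘ Q.p) ⊗ₘ R.p) = (P.p ⊗ₘ Q.p ⊗ₘ R.p) ≫ (α_ P.X Q.X R.X).inv := by
  rw [Category.assoc, karoubi_associator_aux, reassoc_of% (karoubi_idem₃ P Q R),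
    reassoc_of% (karoubi_idem₃ P Q R)]

lemma karoubi_associator_hom_inv (P Q R : Karoubi D) :
    (((P.p ⊗ₘ Q.p) ⊗ₘ R.p) ≫ (α_ P.X Q.X R.X).hom) ≫
      (P.p ⊗ₘ Q.p ⊗ₘ R.p) ≫ (α_ P.X Q.X R.X).inv = ((P.p ⊗ₘ Q.p) ⊗ₘ R.p) := by
  rw [← karoubi_associator_aux, Category.assoc, Iso.hom_inv_id_assoc, karoubi_idem₃']

lemma karoubi_associator_inv_hom (P Q R : Karoubi D) :
    ((P.p ⊗ₘ Q.p ⊗ₘ R.p) ≫ (α_ P.X Q.X R.X).inv) ≫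
      ((P.p ⊗ₘ Q.p) ⊗ₘ R.p) ≫ (α_ P.X Q.X R.X).hom = (P.p ⊗ₘ Q.p ⊗ₘ R.p) := by
  rw [associator_naturality, Category.assoc, Iso.inv_hom_id_assoc, karoubi_idem₃]

/-- The tensor product of the idempotent completion: `(X, p) ⊗ (Y, q) = (X ⊗ Y, p ⊗ q)`, with the
tensor product of morphisms of `D`. -/
instance : MonoidalCategoryStruct (Karoubi D) where
  tensorObj P Q := ⟨P.X ⊗ Q.X, P.p ⊗ₘ Q.p, by simp [tensorHom_comp_tensorHom]⟩
  tensorHom f g := ⟨f.f ⊗ₘ g.f, by simp [tensorHom_comp_tensorHom]⟩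
  whiskerLeft P _ _ g := ⟨P.p ⊗ₘ g.f, by simp [tensorHom_comp_tensorHom]⟩
  whiskerRight f Q := ⟨f.f ⊗ₘ Q.p, by simp [tensorHom_comp_tensorHom]⟩
  tensorUnit := ⟨𝟙_ D, 𝟙 _, by simp⟩
  associator P Q R :=
    { hom := ⟨((P.p ⊗ₘ Q.p) ⊗ₘ R.p) ≫ (α_ P.X Q.X R.X).hom, karoubi_associator_comm P Q R⟩
      inv := ⟨(P.p ⊗ₘ Q.p ⊗ₘ R.p) ≫ (α_ P.X Q.X R.X).inv, karoubi_associator_inv_comm P Q R⟩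
      hom_inv_id := Karoubi.hom_ext _ _ (karoubi_associator_hom_inv P Q R)
      inv_hom_id := Karoubi.hom_ext _ _ (karoubi_associator_inv_hom P Q R) }
  leftUnitor P :=
    { hom := ⟨(𝟙 _ ⊗ₘ P.p) ≫ (λ_ P.X).hom, by simp⟩
      inv := ⟨P.p ≫ (λ_ P.X).inv, by simp⟩
      hom_inv_id := by ext; simp
      inv_hom_id := by ext; simp }
  rightUnitor P :=
    { hom := ⟨(P.p ⊗ₘ 𝟙 _) ≫ (ρ_ P.X).hom, by simp⟩
      inv := ⟨P.p ≫ (ρ_ P.X).inv, by simp⟩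
      hom_inv_id := by ext; simp
      inv_hom_id := by ext; simp }

@[simp] lemma karoubi_tensorObj_X (P Q : Karoubi D) : (P ⊗ Q).X = P.X ⊗ Q.X := rfl
@[simp] lemma karoubi_tensorObj_p (P Q : Karoubi D) : (P ⊗ Q).p = (P.p ⊗ₘ Q.p) := rfl
@[simp] lemma karoubi_tensorUnit_X : (𝟙_ (Karoubi D)).X = 𝟙_ D := rfl
@[simp] lemma karoubi_tensorUnit_p : (𝟙_ (Karoubi D)).p = 𝟙 (𝟙_ D) := rfl
@[simp] lemma karoubi_tensorHom_f {P P' Q Q' : Karoubi D} (f : P ⟶ P') (g : Q ⟶ Q') :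
    (f ⊗ₘ g).f = (f.f ⊗ₘ g.f) := rfl
lemma karoubi_associator_hom_f (P Q R : Karoubi D) :
    (α_ P Q R).hom.f = ((P.p ⊗ₘ Q.p) ⊗ₘ R.p) ≫ (α_ P.X Q.X R.X).hom := rfl
lemma karoubi_leftUnitor_hom_f (P : Karoubi D) :
    (λ_ P).hom.f = (𝟙 _ ⊗ₘ P.p) ≫ (λ_ P.X).hom := rfl
lemma karoubi_rightUnitor_hom_f (P : Karoubi D) :
    (ρ_ P).hom.f = (P.p ⊗ₘ 𝟙 _) ≫ (ρ_ P.X).hom := rfl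

instance : MonoidalCategory (Karoubi D) := .ofTensorHom
  (id_tensorHom_id := fun P Q => rfl)
  (id_tensorHom := fun _ _ _ _ => rfl)
  (tensorHom_id := fun _ _ => rfl)
  (tensorHom_comp_tensorHom := fun f₁ f₂ g₁ g₂ => by
    ext; simp [tensorHom_comp_tensorHom])
  (associator_naturality := fun f₁ f₂ f₃ => by
    ext
    simp [karoubi_associator_hom_f, tensorHom_comp_tensorHom])
  (leftUnitor_naturality := fun f => by
    ext
    simp [karoubi_leftUnitor_hom_f])
  (rightUnitor_naturality := fun f => by
    ext
    simp [karoubi_rightUnitor_hom_f])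
  (pentagon := fun P Q R T => by
    ext
    change (((((P.p ⊗ₘ Q.p) ⊗ₘ R.p) ≫ (α_ P.X Q.X R.X).hom) ⊗ₘ T.p) ≫
      (((P.p ⊗ₘ Q.p ⊗ₘ R.p) ⊗ₘ T.p) ≫ (α_ P.X (Q.X ⊗ R.X) T.X).hom) ≫
        (P.p ⊗ₘ ((Q.p ⊗ₘ R.p) ⊗ₘ T.p) ≫ (α_ Q.X R.X T.X).hom)) =
      ((((P.p ⊗ₘ Q.p) ⊗ₘ R.p) ⊗ₘ T.p) ≫ (α_ (P.X ⊗ Q.X) R.X T.X).hom) ≫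
        (((P.p ⊗ₘ Q.p) ⊗ₘ R.p ⊗ₘ T.p) ≫ (α_ P.X Q.X (R.X ⊗ T.X)).hom)
    have h1 : ∀ {A B A' : D} (a : A ⟶ B) (b : B ⟶ A') {Z Z' : D} (z : Z ⟶ Z'),
        ((a ≫ b) ⊗ₘ z) = (a ⊗ₘ z) ≫ b ▷ Z' := by
      intros; simp [MonoidalCategory.tensorHom_def']
    have h2 : ∀ {A B A' : D} (a : A ⟶ B) (b : B ⟶ A') {Z Z' : D} (z : Z ⟶ Z'),
        (z ⊗ₘ (a ≫ b)) = (z ⊗ₘ a) ≫ Z' ◁ b := by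
      intros; simp [MonoidalCategory.tensorHom_def]
    have h3 : (α_ P.X Q.X R.X).hom ▷ T.X ≫ ((P.p ⊗ₘ Q.p ⊗ₘ R.p) ⊗ₘ T.p) =
        (((P.p ⊗ₘ Q.p) ⊗ₘ R.p) ⊗ₘ T.p) ≫ (α_ P.X Q.X R.X).hom ▷ T.X := by
      rw [← h1, associator_naturality, MonoidalCategory.tensorHom_def (_ ≫ _),
        comp_whiskerRight_assoc, ← MonoidalCategory.tensorHom_def]
    have h4 : ∀ {A A' B B' E E' : D} (a : A ⟶ A') (b : B ⟶ B') (e : E ⟶ E') {Z : D}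
        (z : A' ⊗ B' ⊗ E' ⟶ Z), (α_ A B E).hom ≫ (a ⊗ₘ b ⊗ₘ e) ≫ z =
          ((a ⊗ₘ b) ⊗ₘ e) ≫ (α_ A' B' E').hom ≫ z := by
      intros; simp
    rw [h1, h2]
    simp only [Category.assoc, h4, reassoc_of% h3]
    rw [MonoidalCategory.pentagon]
    simp only [tensorHom_comp_tensorHom_assoc, tensorHom_comp_tensorHom, Karoubi.idem])
  (triangle := fun P Q => by
    ext
    change (((P.p ⊗ₘ 𝟙 (𝟙_ D)) ⊗ₘ Q.p) ≫ (α_ P.X (𝟙_ D) Q.X).hom) ≫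
      (P.p ⊗ₘ ((𝟙 (𝟙_ D) ⊗ₘ Q.p) ≫ (λ_ Q.X).hom)) = (((P.p ⊗ₘ 𝟙 (𝟙_ D)) ≫ (ρ_ P.X).hom) ⊗ₘ Q.p)
    have h1 : (P.p ⊗ₘ ((𝟙 (𝟙_ D) ⊗ₘ Q.p) ≫ (λ_ Q.X).hom)) =
        (P.p ⊗ₘ (𝟙 (𝟙_ D) ⊗ₘ Q.p)) ≫ P.X ◁ (λ_ Q.X).hom := by
      simp [MonoidalCategory.tensorHom_def]
    have h2 : (((P.p ⊗ₘ 𝟙 (𝟙_ D)) ≫ (ρ_ P.X).hom) ⊗ₘ Q.p) =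
        ((P.p ⊗ₘ 𝟙 (𝟙_ D)) ⊗ₘ Q.p) ≫ (ρ_ P.X).hom ▷ Q.X := by
      simp [MonoidalCategory.tensorHom_def']
    rw [h1, h2, Category.assoc, ← associator_naturality_assoc, MonoidalCategory.triangle,
      tensorHom_comp_tensorHom_assoc, tensorHom_comp_tensorHom, Karoubi.idem, Karoubi.idem,
      Category.comp_id])

/-- The extension of a functor to the idempotent completion, `(X, p) ↦ (Φ X, Φ p)`. -/
@[simps]
def karoubiMap (Φ : D ⥤ D) : Karoubi D ⥤ Karoubi D where
  obj P := ⟨Φ.obj P.X, Φ.map P.p, by rw [← Φ.map_comp, P.idem]⟩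
  map f := ⟨Φ.map f.f, by simp only [← Φ.map_comp, f.comm]⟩
  map_id P := rfl
  map_comp f g := by ext; simp

end Karoubi

section Action

variable {C : Type w} [Category.{v} C] [MonoidalCategory C] {Γ : C} [ComonObj Γ]

/-- The functor `C̃_Γ ⥤ C̃_Γ`, `X ↦ X`, `s ↦ s ∘ (φ ⊗ id_X)` of an endomorphism `φ` of the
comonoid `Γ`. -/
def Pre.twist (φ : Γ ⟶ Γ) [IsComonHom φ] : Pre Γ ⥤ Pre Γ where
  obj X := X
  map {X _} s := ⟨φ ▷ X.obj ≫ s.hom⟩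
  map_id X := by
    ext
    change φ ▷ X.obj ≫ ε[Γ] ▷ X.obj ≫ (λ_ X.obj).hom = ε[Γ] ▷ X.obj ≫ (λ_ X.obj).hom
    rw [← comp_whiskerRight_assoc, IsComonHom.hom_counit]
  map_comp {X Y Z} s t := by
    ext
    change φ ▷ X.obj ≫ Δ[Γ] ▷ X.obj ≫ (α_ Γ Γ X.obj).hom ≫ Γ ◁ s.hom ≫ t.hom =
      Δ[Γ] ▷ X.obj ≫ (α_ Γ Γ X.obj).hom ≫ Γ ◁ (φ ▷ X.obj ≫ s.hom) ≫ φ ▷ Y.obj ≫ t.hom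
    rw [← comp_whiskerRight_assoc, IsComonHom.hom_comul, MonoidalCategory.tensorHom_def,
      whisker_exchange_assoc, MonoidalCategory.whiskerLeft_comp_assoc, comp_whiskerRight_assoc,
      comp_whiskerRight_assoc, associator_naturality_middle_assoc,
      associator_naturality_left_assoc]

end Action

section Galois

variable {F : Type u} [Field F] [CharZero F] {G : Type u} [Group G] [Fintype G]
variable {C : Type w} [Category.{v} C] [MonoidalCategory C] [BraidedCategory C]
variable (K : FDRep F G ⥤ C) [K.Braided]

/-- The object `Γ` of `C`: the image of the regular representation under `K : Rep G ⥤ C`. -/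
noncomputable def Gam : C := K.obj (regular F G)

noncomputable instance : MonObj (Gam K) := Functor.monObjObj (F := K) (regular F G)

noncomputable instance : ComonObj (Gam K) := Functor.obj.instComonObj (regular F G) K

instance : IsCommComonObj (Gam K) where
  comul_comm := by
    change (K.map Δ[regular F G] ≫ Functor.OplaxMonoidal.δ K _ _) ≫ (β_ _ _).hom =
      K.map Δ[regular F G] ≫ Functor.OplaxMonoidal.δ K _ _
    have h := Functor.map_braiding K (regular F G) (regular F G)
    have h' : Functor.OplaxMonoidal.δ K (regular F G) (regular F G) ≫
        (β_ (K.obj (regular F G)) (K.obj (regular F G))).hom =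
        K.map (β_ (regular F G) (regular F G)).hom ≫ Functor.OplaxMonoidal.δ K _ _ := by
      rw [h]; simp
    rw [Category.assoc, h', ← K.map_comp_assoc, IsCommComonObj.comul_comm]

/-- The action of `G` on `Γ` by right translations. -/
noncomputable def translate (g : G) : Gam K ⟶ Gam K := K.map (regTranslate g)

instance (g : G) : IsComonHom (translate K g) :=
  letI := Functor.obj.instComonObj (regular F G) K
  inferInstanceAs (IsComonHom (K.map (regTranslate g)))

/-- `C ⋊ S`, the idempotent completion of `C̃_Γ`. -/
abbrev GaloisExtension := Karoubi (Pre (Gam K))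

/-- `γ_g (X, p) = (X, γ_g p)`, `γ_g s = s ∘ (g⁻¹ ⊗ id)`. -/
noncomputable def galoisAction (g : G) : GaloisExtension K ⥤ GaloisExtension K :=
  karoubiMap (Pre.twist (translate K g⁻¹))

end Galois

/-- `X` is a direct sum of the finite family `Y`. -/
def IsDirectSum {D : Type*} [Category D] [Preadditive D] (X : D) {n : ℕ} (Y : Fin n → D) : Prop :=
  ∃ b : Bicone Y, Nonempty b.IsBilimit ∧ Nonempty (b.pt ≅ X)

section Grade

variable {F : Type u} [Field F] [CharZero F] {G : Type u} [Group G] [Fintype G]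
variable {C : Type w} [Category.{v} C] [MonoidalCategory C] [BraidedCategory C]
variable (K : FDRep F G ⥤ C) [K.Braided]

/-- `∂(X, p) = g`: the inverse of the monodromy of `Γ` and `X`, restricted to `Γ ⊗ (X, p)`, is
`∂' ⊗ id_{(X, p)}` for an endomorphism `∂'` of `ι(Γ)`, that is `∂' : Γ ⊗ Γ ⟶ Γ` in `C`, such that
`∂' ∘ Δ` is the action of `g` on `Γ`. -/
def HasGrade (P : GaloisExtension K) (g : G) : Prop :=
  ∃ d : (Pre.incl (Gam K)).obj (Gam K) ⟶ (Pre.incl (Gam K)).obj (Gam K),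
    (𝟙 ((Pre.incl (Gam K)).obj (Gam K)) ⊗ₘ P.p) ≫
        Pre.ofHom ((β_ P.X.obj (Gam K)).inv ≫ (β_ (Gam K) P.X.obj).inv) = d ⊗ₘ P.p ∧
      Δ[Gam K] ≫ d.hom = translate K g

variable [Preadditive C] [MonoidalPreadditive C]

/-- `P` is homogeneous of grade `g`: a non-empty finite direct sum of simple objects of grade `g`. -/
def IsHomogeneousOfGrade (P : GaloisExtension K) (g : G) : Prop :=
  ∃ (n : ℕ) (Y : Fin n → GaloisExtension K),
    0 < n ∧ (∀ i, Simple (Y i) ∧ HasGrade K (Y i) g) ∧ IsDirectSum P Y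

/-- The homogeneous objects of `C ⋊ S`. -/
def homogeneous : ObjectProperty (GaloisExtension K) :=
  fun P => ∃ g : G, IsHomogeneousOfGrade K P g

end Grade

section Crossed

variable {G : Type*} [Group G] {D : Type*} [Category D] [Preadditive D] [MonoidalCategory D]

/-- The category `D` with the full subcategory `homog` of homogeneous objects, the grading `deg`
and the action `γ` of `G` on `D` is a crossed `G`-category. The `γ_g` are strict tensor functors:
they commute with the tensor product of objects and of morphisms, and preserve the unit object, the
associators and the unitors, up to the identity morphisms of equal objects. -/
structure IsCrossedGCategory (homog : ObjectProperty D) (deg : homog.FullSubcategory → G)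
    (γ : G → D ⥤ D) : Prop where
  isMonoidal : homog.IsMonoidal
  deg_iso (X Y : homog.FullSubcategory) (e : Nonempty (X.obj ≅ Y.obj)) : deg X = deg Y
  γ_one : γ 1 = 𝟭 D
  γ_mul (g h : G) : γ (g * h) = γ h ⋙ γ g
  γ_unit (g : G) : (γ g).obj (𝟙_ D) = 𝟙_ D
  γ_tensor (g : G) (X Y : D) : (γ g).obj (X ⊗ Y) = (γ g).obj X ⊗ (γ g).obj Y
  γ_tensorHom (g : G) {X X' Y Y' : D} (s : X ⟶ X') (t : Y ⟶ Y') :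
    (γ g).map (s ⊗ₘ t) =
      eqToHom (γ_tensor g X Y) ≫ ((γ g).map s ⊗ₘ (γ g).map t) ≫ eqToHom (γ_tensor g X' Y').symm
  γ_associator (g : G) (X Y Z : D) :
    (γ g).map (α_ X Y Z).hom =
      eqToHom (by rw [γ_tensor, γ_tensor]) ≫
        (α_ ((γ g).obj X) ((γ g).obj Y) ((γ g).obj Z)).hom ≫
          eqToHom (by rw [γ_tensor, γ_tensor])
  γ_leftUnitor (g : G) (X : D) :
    (γ g).map (λ_ X).hom = eqToHom (by rw [γ_tensor, γ_unit]) ≫ (λ_ ((γ g).obj X)).hom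
  γ_rightUnitor (g : G) (X : D) :
    (γ g).map (ρ_ X).hom = eqToHom (by rw [γ_tensor, γ_unit]) ≫ (ρ_ ((γ g).obj X)).hom
  deg_tensor (X Y : homog.FullSubcategory) :
    deg ⟨X.obj ⊗ Y.obj, isMonoidal.prop_tensor _ _ X.property Y.property⟩ = deg X * deg Y
  γ_homog (g : G) (X : D) (hX : homog X) : homog ((γ g).obj X)
  deg_γ (g : G) (X : homog.FullSubcategory) :
    deg ⟨(γ g).obj X.obj, γ_homog g X.obj X.property⟩ = g * deg X * g⁻¹
  directSum (X : D) : ∃ (n : ℕ) (Y : Fin n → D), (∀ i, homog (Y i)) ∧ IsDirectSum X Y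

variable {homog : ObjectProperty D} {deg : homog.FullSubcategory → G} {γ : G → D ⥤ D}

/-- The tensor product of homogeneous objects. -/
def IsCrossedGCategory.tensor (h : IsCrossedGCategory homog deg γ) (X Y : homog.FullSubcategory) :
    homog.FullSubcategory :=
  ⟨X.obj ⊗ Y.obj, h.isMonoidal.prop_tensor _ _ X.property Y.property⟩

/-- The image of a homogeneous object under the action of `g`. -/
def IsCrossedGCategory.act (h : IsCrossedGCategory homog deg γ) (g : G)
    (X : homog.FullSubcategory) : homog.FullSubcategory :=
  ⟨(γ g).obj X.obj, h.γ_homog g X.obj X.property⟩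

lemma IsCrossedGCategory.obj_tensor (h : IsCrossedGCategory homog deg γ)
    (X Y : homog.FullSubcategory) (Z : D) :
    (γ (deg (h.tensor X Y))).obj Z = (γ (deg X)).obj ((γ (deg Y)).obj Z) := by
  rw [IsCrossedGCategory.tensor, h.deg_tensor, h.γ_mul]; rfl

lemma IsCrossedGCategory.obj_act (h : IsCrossedGCategory homog deg γ) (g : G)
    (X : homog.FullSubcategory) (Y : D) :
    (γ g).obj ((γ (deg X)).obj Y) = (γ (deg (h.act g X))).obj ((γ g).obj Y) := by
  have h1 : (γ g).obj ((γ (deg X)).obj Y) = (γ (g * deg X)).obj Y := by rw [h.γ_mul]; rfl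
  have h2 : (γ (g * deg X * g⁻¹)).obj ((γ g).obj Y) = (γ (g * deg X * g⁻¹ * g)).obj Y := by
    rw [h.γ_mul _ g]; rfl
  rw [IsCrossedGCategory.act, h.deg_γ, h1, h2, inv_mul_cancel_right]

/-- The family `c X Y : X ⊗ Y ≅ ^X Y ⊗ X`, `X` homogeneous and `^X Y = γ_{∂X} Y`, is a braiding of the
crossed `G`-category `D` that is respected by the action of `G`. Since `^X t` and `^X' t` can only be
compared if `∂X = ∂X'`, naturality in `X` contains the statement that there are no non-zero morphisms
between homogeneous objects of different grades. -/
structure IsCrossedBraiding (h : IsCrossedGCategory homog deg γ)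
    (c : ∀ (X : homog.FullSubcategory) (Y : D), X.obj ⊗ Y ≅ (γ (deg X)).obj Y ⊗ X.obj) :
    Prop where
  hom_eq_zero (X X' : homog.FullSubcategory) (s : X.obj ⟶ X'.obj) (hX : deg X ≠ deg X') : s = 0
  naturality (X X' : homog.FullSubcategory) {Y Y' : D} (s : X.obj ⟶ X'.obj) (t : Y ⟶ Y')
    (hX : deg X = deg X') :
    (s ⊗ₘ t) ≫ (c X' Y').hom =
      (c X Y).hom ≫ (((γ (deg X)).map t ≫ eqToHom (by rw [hX])) ⊗ₘ s)
  tensor_right (X : homog.FullSubcategory) (Z T : D) :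
    (c X (Z ⊗ T)).hom =
      (α_ X.obj Z T).inv ≫ (c X Z).hom ▷ T ≫ (α_ ((γ (deg X)).obj Z) X.obj T).hom ≫
        (γ (deg X)).obj Z ◁ (c X T).hom ≫
          (α_ ((γ (deg X)).obj Z) ((γ (deg X)).obj T) X.obj).inv ≫
            eqToHom (h.γ_tensor (deg X) Z T).symm ▷ X.obj
  tensor_left (X Y : homog.FullSubcategory) (Z : D) :
    (c (h.tensor X Y) Z).hom =
      (α_ X.obj Y.obj Z).hom ≫ X.obj ◁ (c Y Z).hom ≫
        (α_ X.obj ((γ (deg Y)).obj Z) Y.obj).inv ≫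
          (c X ((γ (deg Y)).obj Z)).hom ▷ Y.obj ≫
            (α_ ((γ (deg X)).obj ((γ (deg Y)).obj Z)) X.obj Y.obj).hom ≫
              eqToHom (h.obj_tensor X Y Z).symm ▷ (X.obj ⊗ Y.obj)
  γ_braiding (g : G) (X : homog.FullSubcategory) (Y : D) :
    (γ g).map (c X Y).hom =
      eqToHom (h.γ_tensor g X.obj Y) ≫ (c (h.act g X) ((γ g).obj Y)).hom ≫
        eqToHom (h.obj_act g X Y).symm ▷ (γ g).obj X.obj ≫
          eqToHom (h.γ_tensor g ((γ (deg X)).obj Y) X.obj).symm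

end Crossed

section Hypotheses

variable (F : Type u) [Field F] {C : Type w} [Category.{v} C]

/-- `C` is semisimple with finite dimensional spaces of morphisms and `End 𝟙 = F id`. -/
structure IsTensorCategory (F : Type u) [Field F] (C : Type w) [Category.{v} C] [Preadditive C]
    [Linear F C] [MonoidalCategory C] : Prop where
  semisimple (X : C) : ∃ (n : ℕ) (Y : Fin n → C), (∀ i, Simple (Y i)) ∧ IsDirectSum X Y
  finiteDimensional (X Y : C) : FiniteDimensional F (X ⟶ Y)
  end_unit : Function.Bijective (fun a : F => a • 𝟙 (𝟙_ C))

/-- A ribbon structure (twist) on a rigid braided category. -/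
structure RibbonStructure (C : Type w) [Category.{v} C] [MonoidalCategory C] [BraidedCategory C]
    [RigidCategory C] where
  /-- the twist of `X` -/
  twist (X : C) : X ≅ X
  naturality {X Y : C} (s : X ⟶ Y) : s ≫ (twist Y).hom = (twist X).hom ≫ s
  twist_tensor (X Y : C) :
    (twist (X ⊗ Y)).hom = ((twist X).hom ⊗ₘ (twist Y).hom) ≫ (β_ X Y).hom ≫ (β_ Y X).hom
  twist_dual (X : C) : (twist Xᘁ).hom = (twist X).homᘁ

/-- The dimension of `X`, as an endomorphism of the unit object. -/
def RibbonStructure.dim [MonoidalCategory C] [BraidedCategory C] [RigidCategory C]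
    (θ : RibbonStructure C) (X : C) : 𝟙_ C ⟶ 𝟙_ C :=
  η_ X Xᘁ ≫ (θ.twist X).hom ▷ Xᘁ ≫ (β_ X Xᘁ).hom ≫ ε_ X Xᘁ

/-- The full subcategory `S` (containing the unit and closed under tensor products, by `IsMonoidal`)
is a symmetric tensor category with finitely many classes of simple objects: it is closed, up to
isomorphism, under duals, finite direct sums and direct summands, and its objects are transparent
to each other. -/
structure IsFiniteSubSTC [Preadditive C] [HasBinaryBiproducts C] [MonoidalCategory C]
    [BraidedCategory C] [RigidCategory C] (S : ObjectProperty C) : Prop where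
  symmetric (X Y : C) (hX : S X) (hY : S Y) : (β_ X Y).hom ≫ (β_ Y X).hom = 𝟙 (X ⊗ Y)
  dual (X : C) (hX : S X) : S.isoClosure Xᘁ
  zero (X : C) (hX : IsZero X) : S.isoClosure X
  biprod (X Y : C) (hX : S X) (hY : S Y) : S.isoClosure (X ⊞ Y)
  retract (X Y : C) (hX : S X) (r : Retract Y X) : S.isoClosure Y
  finite : ∃ (n : ℕ) (Y : Fin n → C), ∀ X : C, S X → Simple X → ∃ i, Nonempty (X ≅ Y i)

/-- A positive `*`-operation on a monoidal `F`-linear category, antilinear with respect to the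
involution `conj` of `F`. -/
structure PositiveStar (conj : F → F) (D : Type*) [Category D] [Preadditive D] [Linear F D]
    [MonoidalCategory D] where
  /-- the operation `s ↦ s^*` -/
  star {X Y : D} (s : X ⟶ Y) : Y ⟶ X
  star_star {X Y : D} (s : X ⟶ Y) : star (star s) = s
  star_add {X Y : D} (s t : X ⟶ Y) : star (s + t) = star s + star t
  star_smul {X Y : D} (a : F) (s : X ⟶ Y) : star (a • s) = conj a • star s
  star_id (X : D) : star (𝟙 X) = 𝟙 X
  star_comp {X Y Z : D} (s : X ⟶ Y) (t : Y ⟶ Z) : star (s ≫ t) = star t ≫ star s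
  star_tensor {X Y X' Y' : D} (s : X ⟶ Y) (t : X' ⟶ Y') : star (s ⊗ₘ t) = star s ⊗ₘ star t
  star_associator (X Y Z : D) : star (α_ X Y Z).hom = (α_ X Y Z).inv
  star_leftUnitor (X : D) : star (λ_ X).hom = (λ_ X).inv
  star_rightUnitor (X : D) : star (ρ_ X).hom = (ρ_ X).inv
  positive {X Y : D} (s : X ⟶ Y) (hs : s ≫ star s = 0) : s = 0

/-- `S` is admissible: either `F` is the field of complex numbers, `S` is a `*`-category and its
objects have trivial twist, or `F` has characteristic zero and the dimensions of the objects of `S`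
are non-negative integers. -/
def IsAdmissible [Preadditive C] [Linear F C] [MonoidalCategory C] [BraidedCategory C]
    [RigidCategory C] (θ : RibbonStructure C) (S : ObjectProperty C) [S.IsMonoidal] : Prop :=
  (∃ e : F ≃+* ℂ,
      Nonempty (PositiveStar F (fun a => e.symm (starRingEnd ℂ (e a))) S.FullSubcategory) ∧
        ∀ X, S X → (θ.twist X).hom = 𝟙 X) ∨
    (CharZero F ∧ ∀ X, S X → ∃ n : ℕ, θ.dim X = (n : F) • 𝟙 (𝟙_ C))

end Hypotheses

end GaloisExt

/-! The object `Γ` is a cocommutative comonoid, and in `C̃_Γ` it splits into copies of the unit, one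
for each element of `G`. The translations give points `𝟙 ⟶ Γ` of `C̃_Γ`, and the invariant pairings
`(x, y) ↦ [x g = y]` on functions give the dual coordinates. `GaloisPairing` records what is needed
of this; it is checked by linear algebra for the regular representation and transported along the
monoidal functor.

The double braiding `Γ ⊗ X ⟶ Γ ⊗ X` of `C`, read as a morphism `X ⟶ Γ ⊗ X` of `C̃_Γ`, is natural in
`X` and satisfies the axioms of a coaction of `Γ` (`comp_monodromy`, `monodromy_comp_monodromy`,
`monodromy_comp_counit`). Evaluating it at the coordinates of `Γ` gives natural orthogonal
idempotents `proj g X` with sum `𝟙 X`, hence a `G`-grading. No transparency is needed: the grading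
measures exactly how far `X` is from having trivial monodromy with `Γ`. On the part of grade `g` the
monodromy is the point `shift g X`, and this is equivalent to the grade condition on the inverse
monodromy (`isOfGrade_iff_exists`).

Grades multiply under `⊗` by the hexagon identities and are conjugated by the action because
braidings are natural. Pulling `t : Γ ⊗ Y ⟶ Y'` past `X` costs one monodromy of `Γ` with `X`; in
grade `g` this is translation by `g⁻¹`, so `t` becomes `γ_g t`. This single computation
(`tensorHom_comp_braiding`) contains the naturality of the crossed braiding; the remaining laws are
those of `C` with idempotents inserted.

Homogeneous objects are closed under `⊗` because a tensor product of non-zero objects is non-zero.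
That follows from rigidity, from `Hom(Γ, 𝟙) = F ε`, which makes the endomorphisms of the unit of
`C̃_Γ` scalars, and from von Neumann regularity (`f h f = f`). Regularity holds in the semisimple
category `C`, passes to `C̃_Γ` because a morphism there is a retract of a morphism of `C`, and
together with finite dimensionality makes the idempotent completion semisimple. A simple object has
a grade since one of its grading idempotents is the identity.

The endomorphisms of the monoid `Γ` are the translations because a character of the algebra of
functions on `G` is an evaluation. -/

namespace GaloisExt

open scoped ComonObj

/-! ### Composition in `C̃_Γ` with morphisms coming from `C` -/

section Calculus

variable {C : Type u} [Category.{v} C] [MonoidalCategory C]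
variable {Γ : C} [ComonObj Γ]

namespace Pre

@[simp] lemma ofHom_hom {X Y : Pre Γ} (s : X.obj ⟶ Y.obj) :
    (ofHom s : X ⟶ Y).hom = ε[Γ] ▷ X.obj ≫ (λ_ X.obj).hom ≫ s := rfl

lemma comp_ofHom_hom {X Y Z : Pre Γ} (s : X ⟶ Y) (t : Y.obj ⟶ Z.obj) :
    Hom.hom (s ≫ (ofHom t : Y ⟶ Z)) = s.hom ≫ t := comp_incl_map_hom s t

lemma ofHom_comp_hom {X Y Z : Pre Γ} (s : X.obj ⟶ Y.obj) (t : Y ⟶ Z) :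
    Hom.hom ((ofHom s : X ⟶ Y) ≫ t) = Γ ◁ s ≫ t.hom := incl_map_comp_hom s t

lemma ofHom_comp {X Y Z : Pre Γ} (s : X.obj ⟶ Y.obj) (t : Y.obj ⟶ Z.obj) :
    (ofHom (s ≫ t) : X ⟶ Z) = (ofHom s : X ⟶ Y) ≫ ofHom t := (incl Γ).map_comp s t

lemma ofHom_id (X : Pre Γ) : (ofHom (𝟙 X.obj) : X ⟶ X) = 𝟙 X := (incl Γ).map_id X.obj

end Pre
end Calculus

/-! ### Tensor products in `C̃_Γ` and the monodromy with `Γ` -/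

section BraidedCalculus

variable {C : Type u} [Category.{v} C] [MonoidalCategory C] [BraidedCategory C]
variable {Γ : C} [ComonObj Γ] [IsCommComonObj Γ]

namespace Pre

lemma whiskerRight_hom {X Y : Pre Γ} (s : X ⟶ Y) (Z : Pre Γ) :
    Hom.hom (s ▷ Z) = (α_ Γ X.obj Z.obj).inv ≫ s.hom ▷ Z.obj := by
  change Δ[Γ] ▷ (X.obj ⊗ Z.obj) ≫ tensorμ Γ Γ X.obj Z.obj ≫
    (s.hom ⊗ₘ (ε[Γ] ▷ Z.obj ≫ (λ_ Z.obj).hom)) = _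
  have e1 := tensorμ_natural_left (𝟙 Γ) ε[Γ] X.obj Z.obj
  simp only [id_tensorHom, id_whiskerRight] at e1
  have e2 : (s.hom ⊗ₘ (ε[Γ] ▷ Z.obj ≫ (λ_ Z.obj).hom)) =
      (Γ ⊗ X.obj) ◁ (ε[Γ] ▷ Z.obj) ≫ (Γ ⊗ X.obj) ◁ (λ_ Z.obj).hom ≫ s.hom ▷ Z.obj := by
    simp [MonoidalCategory.tensorHom_def']
  rw [e2, ← reassoc_of% e1, ← comp_whiskerRight_assoc, ComonObj.comul_counit]
  simp only [tensorμ, braiding_tensorUnit_left]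
  monoidal

/-- The counit removes the copy of `Γ` that belongs to `Z`, and the other copy has to cross `Z` to
reach `s`. This crossing has no counterpart in `whiskerRight_hom`; the asymmetry is the source of
the monodromy below. -/
lemma whiskerLeft_hom {X Y : Pre Γ} (Z : Pre Γ) (s : X ⟶ Y) :
    Hom.hom (Z ◁ s) = (α_ Γ Z.obj X.obj).inv ≫ (β_ Γ Z.obj).hom ▷ X.obj ≫
      (α_ Z.obj Γ X.obj).hom ≫ Z.obj ◁ s.hom := by
  change Δ[Γ] ▷ (Z.obj ⊗ X.obj) ≫ tensorμ Γ Γ Z.obj X.obj ≫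
    ((ε[Γ] ▷ Z.obj ≫ (λ_ Z.obj).hom) ⊗ₘ s.hom) = _
  have e1 := tensorμ_natural_left ε[Γ] (𝟙 Γ) Z.obj X.obj
  simp only [tensorHom_id, id_whiskerRight] at e1
  have e2 : ((ε[Γ] ▷ Z.obj ≫ (λ_ Z.obj).hom) ⊗ₘ s.hom) =
      (ε[Γ] ▷ Z.obj) ▷ (Γ ⊗ X.obj) ≫ (λ_ Z.obj).hom ▷ (Γ ⊗ X.obj) ≫ Z.obj ◁ s.hom := by
    rw [MonoidalCategory.tensorHom_def, comp_whiskerRight, Category.assoc]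
  rw [e2, ← reassoc_of% e1, ← comp_whiskerRight_assoc, ComonObj.counit_comul]
  simp only [tensorμ]
  monoidal

lemma ofHom_whiskerRight {X Y : Pre Γ} (s : X.obj ⟶ Y.obj) (Z : Pre Γ) :
    (ofHom s : X ⟶ Y) ▷ Z = (ofHom (s ▷ Z.obj) : (X ⊗ Z : Pre Γ) ⟶ Y ⊗ Z) := by
  ext; rw [whiskerRight_hom]; simp

lemma ofHom_whiskerLeft {X Y : Pre Γ} (Z : Pre Γ) (s : X.obj ⟶ Y.obj) :
    Z ◁ (ofHom s : X ⟶ Y) = (ofHom (Z.obj ◁ s) : (Z ⊗ X : Pre Γ) ⟶ Z ⊗ Y) := by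
  have h := incl_map_tensor (Γ := Γ) (𝟙 Z.obj) s
  rw [(incl Γ).map_id, MonoidalCategory.id_tensorHom, MonoidalCategory.id_tensorHom] at h
  exact h

lemma associator_eq (X Y Z : Pre Γ) : (α_ X Y Z).hom = ofHom (α_ X.obj Y.obj Z.obj).hom := rfl
lemma associator_inv_eq (X Y Z : Pre Γ) :
    (α_ X Y Z).inv = ofHom (α_ X.obj Y.obj Z.obj).inv := rfl
lemma leftUnitor_eq (X : Pre Γ) : (λ_ X).hom = ofHom (λ_ X.obj).hom := rfl
lemma leftUnitor_inv_eq (X : Pre Γ) : (λ_ X).inv = ofHom (λ_ X.obj).inv := rfl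
/-- The braiding of `C` is natural in the first variable with respect to `C̃_Γ`. -/
lemma whiskerRight_comp_braiding {X X' : Pre Γ} (s : X ⟶ X') (Y : Pre Γ) :
    s ▷ Y ≫ (ofHom (β_ X'.obj Y.obj).hom : X' ⊗ Y ⟶ Y ⊗ X') =
      (ofHom (β_ X.obj Y.obj).hom : X ⊗ Y ⟶ Y ⊗ X) ≫ Y ◁ s := by
  ext
  rw [comp_ofHom_hom, ofHom_comp_hom, whiskerLeft_hom, whiskerRight_hom]
  simp

/-- The universal morphism `X ⟶ Γ ⊗ X` of `C̃_Γ`. -/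
def pt (X : Pre Γ) : X ⟶ ⟨Γ⟩ ⊗ X := ⟨𝟙 _⟩

@[simp] lemma pt_hom (X : Pre Γ) : (pt X).hom = 𝟙 _ := rfl

lemma pt_comp_ofHom {X Y : Pre Γ} (s : X ⟶ Y) : pt X ≫ (ofHom s.hom : ⟨Γ⟩ ⊗ X ⟶ Y) = s := by
  ext
  rw [comp_ofHom_hom, pt_hom, Category.id_comp]

/-- The monodromy of `Γ` and `X`, as a morphism `X ⟶ Γ ⊗ X` of `C̃_Γ`. -/
def monodromy (X : Pre Γ) : X ⟶ ⟨Γ⟩ ⊗ X := ⟨(β_ Γ X.obj).hom ≫ (β_ X.obj Γ).hom⟩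

@[simp] lemma monodromy_hom (X : Pre Γ) : (monodromy X).hom = (β_ Γ X.obj).hom ≫ (β_ X.obj Γ).hom := rfl

/-- Sliding `s` through the double braiding replaces it by the double braiding of `Γ` with `Γ ⊗ X`,
in which a braiding of `Γ` with `Γ` stands on each side of the monodromy with `X`. Cocommutativity
absorbs the first one into `Δ`; the second is the crossing in `whiskerLeft_hom`. -/
lemma comp_monodromy {X Y : Pre Γ} (s : X ⟶ Y) : s ≫ monodromy Y = monodromy X ≫ (⟨Γ⟩ : Pre Γ) ◁ s := by
  ext
  simp only [comp_hom, whiskerLeft_hom, monodromy_hom]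
  have h : Δ[Γ] ▷ X.obj ≫ (β_ Γ Γ).hom ▷ X.obj = Δ[Γ] ▷ X.obj := by
    rw [← comp_whiskerRight, IsCommComonObj.comul_comm]
  rw [BraidedCategory.braiding_naturality_right_assoc, BraidedCategory.braiding_naturality_left]
  simp only [BraidedCategory.braiding_tensor_right_hom, BraidedCategory.braiding_tensor_left_hom,
    Category.assoc, Iso.hom_inv_id_assoc, Iso.inv_hom_id_assoc]
  rw [reassoc_of% h]
  simp only [MonoidalCategory.whiskerLeft_comp, Category.assoc]

/-- Coassociativity of the coaction. Naturality moves `Δ` to the front, where it meets the monodromy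
of `Γ ⊗ Γ` with `X`. Two uses of Yang–Baxter bring the two iterated monodromies to the same form up
to a braiding of `Γ` with itself, which `Δ` absorbs. -/
lemma monodromy_comp_monodromy (X : Pre Γ) :
    monodromy X ≫ (⟨Γ⟩ : Pre Γ) ◁ monodromy X =
      monodromy X ≫ (ofHom Δ[Γ] : (⟨Γ⟩ : Pre Γ) ⟶ ⟨Γ⟩ ⊗ ⟨Γ⟩) ▷ X ≫ (α_ _ _ _).hom := by
  ext
  rw [ofHom_whiskerRight, associator_eq, ← ofHom_comp, comp_ofHom_hom]
  simp only [comp_hom, whiskerLeft_hom, monodromy_hom]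
  have h : Δ[Γ] ▷ X.obj ≫ (β_ Γ Γ).hom ▷ X.obj = Δ[Γ] ▷ X.obj := by
    rw [← comp_whiskerRight, IsCommComonObj.comul_comm]
  have hY := BraidedCategory.yang_baxter Γ Γ X.obj
  rw [Category.assoc, ← BraidedCategory.braiding_naturality_right_assoc,
    ← BraidedCategory.braiding_naturality_left_assoc]
  simp only [tensorObj_obj, BraidedCategory.braiding_tensor_right_hom, BraidedCategory.braiding_tensor_left_hom,
    Category.assoc, Iso.hom_inv_id_assoc, Iso.inv_hom_id, Category.comp_id,
    MonoidalCategory.whiskerLeft_comp]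
  have hY' := BraidedCategory.yang_baxter Γ X.obj Γ
  have hY'' : ∀ {Z : C} (f : Γ ⊗ X.obj ⊗ Γ ⟶ Z),
      Γ ◁ (β_ X.obj Γ).hom ≫ (α_ Γ Γ X.obj).inv ≫ (β_ Γ Γ).hom ▷ X.obj ≫ (α_ Γ Γ X.obj).hom ≫
        Γ ◁ (β_ Γ X.obj).hom ≫ f =
      (α_ Γ X.obj Γ).inv ≫ (β_ Γ X.obj).hom ▷ Γ ≫ (α_ X.obj Γ Γ).hom ≫ X.obj ◁ (β_ Γ Γ).hom ≫
        (α_ X.obj Γ Γ).inv ≫ (β_ X.obj Γ).hom ▷ Γ ≫ (α_ Γ X.obj Γ).hom ≫ f := fun f => by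
    simpa only [Category.assoc] using congr($hY'.symm ≫ f)
  rw [hY'', ← reassoc_of% hY]
  simp only [Iso.hom_inv_id_assoc, reassoc_of% h]

lemma monodromy_comp_counit (X : Pre Γ) :
    monodromy X ≫ (ofHom (ε[Γ] ▷ X.obj ≫ (λ_ X.obj).hom) : (⟨Γ⟩ ⊗ X : Pre Γ) ⟶ X) = 𝟙 X := by
  ext
  rw [comp_ofHom_hom, monodromy_hom, Category.assoc,
    ← BraidedCategory.braiding_naturality_right_assoc,
    ← BraidedCategory.braiding_naturality_left_assoc]
  simp

/-- Both hexagons: the strand `Γ` crosses `X`, performs the full monodromy with `Y`, and crosses `X`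
back. The first crossing is hidden in the whiskering by `X`. -/
lemma monodromy_tensor (X Y : Pre Γ) :
    monodromy (X ⊗ Y) = X ◁ monodromy Y ≫ (ofHom ((α_ X.obj Γ Y.obj).inv ≫ (β_ X.obj Γ).hom ▷ Y.obj ≫
      (α_ Γ X.obj Y.obj).hom) : X ⊗ (⟨Γ⟩ ⊗ Y) ⟶ ⟨Γ⟩ ⊗ X ⊗ Y) := by
  ext
  rw [comp_ofHom_hom, whiskerLeft_hom]
  simp

end Pre
end BraidedCalculus

/-! ### Additivity of the tensor product of `C̃_Γ` -/

section Preadditive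

variable {C : Type u} [Category.{v} C] [MonoidalCategory C] [BraidedCategory C]
variable [Preadditive C] [MonoidalPreadditive C]
variable {Γ : C} [ComonObj Γ] [IsCommComonObj Γ]

namespace Pre

instance : MonoidalPreadditive (Pre Γ) where
  whiskerLeft_zero := by intros; ext; simp [whiskerLeft_hom]
  zero_whiskerRight := by intros; ext; simp [whiskerRight_hom]
  whiskerLeft_add _ _ := by ext; simp [whiskerLeft_hom]
  add_whiskerRight _ _ := by ext; simp [whiskerRight_hom]

/-- The underlying morphism of `C`, as an additive map. -/
def homAddHom (X Y : Pre Γ) : (X ⟶ Y) →+ (Γ ⊗ X.obj ⟶ Y.obj) where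
  toFun s := s.hom
  map_zero' := rfl
  map_add' _ _ := rfl

lemma sum_hom {ι : Type*} (I : Finset ι) {X Y : Pre Γ} (s : ι → (X ⟶ Y)) :
    (∑ i ∈ I, s i : X ⟶ Y).hom = ∑ i ∈ I, (s i).hom :=
  map_sum (homAddHom X Y) s I

end Pre

end Preadditive

/-! ### Reparametrisation of morphisms by comonoid endomorphisms of `Γ` -/

section Twist

variable {C : Type u} [Category.{v} C] [MonoidalCategory C] [BraidedCategory C]
variable {Γ : C} [ComonObj Γ]

namespace Pre

variable (φ : Γ ⟶ Γ) [IsComonHom φ]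

/-- The map `s ↦ s ∘ (φ ⊗ id_X)` on morphisms of `C̃_Γ`. -/
def twistHom {X Y : Pre Γ} (s : X ⟶ Y) : X ⟶ Y := (twist φ).map s

@[simp] lemma twistHom_hom {X Y : Pre Γ} (s : X ⟶ Y) :
    (twistHom φ s).hom = φ ▷ X.obj ≫ s.hom := rfl

lemma twistHom_comp {X Y Z : Pre Γ} (s : X ⟶ Y) (t : Y ⟶ Z) :
    twistHom φ (s ≫ t) = twistHom φ s ≫ twistHom φ t := (twist φ).map_comp s t

lemma twistHom_ofHom {X Y : Pre Γ} (s : X.obj ⟶ Y.obj) :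
    twistHom φ (ofHom s : X ⟶ Y) = ofHom s := by
  ext
  change φ ▷ X.obj ≫ ε[Γ] ▷ X.obj ≫ _ = ε[Γ] ▷ X.obj ≫ _
  rw [← comp_whiskerRight_assoc, IsComonHom.hom_counit]

lemma twistHom_tensorHom [IsCommComonObj Γ] {X Y Z T : Pre Γ} (s : X ⟶ Y) (t : Z ⟶ T) :
    twistHom φ (s ⊗ₘ t) = twistHom φ s ⊗ₘ twistHom φ t := by
  ext
  change φ ▷ (X.obj ⊗ Z.obj) ≫ Δ[Γ] ▷ (X.obj ⊗ Z.obj) ≫ tensorμ Γ Γ X.obj Z.obj ≫ (s.hom ⊗ₘ t.hom) =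
    Δ[Γ] ▷ (X.obj ⊗ Z.obj) ≫ tensorμ Γ Γ X.obj Z.obj ≫
      ((φ ▷ X.obj ≫ s.hom) ⊗ₘ (φ ▷ Z.obj ≫ t.hom))
  rw [← comp_whiskerRight_assoc, IsComonHom.hom_comul, comp_whiskerRight_assoc,
    tensorμ_natural_left_assoc, tensorHom_comp_tensorHom]

end Pre

end Twist

/-- A finite group `G` acting on a comonoid `Γ` by comonoid endomorphisms, together with pairings
that exhibit the points `𝟙 ⟶ Γ` of `C̃_Γ` given by the action as a decomposition of `Γ` into a direct
sum of copies of `𝟙` in `C̃_Γ`. -/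
structure GaloisPairing {C : Type u} [Category.{v} C] [MonoidalCategory C] [Preadditive C]
    (Γ : C) [ComonObj Γ] (G : Type w) [Group G] [Fintype G] where
  /-- the action of `G` -/
  act : G → (Γ ⟶ Γ)
  isComonHom (g : G) : IsComonHom (act g)
  act_one : act 1 = 𝟙 Γ
  act_mul (g h : G) : act (g * h) = act h ≫ act g
  /-- the pairings -/
  pairing : G → (Γ ⊗ Γ ⟶ 𝟙_ C)
  comul_pairing (g : G) : Γ ◁ Δ[Γ] ≫ (α_ Γ Γ Γ).inv ≫ pairing g ▷ Γ ≫ (λ_ Γ).hom =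
    Δ[Γ] ▷ Γ ≫ (α_ Γ Γ Γ).hom ≫ Γ ◁ pairing g ≫ (ρ_ Γ).hom ≫ act g⁻¹
  act_pairing_self (g : G) : Δ[Γ] ≫ Γ ◁ act g⁻¹ ≫ pairing g = ε[Γ]
  act_pairing_of_ne (g h : G) : g ≠ h → Δ[Γ] ≫ Γ ◁ act g⁻¹ ≫ pairing h = 0
  sum_pairing : ∑ g, pairing g = ε[Γ] ▷ Γ ≫ (λ_ Γ).hom ≫ ε[Γ]

/-! ### The grading defined by the monodromy with `Γ` -/

namespace GaloisPairing

variable {C : Type u} [Category.{v} C] [MonoidalCategory C] [BraidedCategory C]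
variable [Preadditive C] [MonoidalPreadditive C]
variable {Γ : C} [ComonObj Γ] [IsCommComonObj Γ] {G : Type w} [Group G] [Fintype G]
variable (T : GaloisPairing Γ G)

open Pre

attribute [instance] GaloisPairing.isComonHom

/-- The point `𝟙 ⟶ Γ` of `C̃_Γ` that belongs to `g`. -/
def point (g : G) : 𝟙_ (Pre Γ) ⟶ ⟨Γ⟩ := ⟨(ρ_ Γ).hom ≫ T.act g⁻¹⟩

/-- The coordinate `Γ ⟶ 𝟙` in `C̃_Γ` that belongs to `g`. -/
def coord (g : G) : (⟨Γ⟩ : Pre Γ) ⟶ 𝟙_ (Pre Γ) := ⟨T.pairing g⟩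

/-- The morphism `X ⟶ Γ ⊗ X` of `C̃_Γ` given by the point of `Γ` that belongs to `g`. -/
def shift (g : G) (X : Pre Γ) : X ⟶ ⟨Γ⟩ ⊗ X := ⟨T.act g⁻¹ ▷ X.obj⟩

@[simp] lemma point_hom (g : G) : (T.point g).hom = (ρ_ Γ).hom ≫ T.act g⁻¹ := rfl
@[simp] lemma coord_hom (g : G) : (T.coord g).hom = T.pairing g := rfl
@[simp] lemma shift_hom (g : G) (X : Pre Γ) : (T.shift g X).hom = T.act g⁻¹ ▷ X.obj := rfl

/-- Since `shift` only inserts a point of `Γ` beside `X`, its naturality and its pairing with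
coordinates reduce to interchange and to the duality of points and coordinates. -/
lemma shift_eq (g : G) (X : Pre Γ) : T.shift g X = (λ_ X).inv ≫ T.point g ▷ X := by
  ext
  rw [leftUnitor_inv_eq, ofHom_comp_hom, whiskerRight_hom]
  simp

lemma shift_one (X : Pre Γ) : T.shift 1 X = pt X := by
  ext
  simp [T.act_one]

lemma shift_mul (g h : G) (X : Pre Γ) :
    T.shift (g * h) X = T.shift g X ≫ (ofHom (T.act h⁻¹ ▷ X.obj) : (⟨Γ⟩ ⊗ X : Pre Γ) ⟶ ⟨Γ⟩ ⊗ X) := by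
  ext
  rw [comp_ofHom_hom]
  simp [T.act_mul]

lemma comp_shift (g : G) {X Y : Pre Γ} (s : X ⟶ Y) :
    s ≫ T.shift g Y = T.shift g X ≫ (⟨Γ⟩ : Pre Γ) ◁ s := by
  rw [shift_eq, shift_eq, Category.assoc, ← whisker_exchange, leftUnitor_inv_naturality_assoc]

lemma point_coord_self (g : G) : T.point g ≫ T.coord g = 𝟙 _ := by
  ext
  rw [comp_hom, point_hom, coord_hom, id_hom]
  have := T.act_pairing_self g
  simp only [MonoidalCategory.whiskerLeft_comp, Category.assoc, tensorUnit_obj]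
  rw [← MonoidalCategory.rightUnitor_tensor_hom_assoc, rightUnitor_naturality_assoc, this]
  simp [unitors_equal]

lemma point_coord_of_ne {g h : G} (hg : g ≠ h) : T.point g ≫ T.coord h = 0 := by
  ext
  rw [comp_hom, point_hom, coord_hom, zero_hom]
  have := T.act_pairing_of_ne g h hg
  simp only [MonoidalCategory.whiskerLeft_comp, Category.assoc, tensorUnit_obj]
  rw [← MonoidalCategory.rightUnitor_tensor_hom_assoc, rightUnitor_naturality_assoc, this]
  simp

lemma sum_coord : ∑ g, T.coord g = (ofHom ε[Γ] : (⟨Γ⟩ : Pre Γ) ⟶ 𝟙_ (Pre Γ)) := by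
  ext
  rw [sum_hom]
  exact T.sum_pairing

/-- The points are grouplike in dual form. This is the axiom `comul_pairing` read in `C̃_Γ`; it is
what makes the components of a coaction orthogonal idempotents. -/
lemma comul_coord (g : G) :
    (ofHom Δ[Γ] : (⟨Γ⟩ : Pre Γ) ⟶ ⟨Γ⟩ ⊗ ⟨Γ⟩) ≫ T.coord g ▷ ⟨Γ⟩ ≫ (λ_ _).hom =
      T.coord g ≫ T.point g := by
  ext
  rw [leftUnitor_eq, ofHom_comp_hom, comp_ofHom_hom, whiskerRight_hom]
  simpa using T.comul_pairing g

/-- The evaluation of the monodromy at `g`: the projection of `X` onto its part of grade `g`. -/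
def proj (g : G) (X : Pre Γ) : X ⟶ X := monodromy X ≫ T.coord g ▷ X ≫ (λ_ X).hom

lemma coord_comp (g : G) {X Y : Pre Γ} (s : X ⟶ Y) :
    (T.coord g ▷ X ≫ (λ_ X).hom) ≫ s =
      (⟨Γ⟩ : Pre Γ) ◁ s ≫ T.coord g ▷ Y ≫ (λ_ Y).hom := by
  rw [Category.assoc, ← leftUnitor_naturality, whisker_exchange_assoc]

lemma comp_proj (g : G) {X Y : Pre Γ} (s : X ⟶ Y) : s ≫ T.proj g Y = T.proj g X ≫ s := by
  rw [proj, proj, Category.assoc, T.coord_comp, reassoc_of% comp_monodromy s]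

/-- Coassociativity replaces the second monodromy by `Δ` on the coefficient, and `comul_coord`
evaluates this to the point of `g`. Idempotence and orthogonality of the projections are then
pairings of a point with a coordinate. -/
lemma proj_monodromy (g : G) (X : Pre Γ) :
    T.proj g X ≫ monodromy X = T.proj g X ≫ T.shift g X := by
  rw [proj, Category.assoc, T.coord_comp, reassoc_of% monodromy_comp_monodromy X]
  have h := congrArg (fun f => f ▷ X) (T.comul_coord g)
  simp only [comp_whiskerRight] at h
  rw [shift_eq, Category.assoc, Category.assoc, Iso.hom_inv_id_assoc, ← h,
    ← associator_naturality_left_assoc, leftUnitor_whiskerRight]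

lemma shift_coord_self (g : G) (X : Pre Γ) :
    T.shift g X ≫ T.coord g ▷ X ≫ (λ_ X).hom = 𝟙 X := by
  rw [shift_eq, Category.assoc, ← comp_whiskerRight_assoc, T.point_coord_self]
  simp

lemma shift_coord_of_ne {g h : G} (hg : g ≠ h) (X : Pre Γ) :
    T.shift g X ≫ T.coord h ▷ X ≫ (λ_ X).hom = 0 := by
  rw [shift_eq, Category.assoc, ← comp_whiskerRight_assoc, T.point_coord_of_ne hg]
  simp

lemma proj_proj_self (g : G) (X : Pre Γ) : T.proj g X ≫ T.proj g X = T.proj g X := by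
  conv_lhs => rw [proj.eq_def T g X]
  -- The rewriting unfolds both factors; the first is folded back for `proj_monodromy`.
  change T.proj g X ≫ _ = _
  rw [reassoc_of% T.proj_monodromy g X, T.shift_coord_self, Category.comp_id]

lemma proj_proj_of_ne {g h : G} (hg : g ≠ h) (X : Pre Γ) : T.proj g X ≫ T.proj h X = 0 := by
  rw [proj.eq_def T h X, reassoc_of% T.proj_monodromy g X, T.shift_coord_of_ne hg, comp_zero]

lemma sum_proj (X : Pre Γ) : ∑ g, T.proj g X = 𝟙 X := by
  have h : ∑ g, (T.coord g ▷ X) = (ofHom ε[Γ] : (⟨Γ⟩ : Pre Γ) ⟶ 𝟙_ (Pre Γ)) ▷ X := by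
    rw [← T.sum_coord, sum_whiskerRight]
  simp only [proj]
  rw [← Preadditive.comp_sum, ← Preadditive.sum_comp, h, ofHom_whiskerRight, leftUnitor_eq,
    ← ofHom_comp]
  exact monodromy_comp_counit X

/-- The sum over `g` of `comul_coord` is a counit law. With the duality of points and coordinates
this exhibits `Γ` as a sum of copies of the unit in `C̃_Γ`. -/
lemma sum_coord_point : ∑ g, T.coord g ≫ T.point g = 𝟙 _ := by
  simp only [← T.comul_coord]
  rw [← Preadditive.comp_sum, ← Preadditive.sum_comp, ← sum_whiskerRight, T.sum_coord,
    ofHom_whiskerRight, leftUnitor_eq, ← ofHom_comp, ← ofHom_comp, ← ofHom_id]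
  congr 1
  simp

end GaloisPairing

/-! ### Objects of a given grade: commutation, tensor products, conjugation, semisimplicity -/

namespace GaloisPairing

variable {C : Type u} [Category.{v} C] [MonoidalCategory C] [BraidedCategory C]
variable [Preadditive C] [MonoidalPreadditive C]
variable {Γ : C} [ComonObj Γ] [IsCommComonObj Γ] {G : Type w} [Group G] [Fintype G]
variable (T : GaloisPairing Γ G)

open Pre

/-- The morphism `s` factors through the part of grade `g` of its target. -/
lemma comp_proj_eq_self_iff {X Y : Pre Γ} (s : X ⟶ Y) (g : G) :
    s ≫ T.proj g Y = s ↔ s ≫ monodromy Y = s ≫ T.shift g Y := by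
  constructor
  · intro h
    rw [← h, Category.assoc, Category.assoc, T.proj_monodromy]
  · intro h
    rw [proj, reassoc_of% h, T.shift_coord_self, Category.comp_id]

/-- A morphism into the part of grade `g` is moved to the right by the braiding, at the cost of the
action of `g`. -/
lemma tensorHom_comp_braiding {X X' Y Y' : Pre Γ} {g : G} (s : X ⟶ X') (hs : s ≫ T.proj g X' = s)
    (t : Y ⟶ Y') :
    (s ⊗ₘ t) ≫ (ofHom (β_ X'.obj Y'.obj).hom : X' ⊗ Y' ⟶ Y' ⊗ X') =
      (ofHom (β_ X.obj Y.obj).hom : X ⊗ Y ⟶ Y ⊗ X) ≫ (twistHom (T.act g⁻¹) t ⊗ₘ s) := by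
  rw [T.comp_proj_eq_self_iff] at hs
  -- The coefficient strand of `t` crosses `X'` once because of the whiskering and once more when
  -- `t` slides through the braiding: together a full monodromy.
  have h1 : X' ◁ t ≫ (ofHom (β_ X'.obj Y'.obj).hom : X' ⊗ Y' ⟶ Y' ⊗ X') =
      monodromy X' ▷ Y ≫ (ofHom ((α_ Γ X'.obj Y.obj).hom ≫ Γ ◁ (β_ X'.obj Y.obj).hom ≫
        (α_ Γ Y.obj X'.obj).inv ≫ t.hom ▷ X'.obj) : (⟨Γ⟩ ⊗ X') ⊗ Y ⟶ Y' ⊗ X') := by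
    ext
    rw [comp_ofHom_hom, comp_ofHom_hom, whiskerLeft_hom, whiskerRight_hom]
    simp
  -- With the monodromy replaced by `shift g`, the coefficient is only translated by `g⁻¹`, and the
  -- translation is absorbed into `t`.
  have h2 : T.shift g X' ▷ Y ≫ (ofHom ((α_ Γ X'.obj Y.obj).hom ≫ Γ ◁ (β_ X'.obj Y.obj).hom ≫
        (α_ Γ Y.obj X'.obj).inv ≫ t.hom ▷ X'.obj) : (⟨Γ⟩ ⊗ X') ⊗ Y ⟶ Y' ⊗ X') =
      (ofHom (β_ X'.obj Y.obj).hom : X' ⊗ Y ⟶ Y ⊗ X') ≫ twistHom (T.act g⁻¹) t ▷ X' := by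
    ext
    rw [comp_ofHom_hom, ofHom_comp_hom, whiskerRight_hom]
    rw [whiskerRight_hom, shift_hom, twistHom_hom]
    simp only [comp_whiskerRight, tensorObj_obj, Category.assoc]
    rw [associator_naturality_left_assoc, Iso.inv_hom_id_assoc, ← whisker_exchange_assoc,
      associator_inv_naturality_left_assoc]
  rw [MonoidalCategory.tensorHom_def, Category.assoc, h1, ← comp_whiskerRight_assoc, hs,
    comp_whiskerRight_assoc, h2, reassoc_of% whiskerRight_comp_braiding s Y,
    MonoidalCategory.tensorHom_def']

/-- The object `P` of the idempotent completion lies in grade `g`. -/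
def IsOfGrade (P : Karoubi (Pre Γ)) (g : G) : Prop := P.p ≫ T.proj g P.X = P.p

variable {T}

lemma IsOfGrade.monodromy {P : Karoubi (Pre Γ)} {g : G} (h : T.IsOfGrade P g) :
    P.p ≫ Pre.monodromy P.X = P.p ≫ T.shift g P.X :=
  (T.comp_proj_eq_self_iff _ _).1 h

lemma IsOfGrade.comp_proj {P Q : Karoubi (Pre Γ)} {g : G} (h : T.IsOfGrade Q g) (s : P ⟶ Q) :
    s.f ≫ T.proj g Q.X = s.f := by
  rw [← Karoubi.comp_p s, Category.assoc, h]

lemma IsOfGrade.comp_proj' {P Q : Karoubi (Pre Γ)} {g : G} (h : T.IsOfGrade P g) (s : P ⟶ Q) :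
    s.f ≫ T.proj g Q.X = s.f := by
  rw [← Karoubi.p_comp s, Category.assoc, T.comp_proj, ← Category.assoc, h]

/-- By naturality of the projections the morphism is unchanged by both `proj g` and `proj h` at its
target, and these are orthogonal. -/
lemma IsOfGrade.hom_eq_zero {P Q : Karoubi (Pre Γ)} {g h : G} (hP : T.IsOfGrade P g)
    (hQ : T.IsOfGrade Q h) (s : P ⟶ Q) (hg : g ≠ h) : s = 0 := by
  ext1
  rw [← hQ.comp_proj s, ← hP.comp_proj' s, Category.assoc, T.proj_proj_of_ne hg, comp_zero]
  rfl

lemma IsOfGrade.tensor {P Q : Karoubi (Pre Γ)} {g h : G} (hP : T.IsOfGrade P g)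
    (hQ : T.IsOfGrade Q h) : T.IsOfGrade (P ⊗ Q) (g * h) := by
  refine (T.comp_proj_eq_self_iff _ _).2 ?_
  obtain ⟨X, p, hp⟩ := P
  obtain ⟨Y, q, hq⟩ := Q
  change (p ⊗ₘ q) ≫ Pre.monodromy (X ⊗ Y) = (p ⊗ₘ q) ≫ T.shift (g * h) (X ⊗ Y)
  have h1 := hP.monodromy
  have h2 := hQ.monodromy
  dsimp only at h1 h2
  -- Once the monodromy with `Y` is the translation by `h⁻¹`, the two crossings of `X` close up to
  -- the monodromy with `X`, and the translation commutes with them.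
  have h3 : X ◁ T.shift h Y ≫ (ofHom ((α_ X.obj Γ Y.obj).inv ≫ (β_ X.obj Γ).hom ▷ Y.obj ≫
      (α_ Γ X.obj Y.obj).hom) : X ⊗ (⟨Γ⟩ ⊗ Y) ⟶ ⟨Γ⟩ ⊗ X ⊗ Y) =
      Pre.monodromy X ▷ Y ≫ (ofHom ((T.act h⁻¹ ▷ X.obj) ▷ Y.obj ≫ (α_ Γ X.obj Y.obj).hom) :
        (⟨Γ⟩ ⊗ X) ⊗ Y ⟶ ⟨Γ⟩ ⊗ X ⊗ Y) := by
    ext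
    rw [comp_ofHom_hom, comp_ofHom_hom, whiskerLeft_hom, whiskerRight_hom]
    have h3 := congrArg (· ▷ Y.obj) (BraidedCategory.braiding_naturality_right X.obj (T.act h⁻¹))
    simp only [comp_whiskerRight] at h3
    simp only [shift_hom, monodromy_hom, tensorObj_obj, Category.assoc, comp_whiskerRight]
    rw [← reassoc_of% h3]
    simp
  have h4 : T.shift g X ▷ Y ≫ (ofHom ((T.act h⁻¹ ▷ X.obj) ▷ Y.obj ≫ (α_ Γ X.obj Y.obj).hom) :
        (⟨Γ⟩ ⊗ X) ⊗ Y ⟶ ⟨Γ⟩ ⊗ X ⊗ Y) = T.shift (g * h) (X ⊗ Y) := by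
    ext
    rw [comp_ofHom_hom, whiskerRight_hom]
    simp [T.act_mul]
  rw [monodromy_tensor, MonoidalCategory.tensorHom_def, Category.assoc, Category.assoc,
    ← MonoidalCategory.whiskerLeft_comp_assoc, h2, MonoidalCategory.whiskerLeft_comp_assoc, h3,
    ← whisker_exchange_assoc, ← comp_whiskerRight_assoc, h1, comp_whiskerRight_assoc, h4,
    ← whisker_exchange_assoc]

lemma IsOfGrade.unit : T.IsOfGrade (𝟙_ (Karoubi (Pre Γ))) 1 := by
  refine (T.comp_proj_eq_self_iff _ _).2 ?_
  rw [T.shift_one]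
  congr 1
  ext
  rw [monodromy_hom, pt_hom]
  simp

/-- Twist the equation between monodromy and `shift g` by `k⁻¹` and translate the resulting
coefficient by `k`: the monodromy commutes with translations and is unchanged, while `shift g` is
conjugated. The object `Q` is a variable so that `rfl` can identify it with an image under the
action. -/
lemma IsOfGrade.twist {P : Karoubi (Pre Γ)} {g : G} (hP : T.IsOfGrade P g) (k : G)
    {Q : Karoubi (Pre Γ)} (hQ : Q = ⟨P.X, twistHom (T.act k⁻¹) P.p,
      by rw [← twistHom_comp, P.idem]⟩) : T.IsOfGrade Q (k * g * k⁻¹) := by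
  subst hQ
  refine (T.comp_proj_eq_self_iff _ _).2 ?_
  obtain ⟨X, p, hp⟩ := P
  dsimp only
  have h1 : twistHom (T.act k⁻¹) (p ≫ Pre.monodromy X) ≫ ofHom (T.act k ▷ X.obj) =
      twistHom (T.act k⁻¹) (p ≫ T.shift g X) ≫
        (ofHom (T.act k ▷ X.obj) : (⟨Γ⟩ ⊗ X : Pre Γ) ⟶ ⟨Γ⟩ ⊗ X) := by
    rw [hP.monodromy]
  have h2 : twistHom (T.act k⁻¹) (Pre.monodromy X) ≫
      (ofHom (T.act k ▷ X.obj) : (⟨Γ⟩ ⊗ X : Pre Γ) ⟶ ⟨Γ⟩ ⊗ X) = Pre.monodromy X := by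
    ext
    rw [comp_ofHom_hom, twistHom_hom, monodromy_hom]
    simp only [Category.assoc, tensorObj_obj]
    rw [← BraidedCategory.braiding_naturality_right,
      ← BraidedCategory.braiding_naturality_left_assoc, ← comp_whiskerRight_assoc,
      ← T.act_mul, mul_inv_cancel, T.act_one]
    simp
  have h3 : twistHom (T.act k⁻¹) (T.shift g X) ≫
      (ofHom (T.act k ▷ X.obj) : (⟨Γ⟩ ⊗ X : Pre Γ) ⟶ ⟨Γ⟩ ⊗ X) = T.shift (k * g * k⁻¹) X := by
    ext
    rw [comp_ofHom_hom, twistHom_hom, shift_hom, shift_hom]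
    simp only [← comp_whiskerRight, ← T.act_mul, tensorObj_obj]
    congr 2
    group
  rwa [twistHom_comp, twistHom_comp, Category.assoc, Category.assoc, h2, h3] at h1

variable (T)

lemma point_one_comp_hom {X : Pre Γ} (d : (⟨Γ⟩ : Pre Γ) ⟶ X) :
    (T.point 1 ≫ d).hom = (ρ_ Γ).hom ≫ Δ[Γ] ≫ d.hom := by
  rw [comp_hom, point_hom, inv_one, T.act_one, Category.comp_id]
  simp only [tensorUnit_obj]
  rw [← MonoidalCategory.rightUnitor_tensor_hom_assoc, rightUnitor_naturality_assoc]

/-- Both conditions are compared after writing them as `pt` followed by a morphism of `C`. The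
monodromy is invertible there and commutes with translations, so either equation follows from the
other by composing with its inverse and a translation. -/
lemma isOfGrade_iff_monodromy_inv (P : Karoubi (Pre Γ)) (g : G) :
    T.IsOfGrade P g ↔ P.p ≫ pt P.X ≫
      (ofHom ((β_ P.X.obj Γ).inv ≫ (β_ Γ P.X.obj).inv) : (⟨Γ⟩ ⊗ P.X : Pre Γ) ⟶ ⟨Γ⟩ ⊗ P.X) =
        P.p ≫ T.shift g⁻¹ P.X := by
  obtain ⟨X, p, hp⟩ := P
  rw [IsOfGrade, T.comp_proj_eq_self_iff]
  have hm : Pre.monodromy X = pt X ≫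
      (ofHom ((β_ Γ X.obj).hom ≫ (β_ X.obj Γ).hom) : (⟨Γ⟩ ⊗ X : Pre Γ) ⟶ ⟨Γ⟩ ⊗ X) :=
    (pt_comp_ofHom _).symm
  have hs (k : G) : T.shift k X = pt X ≫
      (ofHom (T.act k⁻¹ ▷ X.obj) : (⟨Γ⟩ ⊗ X : Pre Γ) ⟶ ⟨Γ⟩ ⊗ X) := (pt_comp_ofHom _).symm
  dsimp only
  rw [hm, hs, hs, inv_inv]
  constructor
  · intro h
    have h' := congrArg (· ≫ (ofHom (((β_ X.obj Γ).inv ≫ (β_ Γ X.obj).inv) ≫ T.act g ▷ X.obj) :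
      (⟨Γ⟩ ⊗ X : Pre Γ) ⟶ ⟨Γ⟩ ⊗ X)) h
    simp only [Category.assoc, ← ofHom_comp] at h'
    rw [← Category.assoc _ _ (T.act g ▷ X.obj)] at h'
    simp only [Iso.hom_inv_id_assoc, Category.assoc] at h'
    rw [h']
    congr 3
    rw [← BraidedCategory.braiding_inv_naturality_right,
      ← BraidedCategory.braiding_inv_naturality_left_assoc, ← comp_whiskerRight_assoc, ← T.act_mul,
      mul_inv_cancel, T.act_one]
    simp
  · intro h
    have h' := congrArg (· ≫ (ofHom (((β_ Γ X.obj).hom ≫ (β_ X.obj Γ).hom) ≫ T.act g⁻¹ ▷ X.obj) :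
      (⟨Γ⟩ ⊗ X : Pre Γ) ⟶ ⟨Γ⟩ ⊗ X)) h
    simp only [Category.assoc, ← ofHom_comp] at h'
    simp only [Iso.inv_hom_id_assoc] at h'
    rw [h']
    congr 3
    rw [← BraidedCategory.braiding_naturality_right,
      ← BraidedCategory.braiding_naturality_left_assoc, ← comp_whiskerRight_assoc, ← T.act_mul,
      inv_mul_cancel, T.act_one]
    simp

/-- The bridge to `HasGrade`. The condition on `Δ[Γ] ≫ d.hom` says that `d` sends the point of `1`
to the point of `g⁻¹`; testing on that point gives the previous criterion. Conversely, knowledge at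
one point spreads to all points by translation, and the points span `Γ`. -/
lemma isOfGrade_iff_exists (P : Karoubi (Pre Γ)) (g : G) :
    T.IsOfGrade P g ↔ ∃ d : (⟨Γ⟩ : Pre Γ) ⟶ ⟨Γ⟩,
      (𝟙 (⟨Γ⟩ : Pre Γ) ⊗ₘ P.p) ≫ (ofHom ((β_ P.X.obj Γ).inv ≫ (β_ Γ P.X.obj).inv) :
        (⟨Γ⟩ ⊗ P.X : Pre Γ) ⟶ ⟨Γ⟩ ⊗ P.X) = d ⊗ₘ P.p ∧ Δ[Γ] ≫ d.hom = T.act g := by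
  rw [T.isOfGrade_iff_monodromy_inv]
  obtain ⟨X, p, hp⟩ := P
  dsimp only
  simp only [MonoidalCategory.id_tensorHom]
  constructor
  · intro h
    -- The hypothesis is the case `k = 1`; translating by `k⁻¹`, which commutes with the monodromy,
    -- gives the others.
    have hk (k : G) : p ≫ T.shift k X ≫ (ofHom ((β_ X.obj Γ).inv ≫ (β_ Γ X.obj).inv) :
        (⟨Γ⟩ ⊗ X : Pre Γ) ⟶ ⟨Γ⟩ ⊗ X) = p ≫ T.shift (g⁻¹ * k) X := by
      have h' := congrArg (· ≫ (ofHom (T.act k⁻¹ ▷ X.obj) : (⟨Γ⟩ ⊗ X : Pre Γ) ⟶ ⟨Γ⟩ ⊗ X)) h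
      simp only [Category.assoc, ← T.shift_mul, ← ofHom_comp] at h'
      rw [← h', ← one_mul k, T.shift_mul 1 k, T.shift_one, one_mul, Category.assoc, ← ofHom_comp,
        BraidedCategory.braiding_inv_naturality_left_assoc,
        BraidedCategory.braiding_inv_naturality_right]
    -- The endomorphism of `Γ` that permutes the points by left multiplication with `g⁻¹`.
    refine ⟨∑ k, T.coord k ≫ T.point (g⁻¹ * k), ?_, ?_⟩
    · rw [sum_tensor, ← Category.id_comp ((⟨Γ⟩ : Pre Γ) ◁ p), ← id_whiskerRight,
        ← T.sum_coord_point, sum_whiskerRight, Preadditive.sum_comp, Preadditive.sum_comp]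
      refine Finset.sum_congr rfl fun k _ => ?_
      have h1 (k' : G) : (T.coord k ≫ T.point k') ▷ X =
          T.coord k ▷ X ≫ (λ_ X).hom ≫ T.shift k' X := by
        rw [T.shift_eq]; simp
      rw [MonoidalCategory.tensorHom_def, h1, h1]
      simp only [Category.assoc]
      rw [← reassoc_of% T.comp_shift k p, hk, T.comp_shift]
    · have h1 : T.point 1 ≫ ∑ k, T.coord k ≫ T.point (g⁻¹ * k) = T.point g⁻¹ := by
        rw [Preadditive.comp_sum, Finset.sum_eq_single 1, ← Category.assoc, T.point_coord_self,
          Category.id_comp, mul_one]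
        · intro k _ hk
          rw [← Category.assoc, T.point_coord_of_ne hk.symm, zero_comp]
        · simp
      have h2 := congrArg Hom.hom h1
      rw [T.point_one_comp_hom, point_hom, inv_inv] at h2
      exact (cancel_epi (ρ_ Γ).hom).1 h2
  · rintro ⟨d, hd, hd'⟩
    have h1 : T.point 1 ≫ d = T.point g⁻¹ := by
      ext
      rw [T.point_one_comp_hom, hd', point_hom, inv_inv]
    rw [← T.shift_one, reassoc_of% T.comp_shift 1 p, hd, T.shift_eq, Category.assoc,
      MonoidalCategory.tensorHom_def, ← comp_whiskerRight_assoc, h1, T.comp_shift, T.shift_eq,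
      Category.assoc]

/-- Von Neumann regularity passes from `C` to `C̃_Γ`. -/
lemma exists_quasi_inverse (T : GaloisPairing Γ G)
    (hC : ∀ {X Y : C} (f : X ⟶ Y), ∃ h : Y ⟶ X, f ≫ h ≫ f = f)
    {X Y : Pre Γ} (f : X ⟶ Y) : ∃ s : Y ⟶ X, f ≫ s ≫ f = f := by
  -- This morphism `Γ ⊗ X ⟶ Γ ⊗ Y` of `C` is the extension of `f` along `Δ`. By `h1` and `h2`, `f`
  -- is a retract of it, with `pt` as injection and the coordinate of `1` as retraction, so a
  -- quasi-inverse descends.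
  obtain ⟨h, hh⟩ := hC (f ≫ pt Y).hom
  have h1 : f ≫ pt Y = pt X ≫ ofHom (f ≫ pt Y).hom := (pt_comp_ofHom _).symm
  have h2 : (T.coord 1 ▷ X ≫ (λ_ X).hom) ≫ f =
      (ofHom (f ≫ pt Y).hom : (⟨Γ⟩ ⊗ X : Pre Γ) ⟶ ⟨Γ⟩ ⊗ Y) ≫ T.coord 1 ▷ Y ≫ (λ_ Y).hom := by
    have e1 : (ofHom (f ≫ pt Y).hom : (⟨Γ⟩ ⊗ X : Pre Γ) ⟶ ⟨Γ⟩ ⊗ Y) =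
        (ofHom Δ[Γ] : (⟨Γ⟩ : Pre Γ) ⟶ ⟨Γ⟩ ⊗ ⟨Γ⟩) ▷ X ≫ (α_ _ _ _).hom ≫
          (⟨Γ⟩ : Pre Γ) ◁ (ofHom f.hom : ⟨Γ⟩ ⊗ X ⟶ Y) := by
      rw [ofHom_whiskerRight, associator_eq, ofHom_whiskerLeft, ← ofHom_comp, ← ofHom_comp]
      congr 1
      rw [comp_hom, pt_hom]
      simp
    have e2 := congrArg (fun f => f ▷ X) (T.comul_coord 1)
    simp only [comp_whiskerRight] at e2
    simp only [e1, Category.assoc]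
    rw [whisker_exchange_assoc, leftUnitor_naturality,
      ← associator_naturality_left_assoc, ← leftUnitor_whiskerRight_assoc, reassoc_of% e2]
    conv_lhs => rw [← pt_comp_ofHom f, ← T.shift_one, T.shift_eq]
    simp
  refine ⟨pt Y ≫ (ofHom h : (⟨Γ⟩ ⊗ Y : Pre Γ) ⟶ ⟨Γ⟩ ⊗ X) ≫ T.coord 1 ▷ X ≫ (λ_ X).hom, ?_⟩
  have h3 : f ≫ pt Y ≫ T.coord 1 ▷ Y ≫ (λ_ Y).hom = f := by
    rw [← T.shift_one, T.shift_coord_self, Category.comp_id]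
  conv_rhs => rw [← h3, reassoc_of% h1]
  simp only [Category.assoc] at h2 ⊢
  rw [h2, reassoc_of% h1]
  conv_rhs => rw [← hh]
  rw [ofHom_comp (Y := ⟨Γ⟩ ⊗ Y), ofHom_comp (X := ⟨Γ⟩ ⊗ Y) (Y := ⟨Γ⟩ ⊗ X)]
  simp only [Category.assoc]

/-- If the non-zero endomorphisms of the unit of `C̃_Γ` are split monomorphisms, then a tensor
product of non-zero morphisms of `C̃_Γ` with a left factor from an object with a dual is non-zero. -/
lemma eq_zero_of_tensorHom_eq_zero (T : GaloisPairing Γ G) [RightRigidCategory C]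
    (hC : ∀ {X Y : C} (f : X ⟶ Y), ∃ h : Y ⟶ X, f ≫ h ≫ f = f)
    (hunit : ∀ a : 𝟙_ (Pre Γ) ⟶ 𝟙_ (Pre Γ), a ≠ 0 → ∃ b, a ≫ b = 𝟙 _)
    {X X' Y Y' : Pre Γ} (p : X' ⟶ X) (q : Y ⟶ Y') (hp : p ≠ 0) (hpq : (p ⊗ₘ q) = 0) : q = 0 := by
  let D : Pre Γ := ⟨X.objᘁ⟩
  -- The mate of `p` under duality; the zigzag identity recovers `p`, so it is non-zero.
  let e : D ⊗ X' ⟶ 𝟙_ (Pre Γ) := D ◁ p ≫ (ofHom (ε_ X.obj X.objᘁ) : D ⊗ X ⟶ 𝟙_ (Pre Γ))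
  let n : 𝟙_ (Pre Γ) ⟶ X ⊗ D := ofHom (η_ X.obj X.objᘁ)
  have hz : n ▷ X ≫ (α_ X D X).hom ≫ X ◁ (ofHom (ε_ X.obj X.objᘁ) : D ⊗ X ⟶ 𝟙_ (Pre Γ)) =
      (λ_ X).hom ≫ (ρ_ X).inv := by
    rw [ofHom_whiskerRight, associator_eq, ofHom_whiskerLeft, ← ofHom_comp, ← ofHom_comp]
    refine (congrArg _ (ExactPairing.evaluation_coevaluation X.obj X.objᘁ)).trans ?_
    exact ofHom_comp (Y := X) _ _
  have he : e ≠ 0 := by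
    intro he
    apply hp
    have h1 : (λ_ X').inv ≫ n ▷ X' ≫ (α_ X D X').hom ≫ X ◁ e ≫ (ρ_ X).hom = p := by
      simp only [e, MonoidalCategory.whiskerLeft_comp, Category.assoc]
      rw [← associator_naturality_right_assoc, ← whisker_exchange_assoc, reassoc_of% hz]
      simp
    rw [← h1, he]
    simp
  obtain ⟨h, hh⟩ := T.exists_quasi_inverse hC e
  -- Regularity makes `h ≫ e` a non-zero, hence split, endomorphism of the unit. Thus `q` can be
  -- recovered from its tensor product with `e`, which contains `p ⊗ₘ q`.
  have ha : h ≫ e ≠ 0 := fun ha => he (by rw [← hh, ha, comp_zero])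
  obtain ⟨b, hb⟩ := hunit _ ha
  have h2 : q = (λ_ Y).inv ≫ 𝟙_ (Pre Γ) ◁ q ≫ (h ≫ e) ▷ Y' ≫ b ▷ Y' ≫ (λ_ Y').hom := by
    rw [← comp_whiskerRight_assoc, hb]
    simp
  have h3 : (D ⊗ X') ◁ q ≫ (D ◁ p) ▷ Y' = 0 := by
    have : (D ⊗ X') ◁ q ≫ (D ◁ p) ▷ Y' = (α_ D X' Y).hom ≫ D ◁ (p ⊗ₘ q) ≫ (α_ D X Y').inv := by
      rw [MonoidalCategory.tensorHom_def']
      simp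
    rw [this, hpq]
    simp
  rw [h2, comp_whiskerRight_assoc, whisker_exchange_assoc]
  simp only [e, comp_whiskerRight, Category.assoc, reassoc_of% h3, zero_comp, comp_zero]

end GaloisPairing

/-! ### Finite direct sums by injections and projections -/

section DirectSum

variable {D : Type*} [Category D] [Preadditive D]

/-- The injections and projections of a finite direct sum. -/
lemma IsDirectSum.exists_maps {X : D} {n : ℕ} {Y : Fin n → D} (h : IsDirectSum X Y) :
    ∃ (i : ∀ k, Y k ⟶ X) (p : ∀ k, X ⟶ Y k), (∀ k, i k ≫ p k = 𝟙 _) ∧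
      (∀ j k, j ≠ k → i j ≫ p k = 0) ∧ ∑ k, p k ≫ i k = 𝟙 X := by
  obtain ⟨b, ⟨hb⟩, ⟨e⟩⟩ := h
  refine ⟨fun k => b.ι k ≫ e.hom, fun k => e.inv ≫ b.π k, fun k => by simp, fun j k hjk => ?_, ?_⟩
  · simp [b.ι_π, hjk]
  · have := IsBilimit.total hb
    have h1 : ∑ k, (e.inv ≫ b.π k) ≫ b.ι k ≫ e.hom = e.inv ≫ (∑ k, b.π k ≫ b.ι k) ≫ e.hom := by
      simp [Preadditive.comp_sum, Preadditive.sum_comp]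
    rw [h1, this]
    simp

lemma IsDirectSum.of_maps {X : D} {n : ℕ} {Y : Fin n → D} (i : ∀ k, Y k ⟶ X) (p : ∀ k, X ⟶ Y k)
    (h₁ : ∀ k, i k ≫ p k = 𝟙 _) (h₂ : ∀ j k, j ≠ k → i j ≫ p k = 0)
    (h₃ : ∑ k, p k ≫ i k = 𝟙 X) : IsDirectSum X Y := by
  refine ⟨⟨X, p, i, fun j k => ?_⟩, ⟨isBilimitOfTotal _ h₃⟩, ⟨Iso.refl X⟩⟩
  split_ifs with h
  · subst h
    exact h₁ j
  · exact h₂ j k h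

/-- `X` is a finite direct sum of simple objects. -/
def IsSumOfSimples (X : D) : Prop :=
  ∃ (n : ℕ) (Y : Fin n → D), (∀ k, Simple (Y k)) ∧ IsDirectSum X Y

lemma IsSumOfSimples.of_fintype {X : D} {ι : Type*} [Fintype ι] {Y : ι → D}
    (hY : ∀ k, Simple (Y k)) (i : ∀ k, Y k ⟶ X) (p : ∀ k, X ⟶ Y k)
    (h₁ : ∀ k, i k ≫ p k = 𝟙 _) (h₂ : ∀ j k, j ≠ k → i j ≫ p k = 0)
    (h₃ : ∑ k, p k ≫ i k = 𝟙 X) : IsSumOfSimples X := by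
  let e := Fintype.equivFin ι
  refine ⟨_, fun k => Y (e.symm k), fun k => hY _, IsDirectSum.of_maps (fun k => i (e.symm k))
    (fun k => p (e.symm k)) (fun k => h₁ _) (fun j k hjk => h₂ _ _ ?_) ?_⟩
  · exact fun h => hjk (e.symm.injective h)
  · rw [← h₃]
    exact Equiv.sum_comp e.symm (fun k => p k ≫ i k)

lemma IsSumOfSimples.of_simple (X : D) [h : Simple X] : IsSumOfSimples X :=
  .of_fintype (ι := Unit) (Y := fun _ => X) (fun _ => h) (fun _ => 𝟙 X) (fun _ => 𝟙 X)
    (by simp) (by simp) (by simp)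

lemma IsSumOfSimples.of_id_eq_zero {X : D} (h : 𝟙 X = 0) : IsSumOfSimples X :=
  .of_fintype (ι := Empty) (Y := fun _ => X) (by simp) (fun _ => 𝟙 X) (fun _ => 𝟙 X)
    (by simp) (by simp) (by simp [h])

lemma IsSumOfSimples.of_binary {X A B : D} (hA : IsSumOfSimples A) (hB : IsSumOfSimples B)
    (i : A ⟶ X) (p : X ⟶ A) (j : B ⟶ X) (q : X ⟶ B) (hip : i ≫ p = 𝟙 A) (hjq : j ≫ q = 𝟙 B)
    (hiq : i ≫ q = 0) (hjp : j ≫ p = 0) (hsum : p ≫ i + q ≫ j = 𝟙 X) : IsSumOfSimples X := by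
  obtain ⟨n, Y, hY, hAY⟩ := hA
  obtain ⟨m, Z, hZ, hBZ⟩ := hB
  obtain ⟨a, a', ha₁, ha₂, ha₃⟩ := hAY.exists_maps
  obtain ⟨b, b', hb₁, hb₂, hb₃⟩ := hBZ.exists_maps
  refine .of_fintype (ι := Fin n ⊕ Fin m) (Y := Sum.elim Y Z) ?_
    (Sum.rec (fun k => a k ≫ i) (fun k => b k ≫ j))
    (Sum.rec (fun k => p ≫ a' k) (fun k => q ≫ b' k)) ?_ ?_ ?_
  · rintro (k | k)
    exacts [hY k, hZ k]
  · rintro (k | k)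
    · simp [reassoc_of% hip, ha₁]
    · simp [reassoc_of% hjq, hb₁]
  · rintro (k | k) (l | l) hkl
    · have : (a k ≫ i) ≫ p ≫ a' l = 0 := by
        rw [Category.assoc, reassoc_of% hip, ha₂ k l (by simpa using hkl)]
      exact this
    · have : (a k ≫ i) ≫ q ≫ b' l = 0 := by
        rw [Category.assoc, reassoc_of% hiq, zero_comp, comp_zero]
      exact this
    · have : (b k ≫ j) ≫ p ≫ a' l = 0 := by
        rw [Category.assoc, reassoc_of% hjp, zero_comp, comp_zero]
      exact this
    · have : (b k ≫ j) ≫ q ≫ b' l = 0 := by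
        rw [Category.assoc, reassoc_of% hjq, hb₂ k l (by simpa using hkl)]
      exact this
  · rw [Fintype.sum_sum_type]
    have h1 : ∑ k, (p ≫ a' k) ≫ a k ≫ i = p ≫ (∑ k, a' k ≫ a k) ≫ i := by
      simp [Preadditive.comp_sum, Preadditive.sum_comp]
    have h2 : ∑ k, (q ≫ b' k) ≫ b k ≫ j = q ≫ (∑ k, b' k ≫ b k) ≫ j := by
      simp [Preadditive.comp_sum, Preadditive.sum_comp]
    refine (congr($h1 + $h2)).trans ?_
    rw [ha₃, hb₃]
    simpa using hsum

end DirectSum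

/-! ### Regularity of morphisms in a semisimple abelian category -/

section Semisimple

variable {C : Type*} [Category C] [Abelian C]

/-- Some simple summand of `X` has non-zero image in `S`, and by Schur's lemma it maps
isomorphically. -/
lemma exists_section_of_simple {X S : C} [Simple S] (hX : IsSumOfSimples X) (f : X ⟶ S) [Epi f] :
    ∃ s : S ⟶ X, s ≫ f = 𝟙 S := by
  obtain ⟨n, Y, hY, h⟩ := hX
  obtain ⟨i, p, -, -, hs⟩ := h.exists_maps
  have hf : f ≠ 0 := by
    rintro rfl
    exact id_nonzero S ((cancel_epi (0 : X ⟶ S)).1 (by simp))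
  obtain ⟨k, hk⟩ : ∃ k, i k ≫ f ≠ 0 := by
    by_contra! hc
    apply hf
    rw [← Category.id_comp f, ← hs, Preadditive.sum_comp]
    simp [hc]
  have := hY k
  have := isIso_of_hom_simple hk
  exact ⟨inv (i k ≫ f) ≫ i k, by simp⟩

/-- If all objects are finite direct sums of simple objects then all objects are projective. -/
lemma projective_of_isSumOfSimples (hC : ∀ X : C, IsSumOfSimples X) (X : C) : Projective X := by
  obtain ⟨n, Y, hY, h⟩ := hC X
  obtain ⟨i, p, -, -, hs⟩ := h.exists_maps
  refine ⟨fun {B A} f e _ => ?_⟩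
  have h1 : ∀ k, ∃ g : Y k ⟶ _, g ≫ e = i k ≫ f := fun k => by
    have := hY k
    obtain ⟨s, hs⟩ := exists_section_of_simple (hC _) (pullback.snd e (i k ≫ f))
    exact ⟨s ≫ pullback.fst e (i k ≫ f), by
      rw [Category.assoc, pullback.condition, reassoc_of% hs]⟩
  choose g hg using h1
  refine ⟨∑ k, p k ≫ g k, ?_⟩
  rw [Preadditive.sum_comp]
  simp only [Category.assoc, hg]
  simp only [← Category.assoc, ← Preadditive.sum_comp]
  rw [hs, Category.id_comp]

/-- In a semisimple abelian category all morphisms are von Neumann regular. -/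
lemma exists_quasi_inverse_of_semisimple (hC : ∀ X : C, IsSumOfSimples X) {X Y : C} (f : X ⟶ Y) :
    ∃ h : Y ⟶ X, f ≫ h ≫ f = f := by
  let e := Abelian.factorThruImage f
  let m := Abelian.image.ι f
  have hf : e ≫ m = f := Abelian.image.fac f
  have := projective_of_isSumOfSimples hC
  let s := Projective.factorThru (𝟙 _) e
  have hs : s ≫ e = 𝟙 _ := Projective.factorThru_comp _ _
  let t := Projective.factorThru (𝟙 _) (cokernel.π m)
  have ht : t ≫ cokernel.π m = 𝟙 _ := Projective.factorThru_comp _ _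
  -- The idempotent complementary to the split cokernel lands in the image and gives a retraction of
  -- `m`. The quasi-inverse is this retraction followed by a section of `e`.
  have h1 : (𝟙 Y - cokernel.π m ≫ t) ≫ cokernel.π m = 0 := by
    simp [Preadditive.sub_comp, ht]
  have h2 : m ≫ Abelian.monoLift m _ h1 = 𝟙 _ := by
    rw [← cancel_mono m, Category.assoc, Abelian.monoLift_comp]
    simp [Preadditive.comp_sub]
  refine ⟨Abelian.monoLift m _ h1 ≫ s, ?_⟩
  calc f ≫ (Abelian.monoLift m _ h1 ≫ s) ≫ f
      = (e ≫ m) ≫ (Abelian.monoLift m _ h1 ≫ s) ≫ e ≫ m := by rw [hf]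
    _ = e ≫ m := by simp only [Category.assoc, reassoc_of% hs, reassoc_of% h2]
    _ = f := hf

end Semisimple

/-! ### Semisimplicity of the idempotent completion -/

section KaroubiSemisimple

variable {D : Type*} [Category D] [Preadditive D]

lemma Karoubi.exists_quasi_inverse (hD : ∀ {X Y : D} (f : X ⟶ Y), ∃ h : Y ⟶ X, f ≫ h ≫ f = f)
    {P Q : Karoubi D} (f : P ⟶ Q) : ∃ h : Q ⟶ P, f ≫ h ≫ f = f := by
  obtain ⟨h, hh⟩ := hD f.f
  refine ⟨⟨Q.p ≫ h ≫ P.p, by simp⟩, ?_⟩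
  ext
  simp [hh]

lemma Karoubi.id_eq_zero_iff (P : Karoubi D) : 𝟙 P = 0 ↔ P.p = 0 :=
  Karoubi.hom_ext_iff

/-- A nonzero idempotent endomorphism of a simple object is the identity. -/
lemma Karoubi.eq_id_of_simple {P : Karoubi D} [Simple P] (e : P ⟶ P) (he : e ≫ e = e)
    (h0 : e ≠ 0) : e = 𝟙 P := by
  have he' : e.f ≫ e.f = e.f := congrArg Karoubi.Hom.f he
  let Q : Karoubi D := ⟨P.X, e.f, he'⟩
  let i : Q ⟶ P := ⟨e.f, by simp [Q, he']⟩
  let r : P ⟶ Q := ⟨e.f, by simp [Q, he']⟩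
  have hir : i ≫ r = 𝟙 Q := Karoubi.hom_ext _ _ he'
  have hri : r ≫ i = e := Karoubi.hom_ext _ _ he'
  have : Mono i := ⟨fun a b hab => by
    rw [← Category.comp_id a, ← Category.comp_id b, ← hir, reassoc_of% hab]⟩
  have hi : i ≠ 0 := fun h => h0 (by rw [← hri, h, comp_zero])
  have := isIso_of_mono_of_nonzero hi
  rw [← hri, ← cancel_epi i, reassoc_of% hir, Category.comp_id]

variable {F : Type*} [Field F] [Linear F D]

/-- The endomorphisms of the underlying object of `P` that factor through `P`. -/
def Karoubi.factorSubmodule (P : Karoubi D) : Submodule F (P.X ⟶ P.X) where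
  carrier := {s | s ≫ P.p = s}
  zero_mem' := zero_comp
  add_mem' {a b} ha hb := by
    simp only [Set.mem_ofPred_eq] at ha hb ⊢
    rw [Preadditive.add_comp, ha, hb]
  smul_mem' c a ha := by
    simp only [Set.mem_ofPred_eq] at ha ⊢
    rw [Linear.smul_comp, ha]

/-- The idempotent completion of a linear category with finite dimensional spaces of morphisms
and von Neumann regular morphisms is semisimple. -/
theorem Karoubi.isSumOfSimples (hfin : ∀ X Y : D, FiniteDimensional F (X ⟶ Y))
    (hD : ∀ {X Y : D} (f : X ⟶ Y), ∃ h : Y ⟶ X, f ≫ h ≫ f = f) (P : Karoubi D) :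
    IsSumOfSimples P := by
  -- Summands of `P` cut out by idempotents have the same underlying object, so their
  -- `factorSubmodule`s are compared inside one vector space.
  induction hn : Module.finrank F (Karoubi.factorSubmodule (F := F) P) using
    Nat.strong_induction_on generalizing P with
  | _ n ih =>
    by_cases h0 : 𝟙 P = 0
    · exact .of_id_eq_zero h0
    by_cases hs : Simple P
    · exact .of_simple P
    obtain ⟨Q, f, hf, hne, hiso⟩ : ∃ (Q : Karoubi D) (f : Q ⟶ P), Mono f ∧ f ≠ 0 ∧ ¬ IsIso f := by
      by_contra! hc
      refine hs ⟨fun {Q} f hf => ⟨fun hi hz => h0 ?_, fun hz => hc Q f hf hz⟩⟩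
      exact (IsIso.inv_hom_id f).symm.trans ((congrArg (inv f ≫ ·) hz).trans comp_zero)
    -- A regular monomorphism splits, so a proper non-zero subobject yields a proper non-zero
    -- idempotent and its complement.
    obtain ⟨s, hsf⟩ := Karoubi.exists_quasi_inverse hD f
    have hfs : f ≫ s = 𝟙 Q := by
      rw [← cancel_mono f, Category.assoc, hsf, Category.id_comp]
    let e := (s ≫ f).f
    have hee : e ≫ e = e := by
      have : (s ≫ f) ≫ (s ≫ f) = s ≫ f := by rw [Category.assoc, hsf]
      exact congrArg Karoubi.Hom.f this
    have hpe : P.p ≫ e = e := Karoubi.p_comp _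
    have hep : e ≫ P.p = e := Karoubi.comp_p _
    have hne' : e ≠ 0 := by
      intro h
      have : s ≫ f = 0 := Karoubi.hom_ext _ _ h
      exact hne (by rw [← hsf, this, comp_zero])
    have hnp : e ≠ P.p := by
      intro h
      have : s ≫ f = 𝟙 P := Karoubi.hom_ext _ _ h
      exact hiso ⟨s, hfs, this⟩
    have hcc : (P.p - e) ≫ (P.p - e) = P.p - e := by
      simp [Preadditive.sub_comp, Preadditive.comp_sub, hpe, hep, hee]
    have key : ∀ (a : P.X ⟶ P.X) (ha : a ≫ a = a), a ≫ P.p = a → a ≠ P.p → P.p ≫ a = a →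
        IsSumOfSimples (⟨P.X, a, ha⟩ : Karoubi D) := by
      intro a ha hap hane hpa
      refine ih _ ?_ _ rfl
      rw [← hn]
      -- The inclusion is strict because `P.p` is in the larger subspace, whereas `P.p ≫ a = a ≠
      -- P.p`.
      refine Submodule.finrank_lt_finrank_of_lt (lt_of_le_of_ne ?_ ?_)
      · intro t (ht : t ≫ a = t)
        change t ≫ P.p = t
        rw [← ht, Category.assoc, hap]
      · intro h
        have : P.p ∈ Karoubi.factorSubmodule (F := F) P := P.idem
        rw [← h] at this
        exact hane (hpa.symm.trans this)
    refine .of_binary (key e hee hep hnp hpe) (key (P.p - e) hcc ?_ ?_ ?_) ⟨e, ?_⟩ ⟨e, ?_⟩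
      ⟨P.p - e, ?_⟩ ⟨P.p - e, ?_⟩ ?_ ?_ ?_ ?_ ?_
    · simp [Preadditive.sub_comp, hep]
    · simpa using hne'
    · simp [Preadditive.comp_sub, hpe]
    · simp [hep, hee]
    · simp [hpe, hee]
    · simp [Preadditive.sub_comp, Preadditive.comp_sub, hpe, hep, hee]
    · simp [Preadditive.sub_comp, Preadditive.comp_sub, hpe, hep, hee]
    · exact Karoubi.hom_ext _ _ hee
    · exact Karoubi.hom_ext _ _ hcc
    · apply Karoubi.hom_ext
      simp [Preadditive.comp_sub, hep, hee]
    · apply Karoubi.hom_ext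
      simp [Preadditive.sub_comp, hpe, hee]
    · apply Karoubi.hom_ext
      simp [Preadditive.sub_comp, Preadditive.comp_sub, hpe, hep, hee]

end KaroubiSemisimple

/-! ### The linear structure of `C̃_Γ` -/

section Linear

variable {F : Type*} [Field F] {C : Type u} [Category.{v} C] [Preadditive C] [Linear F C]
variable [MonoidalCategory C] [MonoidalPreadditive C] [MonoidalLinear F C]
variable {Γ : C} [ComonObj Γ]

namespace Pre

instance (X Y : Pre Γ) : SMul F (X ⟶ Y) := ⟨fun a s => ⟨a • s.hom⟩⟩

@[simp] lemma smul_hom {X Y : Pre Γ} (a : F) (s : X ⟶ Y) : (a • s).hom = a • s.hom := rfl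

instance (X Y : Pre Γ) : Module F (X ⟶ Y) where
  one_smul s := by ext; simp
  mul_smul a b s := by ext; simp [mul_smul]
  smul_zero a := by ext; simp
  smul_add a s t := by ext; simp
  add_smul a b s := by ext; simp [add_smul]
  zero_smul s := by ext; simp

instance : Linear F (Pre Γ) where
  smul_comp X Y Z a s t := by ext; simp
  comp_smul X Y Z s a t := by ext; simp

/-- `Hom_{C̃_Γ}(X, Y) = Hom_C(Γ ⊗ X, Y)`, as vector spaces. -/
def homEquiv (X Y : Pre Γ) : (X ⟶ Y) ≃ₗ[F] (Γ ⊗ X.obj ⟶ Y.obj) where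
  toFun s := s.hom
  invFun s := ⟨s⟩
  map_add' _ _ := rfl
  map_smul' _ _ := rfl

end Pre

end Linear

/-! ### Transport of Galois pairings along monoidal functors -/

section MapPairing

open Functor.LaxMonoidal Functor.OplaxMonoidal

attribute [local instance] Functor.obj.instComonObj in
/-- The image of a Galois pairing under an additive monoidal functor. -/
def GaloisPairing.map {A : Type*} [Category A] [MonoidalCategory A] [Preadditive A]
    {C : Type u} [Category.{v} C] [MonoidalCategory C] [Preadditive C]
    {Γ : A} [ComonObj Γ] {G : Type w} [Group G] [Fintype G] (T : GaloisPairing Γ G)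
    (K : A ⥤ C) [K.Monoidal] [K.Additive] : GaloisPairing (K.obj Γ) G where
  act g := K.map (T.act g)
  isComonHom g := by have := T.isComonHom g; infer_instance
  act_one := by rw [T.act_one, K.map_id]
  act_mul g h := by rw [T.act_mul, K.map_comp]
  pairing g := μ K Γ Γ ≫ K.map (T.pairing g) ≫ η K
  comul_pairing g := by
    have h := congrArg (fun f => μ K Γ Γ ≫ K.map f) (T.comul_pairing g)
    simp only [Functor.map_comp, Functor.Monoidal.map_whiskerLeft,
      Functor.Monoidal.map_whiskerRight, Functor.Monoidal.map_associator,
      Functor.Monoidal.map_associator_inv, Functor.Monoidal.map_leftUnitor,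
      Functor.Monoidal.map_rightUnitor, Category.assoc, Functor.Monoidal.μ_δ_assoc] at h
    simp only [Functor.obj.Δ_def, MonoidalCategory.whiskerLeft_comp, comp_whiskerRight,
      Category.assoc]
    exact h
  act_pairing_self g := by
    have h := congrArg (fun f => K.map f ≫ η K) (T.act_pairing_self g)
    simp only [Functor.map_comp, Functor.Monoidal.map_whiskerLeft, Category.assoc] at h
    simpa only [Functor.obj.Δ_def, Functor.obj.ε_def, Category.assoc] using h
  act_pairing_of_ne g h hgh := by
    have h := congrArg (fun f => K.map f ≫ η K) (T.act_pairing_of_ne g h hgh)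
    simp only [Functor.map_comp, Functor.Monoidal.map_whiskerLeft, Category.assoc,
      Functor.map_zero, zero_comp] at h
    simpa only [Functor.obj.Δ_def, Category.assoc] using h
  sum_pairing := by
    have h := congrArg (fun f => μ K Γ Γ ≫ K.map f ≫ η K) T.sum_pairing
    simp only [Functor.map_comp, Functor.map_sum, Functor.Monoidal.map_whiskerRight,
      Functor.Monoidal.map_leftUnitor, Category.assoc, Functor.Monoidal.μ_δ_assoc,
      Preadditive.sum_comp, Preadditive.comp_sum] at h
    simpa only [Functor.obj.ε_def, comp_whiskerRight, Category.assoc] using h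

end MapPairing

/-! ### The Galois pairing and the endomorphisms of the regular representation -/

section Regular

open TannakaDuality.FiniteGroup
open scoped TensorProduct

variable {F : Type u} [Field F] {G : Type u} [Group G] [Fintype G]

/-- `f ⊗ f' ↦ |G|⁻² ∑ f(x) f'(xg)`. -/
noncomputable def pairingLin (g : G) : (G → F) ⊗[F] (G → F) →ₗ[F] F :=
  (Fintype.card G : F)⁻¹ • counitLin ∘ₗ LinearMap.mul' F (G → F) ∘ₗ
    TensorProduct.map (rightRegular g⁻¹) LinearMap.id

open Classical in
lemma pairingLin_single (g x y : G) :
    pairingLin g ((Pi.single x 1 : G → F) ⊗ₜ[F] (Pi.single y 1 : G → F)) =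
      if x * g = y then (Fintype.card G : F)⁻¹ * (Fintype.card G : F)⁻¹ else 0 := by
  simp only [pairingLin, LinearMap.smul_apply, LinearMap.comp_apply, TensorProduct.map_tmul,
    rightRegular_single, inv_inv, LinearMap.id_apply, LinearMap.mul'_apply]
  rw [← Pi.single_mul_right]
  split_ifs with h
  · subst h
    simp [counitLin_single]
  · rw [Pi.single_eq_of_ne' h]
    simp

lemma tensor_linearMap_ext {M : Type*} [AddCommGroup M] [Module F M]
    {a b : (G → F) ⊗[F] (G → F) →ₗ[F] M}
    (h : ∀ x y, (open Classical in a (Pi.single x 1 ⊗ₜ[F] Pi.single y 1) =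
      b (Pi.single x 1 ⊗ₜ[F] Pi.single y 1))) : a = b :=
  TensorProduct.ext (linearMap_ext fun x => linearMap_ext fun y => h x y)

lemma pairingLin_leftRegular (g h : G) :
    pairingLin g ∘ₗ TensorProduct.map (leftRegular h) (leftRegular h) =
      (pairingLin g : (G → F) ⊗[F] (G → F) →ₗ[F] F) :=
  tensor_linearMap_ext fun x y => by
    have e : h * x * g = h * y ↔ x * g = y := by rw [mul_assoc, mul_right_inj]
    simp only [LinearMap.comp_apply, TensorProduct.map_tmul, leftRegular_single, pairingLin_single]
    classical
    exact if_congr e rfl rfl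

/-- The pairing that belongs to `g`, as a morphism of representations. -/
noncomputable def regPairing (g : G) : regular F G ⊗ regular F G ⟶ 𝟙_ (FDRep F G) where
  hom := InducedCategory.homMk (ModuleCat.ofHom (pairingLin g))
  comm h := FGModuleCat.hom_ext (pairingLin_leftRegular g h)

/-- On `δ_x ⊗ δ_y` both sides vanish unless `x g = y`. In that case one side is a multiple of `δ_y`,
the other the same multiple of the translate by `g⁻¹` of `δ_x`, which is `δ_{xg}`. -/
lemma comulLin_pairingLin (g : G) :
    (TensorProduct.lid F (G → F)).toLinearMap ∘ₗ (pairingLin g).rTensor (G → F) ∘ₗ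
      (TensorProduct.assoc F (G → F) (G → F) (G → F)).symm.toLinearMap ∘ₗ
        comulLin.lTensor (G → F) =
    rightRegular g⁻¹ ∘ₗ (TensorProduct.rid F (G → F)).toLinearMap ∘ₗ
      (pairingLin g).lTensor (G → F) ∘ₗ
      (TensorProduct.assoc F (G → F) (G → F) (G → F)).toLinearMap ∘ₗ
        comulLin.rTensor (G → F) :=
  tensor_linearMap_ext fun x y => by
    simp [comulLin_single, ← TensorProduct.smul_tmul', pairingLin_single]
    split_ifs with h
    · subst h
      have e := rightRegular_single (F := F) g⁻¹ x
      rw [inv_inv] at e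
      rw [map_smul, map_smul]
      exact congr(_ • _ • $e.symm)
    · simp

lemma comulLin_rightRegular_pairingLin_self [CharZero F] (g : G) :
    pairingLin g ∘ₗ (rightRegular g⁻¹).lTensor (G → F) ∘ₗ comulLin = (counitLin : (G → F) →ₗ[F] F) :=
  linearMap_ext fun x => by
    have := card_cast_ne_zero (F := F) (G := G)
    simp [comulLin_single, rightRegular_single, pairingLin_single, counitLin_single, this]

lemma comulLin_rightRegular_pairingLin_of_ne {g h : G} (hgh : g ≠ h) :
    pairingLin h ∘ₗ (rightRegular g⁻¹).lTensor (G → F) ∘ₗ comulLin = (0 : (G → F) →ₗ[F] F) :=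
  linearMap_ext fun x => by
    simp [comulLin_single, rightRegular_single, pairingLin_single, hgh.symm]

/-- For given `x` and `y` exactly one element `z`, namely `x⁻¹ y`, contributes. -/
lemma sum_pairingLin :
    ∑ g : G, pairingLin g = (counitLin : (G → F) →ₗ[F] F) ∘ₗ
      (TensorProduct.lid F (G → F)).toLinearMap ∘ₗ counitLin.rTensor (G → F) :=
  tensor_linearMap_ext fun x y => by
    have e (z : G) : x * z = y ↔ z = x⁻¹ * y := by rw [eq_inv_mul_iff_mul_eq]
    simp only [LinearMap.sum_apply, pairingLin_single, LinearMap.comp_apply,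
      LinearMap.rTensor_tmul, counitLin_single, LinearEquiv.coe_coe, TensorProduct.lid_tmul,
      map_smul, smul_eq_mul]
    rw [Finset.sum_eq_single (x⁻¹ * y), if_pos (by simp)]
    · intro z _ hz
      rw [if_neg (mt (e z).1 hz)]
    · simp

/-- The underlying linear map of a morphism of representations, as an additive map. -/
def linAddHom (V W : FDRep F G) : (V ⟶ W) →+ (V.V →ₗ[F] W.V) where
  toFun f := f.hom.hom.hom
  map_zero' := rfl
  map_add' _ _ := rfl

lemma linAddHom_injective (V W : FDRep F G) : Function.Injective (linAddHom V W) :=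
  fun _ _ h => Action.Hom.ext (FGModuleCat.hom_ext h)

variable (F G) in
/-- The Galois pairing on the regular representation. -/
noncomputable def regGaloisPairing [CharZero F] : GaloisPairing (regular F G) G where
  act := regTranslate
  isComonHom _ := inferInstance
  act_one := linAddHom_injective _ _ (map_one (rightRegular (k := F) (G := G)))
  act_mul g h := linAddHom_injective _ _ (map_mul (rightRegular (k := F) (G := G)) g h)
  pairing := regPairing
  comul_pairing g := by
    apply Action.Hom.ext
    simp only [Action.comp_hom, Action.associator_hom_hom, Action.associator_inv_hom,
      Action.whiskerLeft_hom, Action.whiskerRight_hom, Action.leftUnitor_hom_hom,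
      Action.rightUnitor_hom_hom]
    exact FGModuleCat.hom_ext (comulLin_pairingLin g)
  act_pairing_self g := linAddHom_injective _ _ (comulLin_rightRegular_pairingLin_self g)
  act_pairing_of_ne _ _ hgh :=
    linAddHom_injective _ _ (comulLin_rightRegular_pairingLin_of_ne hgh)
  sum_pairing := by
    symm
    apply Action.Hom.ext
    simp only [Action.comp_hom, Action.whiskerRight_hom, Action.leftUnitor_hom_hom]
    apply FGModuleCat.hom_ext
    refine Eq.trans (sum_pairingLin (F := F) (G := G)).symm ?_
    exact (map_sum (linAddHom (regular F G ⊗ regular F G) (𝟙_ (FDRep F G))) regPairing _).symm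

lemma exists_smul_regCounit [CharZero F] (f : regular F G ⟶ 𝟙_ (FDRep F G)) :
    ∃ a : F, f = a • ε[regular F G] := by
  classical
  let φ : (G → F) →ₗ[F] F := linAddHom _ _ f
  have h (g : G) : φ ∘ₗ leftRegular g = φ := congrArg (fun f => f.hom.hom) (f.comm g)
  -- An invariant functional is constant on the delta functions, on each of which the counit takes
  -- the value `|G|⁻¹`.
  refine ⟨(Fintype.card G : F) * φ (Pi.single 1 1), linAddHom_injective _ _ ?_⟩
  have : φ = ((Fintype.card G : F) * φ (Pi.single 1 1)) • counitLin := linearMap_ext fun x => by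
    have h1 : φ (Pi.single x 1) = φ (Pi.single 1 1) := by
      have := LinearMap.congr_fun (h x) (Pi.single 1 1)
      rwa [LinearMap.comp_apply, leftRegular_single, mul_one] at this
    have := card_cast_ne_zero (F := F) (G := G)
    simp only [LinearMap.smul_apply, counitLin_single, h1, smul_eq_mul]
    field_simp
  exact this

lemma regCounit_ne_zero [CharZero F] : ε[regular F G] ≠ 0 := by
  classical
  intro h
  have h1 := LinearMap.congr_fun (congrArg (linAddHom _ _) h) (Pi.single 1 1 : G → F)
  have h2 : counitLin (Pi.single 1 1 : G → F) = 0 := h1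
  rw [counitLin_single] at h2
  exact inv_ne_zero card_cast_ne_zero h2

lemma regTranslate_injective : Function.Injective (regTranslate (F := F) (G := G)) := by
  classical
  intro g h hgh
  have h1 := LinearMap.congr_fun (congrArg (linAddHom _ _) hgh) (Pi.single 1 1 : G → F)
  have h2 : rightRegular g (Pi.single 1 1 : G → F) = rightRegular h (Pi.single 1 1) := h1
  rw [rightRegular_single, rightRegular_single, one_mul, one_mul] at h2
  have h3 := congrFun h2 g⁻¹
  by_contra hne
  have hne' : g⁻¹ ≠ h⁻¹ := fun h => hne (inv_injective h)
  simp [Pi.single_eq_of_ne hne'] at h3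

instance (g : G) : IsMonHom (regTranslate (F := F) g) where
  one_hom := linAddHom_injective _ _ rfl
  mul_hom := linAddHom_injective _ _ (TensorProduct.ext' fun _ _ => rfl)

/-- The endomorphisms of the algebra of functions on `G` in the category of representations of `G`
are the right translations. -/
lemma exists_regTranslate_eq (ψ : regular F G ⟶ regular F G) [IsMonHom ψ] :
    ∃ g : G, regTranslate g = ψ := by
  classical
  let φ : (G → F) →ₗ[F] (G → F) := linAddHom _ _ ψ
  have hcomm (g : G) (f : G → F) : φ (leftRegular g f) = leftRegular g (φ f) :=
    LinearMap.congr_fun (congrArg (fun f => f.hom.hom) (ψ.comm g)) f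
  have hone : φ 1 = 1 := by
    have h : (linAddHom _ _ (MonObj.one ≫ ψ)) (1 : F) = (linAddHom _ _ MonObj.one) (1 : F) := by
      rw [IsMonHom.one_hom]
    have e : (Algebra.linearMap F (G → F)) (1 : F) = 1 := by simp
    have h' : φ ((Algebra.linearMap F (G → F)) (1 : F)) = Algebra.linearMap F (G → F) 1 := h
    rwa [e] at h'
  have hmul (a b : G → F) : φ (a * b) = φ a * φ b := by
    have h := LinearMap.congr_fun (congrArg (linAddHom _ _) (IsMonHom.mul_hom ψ)) (a ⊗ₜ[F] b)
    exact h
  let A : (G → F) →ₐ[F] (G → F) := AlgHom.ofLinearMap φ hone hmul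
  -- The value of `φ f` at `1` is a character of the algebra of functions, hence evaluation at some
  -- `s`.
  obtain ⟨s, hs⟩ := ((Pi.evalAlgHom F (fun _ : G => F) 1).comp A).eq_piEvalAlgHom
  refine ⟨s, linAddHom_injective _ _ ?_⟩
  have : rightRegular s = φ := by
    ext u t
    -- Equivariance moves the evaluation from `1` to `t`: `(φ f)(t)` is the value at `1` of `φ` of
    -- the left translate of `f`, that is `f (t s)`.
    have h1 : φ (leftRegular t⁻¹ (Pi.single u 1)) 1 = (leftRegular t⁻¹ (Pi.single u 1) : G → F) s :=
      congr($hs (leftRegular t⁻¹ (Pi.single u 1)))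
    rw [hcomm] at h1
    simpa using h1.symm
  exact this

end Regular

/-! ### Properties of `Γ` inherited from the regular representation -/

section Functor

variable {F : Type u} [Field F] [CharZero F] {G : Type u} [Group G] [Fintype G]
variable {C : Type w} [Category.{v} C] [MonoidalCategory C] [BraidedCategory C]
variable (K : FDRep F G ⥤ C) [K.Braided]

/-- The Galois pairing on `Γ`. -/
noncomputable def galoisPairing [Preadditive C] [K.Additive] : GaloisPairing (Gam K) G :=
  (regGaloisPairing F G).map K

lemma translate_injective [K.Faithful] : Function.Injective (translate K) :=
  K.map_injective.comp regTranslate_injective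

lemma isMonHom_iff_exists_translate [K.Full] [K.Faithful] (φ : Gam K ⟶ Gam K) :
    IsMonHom φ ↔ ∃ g : G, translate K g = φ := by
  let := Functor.monObjObj (F := K) (regular F G)
  constructor
  · intro h
    have : IsMonHom (M := K.obj (regular F G)) (N := K.obj (regular F G)) φ := h
    let hK := Functor.FullyFaithful.ofFullyFaithful K
    have h' : IsMonHom (hK.preimage (X := regular F G) (Y := regular F G) φ) :=
      Functor.FullyFaithful.isMonHom_preimage hK (X := regular F G) (Y := regular F G) φ
    obtain ⟨g, hg⟩ := exists_regTranslate_eq (hK.preimage (X := regular F G) (Y := regular F G) φ)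
    refine ⟨g, ?_⟩
    rw [translate, hg]
    exact hK.map_preimage _
  · rintro ⟨g, rfl⟩
    exact inferInstanceAs (IsMonHom (K.map (regTranslate g)))

variable [Preadditive C] [Linear F C] [MonoidalPreadditive C] [MonoidalLinear F C]

lemma exists_smul_counit [K.Full] [K.Linear F] (f : Gam K ⟶ 𝟙_ C) :
    ∃ a : F, f = a • ε[Gam K] := by
  obtain ⟨φ, hφ⟩ := K.map_surjective (X := regular F G) (f ≫ Functor.LaxMonoidal.ε K)
  obtain ⟨a, rfl⟩ := exists_smul_regCounit φ
  refine ⟨a, ?_⟩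
  have h : f = (f ≫ Functor.LaxMonoidal.ε K) ≫ Functor.OplaxMonoidal.η K := by simp
  refine h.trans ((congrArg (· ≫ Functor.OplaxMonoidal.η K) hφ.symm).trans ?_)
  rw [K.map_smul]
  exact Linear.smul_comp _ _ _ _ _ _

lemma counit_ne_zero [K.Faithful] [K.Additive] : ε[Gam K] ≠ 0 := by
  intro h
  have h1 : K.map ε[regular F G] ≫ Functor.OplaxMonoidal.η K = 0 := h
  have h2 := congrArg (· ≫ Functor.LaxMonoidal.ε K) h1
  simp only [Category.assoc, Functor.Monoidal.η_ε, Category.comp_id, zero_comp] at h2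
  exact regCounit_ne_zero (K.map_injective (h2.trans (K.map_zero _ _).symm))

/-- An endomorphism of the unit of `C̃_Γ` is a morphism `Γ ⟶ 𝟙` of `C`, hence a multiple of the
counit, and the counit is the identity of the unit in `C̃_Γ`. -/
lemma exists_comp_eq_id [K.Full] [K.Linear F] (a : 𝟙_ (Pre (Gam K)) ⟶ 𝟙_ (Pre (Gam K)))
    (ha : a ≠ 0) : ∃ b, a ≫ b = 𝟙 _ := by
  obtain ⟨c, hc⟩ := exists_smul_counit K ((ρ_ (Gam K)).inv ≫ a.hom)
  have h1 : a = c • 𝟙 _ := by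
    ext
    rw [Pre.smul_hom, Pre.id_hom, ← cancel_epi (ρ_ (Gam K)).inv]
    refine hc.trans ?_
    rw [Linear.comp_smul]
    simp [unitors_equal]
  have hc0 : c ≠ 0 := by
    rintro rfl
    exact ha (by rw [h1, zero_smul])
  exact ⟨c⁻¹ • 𝟙 _, by rw [h1, Linear.smul_comp, Linear.comp_smul, smul_smul, mul_inv_cancel₀ hc0,
    one_smul, Category.id_comp]⟩

lemma id_unit_ne_zero [K.Faithful] [K.Additive] : 𝟙 (𝟙_ (Pre (Gam K))) ≠ 0 := by
  intro h
  have h1 : ε[Gam K] ▷ 𝟙_ C ≫ (λ_ (𝟙_ C)).hom = 0 := congrArg Pre.Hom.hom h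
  apply counit_ne_zero K
  rw [← cancel_epi (ρ_ (Gam K)).hom, ← rightUnitor_naturality, ← unitors_equal, h1, comp_zero]

end Functor

/-! ### Equality of objects and sliding of idempotents in the idempotent completion -/

section KaroubiEq

variable {D : Type*} [Category D]

/-- The identity of `(X, q)` is `q` itself. Thus the transports in the strictness and braiding
axioms become idempotents of the underlying category. -/
lemma karoubi_eqToHom_f {X : D} {p q : X ⟶ X} {hp : p ≫ p = p} {hq : q ≫ q = q}
    (h : (⟨X, p, hp⟩ : Karoubi D) = ⟨X, q, hq⟩) : (eqToHom h).f = q := by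
  obtain rfl : p = q := by simpa using h
  rfl

lemma karoubi_p_eq {X : D} {p q : X ⟶ X} {hp : p ≫ p = p} {hq : q ≫ q = q}
    (h : (⟨X, p, hp⟩ : Karoubi D) = ⟨X, q, hq⟩) : p = q := by
  simpa using h

lemma karoubi_mk_eq {X : D} {p q : X ⟶ X} (hp : p ≫ p = p) (hq : q ≫ q = q) (h : p = q) :
    (⟨X, p, hp⟩ : Karoubi D) = ⟨X, q, hq⟩ := by
  subst h
  rfl

variable [MonoidalCategory D]

/-- Sliding idempotents through a half braiding applied twice, in the second factor. -/
lemma slide_tensor_right {X Z T : D} {p : X ⟶ X} {z z' : Z ⟶ Z} {t t' : T ⟶ T}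
    (b : X ⊗ Z ⟶ Z ⊗ X) (c : X ⊗ T ⟶ T ⊗ X) (hp : p ≫ p = p) (hz : z ≫ z = z) (ht : t ≫ t = t)
    (hz' : z' ≫ z' = z') (ht' : t' ≫ t' = t')
    (hb : (p ⊗ₘ z) ≫ b = b ≫ (z' ⊗ₘ p)) (hc : (p ⊗ₘ t) ≫ c = c ≫ (t' ⊗ₘ p)) :
    ((p ⊗ₘ z ⊗ₘ t) ≫ (α_ X Z T).inv) ≫ (((p ⊗ₘ z) ≫ b) ⊗ₘ t) ≫
      (((z' ⊗ₘ p) ⊗ₘ t) ≫ (α_ Z X T).hom) ≫ (z' ⊗ₘ ((p ⊗ₘ t) ≫ c)) ≫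
        ((z' ⊗ₘ t' ⊗ₘ p) ≫ (α_ Z T X).inv) ≫ ((z' ⊗ₘ t') ⊗ₘ p) =
      ((α_ X Z T).inv ≫ b ▷ T ≫ (α_ Z X T).hom ≫ Z ◁ c ≫ (α_ Z T X).inv) ≫
        ((z' ⊗ₘ t') ⊗ₘ p) := by
  -- Each idempotent is moved behind the crossing, where it merges with the next one; only the last
  -- survives.
  have e1 : (((p ⊗ₘ z) ≫ b) ⊗ₘ t) = b ▷ T ≫ ((z' ⊗ₘ p) ⊗ₘ t) := by
    rw [hb, MonoidalCategory.tensorHom_def, comp_whiskerRight, Category.assoc,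
      ← MonoidalCategory.tensorHom_def]
  have e2 : (z' ⊗ₘ ((p ⊗ₘ t) ≫ c)) = Z ◁ c ≫ (z' ⊗ₘ t' ⊗ₘ p) := by
    rw [hc, MonoidalCategory.tensorHom_def', MonoidalCategory.whiskerLeft_comp, Category.assoc,
      ← MonoidalCategory.tensorHom_def']
  have e3 : ((p ⊗ₘ z ⊗ₘ t) ≫ (α_ X Z T).inv) ≫ (((p ⊗ₘ z) ≫ b) ⊗ₘ t) =
      (α_ X Z T).inv ≫ (((p ⊗ₘ z) ≫ b) ⊗ₘ t) := by
    rw [associator_inv_naturality, Category.assoc, tensorHom_comp_tensorHom,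
      tensorHom_comp_tensorHom_assoc, hp, hz, ht]
  have e4 : ((z' ⊗ₘ p) ⊗ₘ t) ≫ (((z' ⊗ₘ p) ⊗ₘ t) ≫ (α_ Z X T).hom) ≫ (z' ⊗ₘ ((p ⊗ₘ t) ≫ c)) =
      (α_ Z X T).hom ≫ (z' ⊗ₘ ((p ⊗ₘ t) ≫ c)) := by
    simp only [associator_naturality_assoc, associator_naturality, Category.assoc,
      tensorHom_comp_tensorHom, tensorHom_comp_tensorHom_assoc, hz', hp, ht]
  have e5 : (z' ⊗ₘ t' ⊗ₘ p) ≫ ((z' ⊗ₘ t' ⊗ₘ p) ≫ (α_ Z T X).inv) ≫ ((z' ⊗ₘ t') ⊗ₘ p) =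
      (α_ Z T X).inv ≫ ((z' ⊗ₘ t') ⊗ₘ p) := by
    simp only [associator_inv_naturality_assoc, associator_inv_naturality, Category.assoc,
      tensorHom_comp_tensorHom, hz', hp, ht']
  simp only [Category.assoc] at e3 e4 e5 ⊢
  rw [reassoc_of% e3, e1, Category.assoc, reassoc_of% e4, e2, Category.assoc, e5]

/-- Sliding idempotents through a half braiding applied twice, in the first factor. -/
lemma slide_tensor_left {X Y Z : D} {p : X ⟶ X} {q : Y ⟶ Y} {z z' z'' : Z ⟶ Z}
    (b : Y ⊗ Z ⟶ Z ⊗ Y) (c : X ⊗ Z ⟶ Z ⊗ X) (hp : p ≫ p = p) (hq : q ≫ q = q) (hz : z ≫ z = z)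
    (hz' : z' ≫ z' = z') (hz'' : z'' ≫ z'' = z'')
    (hb : (q ⊗ₘ z) ≫ b = b ≫ (z' ⊗ₘ q)) (hc : (p ⊗ₘ z') ≫ c = c ≫ (z'' ⊗ₘ p)) :
    (((p ⊗ₘ q) ⊗ₘ z) ≫ (α_ X Y Z).hom) ≫ (p ⊗ₘ ((q ⊗ₘ z) ≫ b)) ≫
      ((p ⊗ₘ z' ⊗ₘ q) ≫ (α_ X Z Y).inv) ≫ (((p ⊗ₘ z') ≫ c) ⊗ₘ q) ≫
        (((z'' ⊗ₘ p) ⊗ₘ q) ≫ (α_ Z X Y).hom) ≫ (z'' ⊗ₘ p ⊗ₘ q) =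
      ((α_ X Y Z).hom ≫ X ◁ b ≫ (α_ X Z Y).inv ≫ c ▷ Y ≫ (α_ Z X Y).hom) ≫
        (z'' ⊗ₘ p ⊗ₘ q) := by
  have e1 : (p ⊗ₘ ((q ⊗ₘ z) ≫ b)) = X ◁ b ≫ (p ⊗ₘ z' ⊗ₘ q) := by
    rw [hb, MonoidalCategory.tensorHom_def', MonoidalCategory.whiskerLeft_comp, Category.assoc,
      ← MonoidalCategory.tensorHom_def']
  have e2 : (((p ⊗ₘ z') ≫ c) ⊗ₘ q) = c ▷ Y ≫ ((z'' ⊗ₘ p) ⊗ₘ q) := by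
    rw [hc, MonoidalCategory.tensorHom_def, comp_whiskerRight, Category.assoc,
      ← MonoidalCategory.tensorHom_def]
  have e3 : (((p ⊗ₘ q) ⊗ₘ z) ≫ (α_ X Y Z).hom) ≫ (p ⊗ₘ ((q ⊗ₘ z) ≫ b)) =
      (α_ X Y Z).hom ≫ (p ⊗ₘ ((q ⊗ₘ z) ≫ b)) := by
    rw [associator_naturality, Category.assoc, tensorHom_comp_tensorHom,
      tensorHom_comp_tensorHom_assoc, hp, hq, hz]
  have e4 : (p ⊗ₘ z' ⊗ₘ q) ≫ ((p ⊗ₘ z' ⊗ₘ q) ≫ (α_ X Z Y).inv) ≫ (((p ⊗ₘ z') ≫ c) ⊗ₘ q) =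
      (α_ X Z Y).inv ≫ (((p ⊗ₘ z') ≫ c) ⊗ₘ q) := by
    simp only [associator_inv_naturality_assoc, Category.assoc,
      tensorHom_comp_tensorHom, tensorHom_comp_tensorHom_assoc, hz', hp, hq]
  have e5 : ((z'' ⊗ₘ p) ⊗ₘ q) ≫ (((z'' ⊗ₘ p) ⊗ₘ q) ≫ (α_ Z X Y).hom) ≫ (z'' ⊗ₘ p ⊗ₘ q) =
      (α_ Z X Y).hom ≫ (z'' ⊗ₘ p ⊗ₘ q) := by
    simp only [associator_naturality_assoc, Category.assoc,
      tensorHom_comp_tensorHom, hz'', hp, hq]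
  simp only [Category.assoc] at e3 e4 e5 ⊢
  rw [reassoc_of% e3, e1, Category.assoc, reassoc_of% e4, e2, Category.assoc, e5]

end KaroubiEq

/-! ### Composition of twists -/

section TwistGroup

variable {C : Type u} [Category.{v} C] [MonoidalCategory C] {Γ : C} [ComonObj Γ]

namespace Pre

/-- The equation is a hypothesis so that `φ` can be substituted together with the instance that
depends on it. -/
lemma twistHom_of_eq_id {φ : Γ ⟶ Γ} [IsComonHom φ] (h : φ = 𝟙 Γ) {X Y : Pre Γ} (s : X ⟶ Y) :
    twistHom φ s = s := by
  subst h
  ext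
  simp

lemma twistHom_of_eq_comp {φ ψ χ : Γ ⟶ Γ} [IsComonHom φ] [IsComonHom ψ] [IsComonHom χ]
    (h : φ = ψ ≫ χ) {X Y : Pre Γ} (s : X ⟶ Y) :
    twistHom φ s = twistHom ψ (twistHom χ s) := by
  subst h
  ext
  simp

end Pre

end TwistGroup

/-! ### The hexagon identities in `C̃_Γ` -/

section Hexagon

variable {C : Type u} [Category.{v} C] [MonoidalCategory C] [BraidedCategory C]
variable {Γ : C} [ComonObj Γ] [IsCommComonObj Γ]

namespace Pre

lemma braiding_tensor_right (X Z T : Pre Γ) :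
    (ofHom (β_ X.obj (Z ⊗ T).obj).hom : X ⊗ Z ⊗ T ⟶ (Z ⊗ T) ⊗ X) =
      (α_ X Z T).inv ≫ (ofHom (β_ X.obj Z.obj).hom : X ⊗ Z ⟶ Z ⊗ X) ▷ T ≫ (α_ Z X T).hom ≫
        Z ◁ (ofHom (β_ X.obj T.obj).hom : X ⊗ T ⟶ T ⊗ X) ≫ (α_ Z T X).inv := by
  rw [ofHom_whiskerRight, ofHom_whiskerLeft, associator_eq, associator_inv_eq, associator_inv_eq,
    ← ofHom_comp, ← ofHom_comp, ← ofHom_comp, ← ofHom_comp]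
  congr 1
  exact BraidedCategory.braiding_tensor_right_hom _ _ _

lemma braiding_tensor_left (X Y Z : Pre Γ) :
    (ofHom (β_ (X ⊗ Y).obj Z.obj).hom : (X ⊗ Y) ⊗ Z ⟶ Z ⊗ X ⊗ Y) =
      (α_ X Y Z).hom ≫ X ◁ (ofHom (β_ Y.obj Z.obj).hom : Y ⊗ Z ⟶ Z ⊗ Y) ≫ (α_ X Z Y).inv ≫
        (ofHom (β_ X.obj Z.obj).hom : X ⊗ Z ⟶ Z ⊗ X) ▷ Y ≫ (α_ Z X Y).hom := by
  rw [ofHom_whiskerRight, ofHom_whiskerLeft, associator_eq, associator_inv_eq, associator_eq,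
    ← ofHom_comp, ← ofHom_comp, ← ofHom_comp, ← ofHom_comp]
  congr 1
  exact BraidedCategory.braiding_tensor_left_hom _ _ _

end Pre

end Hexagon

/-! ### The crossed braiding and the grades of simple objects -/

namespace GaloisPairing

variable {C : Type u} [Category.{v} C] [MonoidalCategory C] [BraidedCategory C]
variable [Preadditive C] [MonoidalPreadditive C]
variable {Γ : C} [ComonObj Γ] [IsCommComonObj Γ] {G : Type w} [Group G] [Fintype G]
variable {T : GaloisPairing Γ G}

open Pre

/-- A morphism out of an object of grade `g` is moved to the right by the braiding, at the cost of
the action of `g`. -/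
lemma IsOfGrade.tensorHom_comp_braiding {P P' : Karoubi (Pre Γ)} {g : G} (hP : T.IsOfGrade P g)
    (s : P ⟶ P') {Y Y' : Pre Γ} (t : Y ⟶ Y') :
    (s.f ⊗ₘ t) ≫ (ofHom (β_ P'.X.obj Y'.obj).hom : P'.X ⊗ Y' ⟶ Y' ⊗ P'.X) =
      (ofHom (β_ P.X.obj Y.obj).hom : P.X ⊗ Y ⟶ Y ⊗ P.X) ≫ (twistHom (T.act g⁻¹) t ⊗ₘ s.f) :=
  T.tensorHom_comp_braiding s.f (hP.comp_proj' s) t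

lemma IsOfGrade.p_comp_braiding {P : Karoubi (Pre Γ)} {g : G} (hP : T.IsOfGrade P g)
    {Y Y' : Pre Γ} (t : Y ⟶ Y') :
    (P.p ⊗ₘ t) ≫ (ofHom (β_ P.X.obj Y'.obj).hom : P.X ⊗ Y' ⟶ Y' ⊗ P.X) =
      (ofHom (β_ P.X.obj Y.obj).hom : P.X ⊗ Y ⟶ Y ⊗ P.X) ≫ (twistHom (T.act g⁻¹) t ⊗ₘ P.p) :=
  hP.tensorHom_comp_braiding (𝟙 P) t

lemma ofHom_braiding_hom_inv (X Y : Pre Γ) :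
    (ofHom (β_ X.obj Y.obj).hom : X ⊗ Y ⟶ Y ⊗ X) ≫ ofHom (β_ X.obj Y.obj).inv = 𝟙 (X ⊗ Y) := by
  rw [← ofHom_comp, Iso.hom_inv_id]
  exact ofHom_id _

lemma ofHom_braiding_inv_hom (X Y : Pre Γ) :
    (ofHom (β_ X.obj Y.obj).inv : Y ⊗ X ⟶ X ⊗ Y) ≫ ofHom (β_ X.obj Y.obj).hom = 𝟙 (Y ⊗ X) := by
  rw [← ofHom_comp, Iso.inv_hom_id]
  exact ofHom_id _

lemma IsOfGrade.comp_braiding_inv {P : Karoubi (Pre Γ)} {g : G} (hP : T.IsOfGrade P g)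
    {Y Y' : Pre Γ} (t : Y ⟶ Y') :
    (twistHom (T.act g⁻¹) t ⊗ₘ P.p) ≫
        (ofHom (β_ P.X.obj Y'.obj).inv : Y' ⊗ P.X ⟶ P.X ⊗ Y') =
      (ofHom (β_ P.X.obj Y.obj).inv : Y ⊗ P.X ⟶ P.X ⊗ Y) ≫ (P.p ⊗ₘ t) := by
  have h := congrArg (fun f => (ofHom (β_ P.X.obj Y.obj).inv : Y ⊗ P.X ⟶ P.X ⊗ Y) ≫ f ≫
    (ofHom (β_ P.X.obj Y'.obj).inv : Y' ⊗ P.X ⟶ P.X ⊗ Y')) (hP.p_comp_braiding t)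
  simp only [Category.assoc, ofHom_braiding_hom_inv, Category.comp_id] at h
  rw [h, reassoc_of% ofHom_braiding_inv_hom]

/-- The crossed braiding of an object of grade `g` with an arbitrary object. -/
def crossedBraiding {P : Karoubi (Pre Γ)} {g : G} (hP : T.IsOfGrade P g) (Q : Karoubi (Pre Γ)) :
    P ⊗ Q ≅ (karoubiMap (twist (T.act g⁻¹))).obj Q ⊗ P where
  hom := ⟨(P.p ⊗ₘ Q.p) ≫ (ofHom (β_ P.X.obj Q.X.obj).hom : P.X ⊗ Q.X ⟶ Q.X ⊗ P.X), by
    -- Crossing an object of grade `g` turns the idempotent of `Q` into that of `γ_g Q`, so the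
    -- target is the twisted object.
    have h := hP.p_comp_braiding Q.p
    have h1 : (twistHom (T.act g⁻¹) Q.p ⊗ₘ P.p) ≫ (twistHom (T.act g⁻¹) Q.p ⊗ₘ P.p) =
        (twistHom (T.act g⁻¹) Q.p ⊗ₘ P.p) := by
      rw [tensorHom_comp_tensorHom, ← twistHom_comp, Q.idem, P.idem]
    have h2 : (P.p ⊗ₘ Q.p) ≫ ((P.p ⊗ₘ Q.p) ≫
        (ofHom (β_ P.X.obj Q.X.obj).hom : P.X ⊗ Q.X ⟶ Q.X ⊗ P.X)) ≫
          (twistHom (T.act g⁻¹) Q.p ⊗ₘ P.p) =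
        (P.p ⊗ₘ Q.p) ≫ (ofHom (β_ P.X.obj Q.X.obj).hom : P.X ⊗ Q.X ⟶ Q.X ⊗ P.X) := by
      rw [Category.assoc, tensorHom_comp_tensorHom_assoc, P.idem, Q.idem, ← Category.assoc, h,
        Category.assoc, h1]
    exact h2⟩
  inv := ⟨(ofHom (β_ P.X.obj Q.X.obj).inv : Q.X ⊗ P.X ⟶ P.X ⊗ Q.X) ≫ (P.p ⊗ₘ Q.p), by
    have h := hP.comp_braiding_inv Q.p
    have h1 : (P.p ⊗ₘ Q.p) ≫ (P.p ⊗ₘ Q.p) = (P.p ⊗ₘ Q.p) := by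
      rw [tensorHom_comp_tensorHom, Q.idem, P.idem]
    have h2 : (twistHom (T.act g⁻¹) Q.p ⊗ₘ P.p) ≫
        ((ofHom (β_ P.X.obj Q.X.obj).inv : Q.X ⊗ P.X ⟶ P.X ⊗ Q.X) ≫ (P.p ⊗ₘ Q.p)) ≫
          (P.p ⊗ₘ Q.p) =
        (ofHom (β_ P.X.obj Q.X.obj).inv : Q.X ⊗ P.X ⟶ P.X ⊗ Q.X) ≫ (P.p ⊗ₘ Q.p) := by
      rw [Category.assoc, h1, reassoc_of% h, h1]
    exact h2⟩
  hom_inv_id := by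
    apply Karoubi.hom_ext
    change ((P.p ⊗ₘ Q.p) ≫ (ofHom (β_ P.X.obj Q.X.obj).hom : P.X ⊗ Q.X ⟶ Q.X ⊗ P.X)) ≫
      (ofHom (β_ P.X.obj Q.X.obj).inv : Q.X ⊗ P.X ⟶ P.X ⊗ Q.X) ≫ (P.p ⊗ₘ Q.p) = (P.p ⊗ₘ Q.p)
    rw [Category.assoc, reassoc_of% ofHom_braiding_hom_inv, tensorHom_comp_tensorHom, P.idem,
      Q.idem]
  inv_hom_id := by
    apply Karoubi.hom_ext
    have h : ((ofHom (β_ P.X.obj Q.X.obj).inv : Q.X ⊗ P.X ⟶ P.X ⊗ Q.X) ≫ (P.p ⊗ₘ Q.p)) ≫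
        (P.p ⊗ₘ Q.p) ≫ (ofHom (β_ P.X.obj Q.X.obj).hom : P.X ⊗ Q.X ⟶ Q.X ⊗ P.X) =
          (twistHom (T.act g⁻¹) Q.p ⊗ₘ P.p) := by
      rw [Category.assoc, tensorHom_comp_tensorHom_assoc, P.idem, Q.idem, hP.p_comp_braiding,
        reassoc_of% ofHom_braiding_inv_hom]
    exact h

/-- The unique grade of a non-zero object. -/
lemma IsOfGrade.unique {P : Karoubi (Pre Γ)} {g h : G} (hg : T.IsOfGrade P g)
    (hh : T.IsOfGrade P h) (hP : P.p ≠ 0) : g = h := by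
  by_contra hne
  exact hP ((Karoubi.id_eq_zero_iff P).1 (hg.hom_eq_zero hh (𝟙 P) hne))

lemma IsOfGrade.of_retract {P Q : Karoubi (Pre Γ)} {g : G} (hP : T.IsOfGrade P g) (i : Q ⟶ P)
    (r : P ⟶ Q) (h : i ≫ r = 𝟙 Q) : T.IsOfGrade Q g := by
  have h1 : Q.p = i.f ≫ r.f := congrArg Karoubi.Hom.f h.symm
  rw [IsOfGrade, h1, Category.assoc, T.comp_proj, ← Category.assoc, hP.comp_proj]

/-- The projections restrict to idempotent endomorphisms of `P` with sum the identity. One of them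
is non-zero, hence equal to the identity since `P` is simple. -/
lemma exists_isOfGrade_of_simple (T : GaloisPairing Γ G) (P : Karoubi (Pre Γ)) [Simple P] :
    ∃ g, T.IsOfGrade P g := by
  let e (g : G) : P ⟶ P := ⟨P.p ≫ T.proj g P.X, by
    rw [← Category.assoc, ← Category.assoc, P.idem, Category.assoc, ← T.comp_proj, ← Category.assoc,
      P.idem]⟩
  have he (g : G) : e g ≫ e g = e g := by
    apply Karoubi.hom_ext
    change (P.p ≫ T.proj g P.X) ≫ P.p ≫ T.proj g P.X = P.p ≫ T.proj g P.X
    rw [Category.assoc, ← reassoc_of% T.comp_proj g P.p, ← Category.assoc, P.idem, T.proj_proj_self]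
  have hsum : P.p = ∑ g, (e g).f := by
    change P.p = ∑ g, P.p ≫ T.proj g P.X
    rw [← Preadditive.comp_sum, T.sum_proj, Category.comp_id]
  obtain ⟨g, hg⟩ : ∃ g, e g ≠ 0 := by
    by_contra! hc
    apply id_nonzero P
    rw [Karoubi.id_eq_zero_iff, hsum]
    simp [hc]
  exact ⟨g, congrArg Karoubi.Hom.f (Karoubi.eq_id_of_simple (e g) (he g) hg)⟩

end GaloisPairing

/-! ### The axioms of a braided crossed `G`-category -/

namespace GaloisPairing

variable {C : Type u} [Category.{v} C] [MonoidalCategory C] [BraidedCategory C]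
variable [Preadditive C] [MonoidalPreadditive C]
variable {Γ : C} [ComonObj Γ] [IsCommComonObj Γ] {G : Type w} [Group G] [Fintype G]
variable (T : GaloisPairing Γ G)

open Pre

/-- The action of `G` on the idempotent completion of `C̃_Γ`. -/
def action (g : G) : Karoubi (Pre Γ) ⥤ Karoubi (Pre Γ) := karoubiMap (twist (T.act g⁻¹))

lemma twistHom_act_one {X Y : Pre Γ} (s : X ⟶ Y) : twistHom (T.act 1⁻¹) s = s :=
  twistHom_of_eq_id (by rw [inv_one, T.act_one]) s

lemma twistHom_act_mul (g h : G) {X Y : Pre Γ} (s : X ⟶ Y) :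
    twistHom (T.act (g * h)⁻¹) s = twistHom (T.act g⁻¹) (twistHom (T.act h⁻¹) s) :=
  twistHom_of_eq_comp (by rw [mul_inv_rev, T.act_mul]) s

lemma twistHom_act_ne_zero (g : G) {X Y : Pre Γ} {s : X ⟶ Y} (hs : s ≠ 0) :
    twistHom (T.act g⁻¹) s ≠ 0 := by
  intro h
  apply hs
  have h1 := T.twistHom_act_mul g⁻¹ g s
  have h2 : twistHom (T.act (g⁻¹ * g)⁻¹) s = s :=
    twistHom_of_eq_id (by rw [inv_mul_cancel, inv_one, T.act_one]) s
  rw [← h2, h1, h]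
  ext
  simp

lemma action_one : T.action 1 = 𝟭 (Karoubi (Pre Γ)) := by
  have hobj (P : Karoubi (Pre Γ)) : (T.action 1).obj P = P :=
    karoubi_mk_eq _ _ (T.twistHom_act_one P.p)
  refine CategoryTheory.Functor.ext hobj fun P Q s => Karoubi.hom_ext _ _ ?_
  have e1 : (eqToHom (hobj P)).f = P.p := karoubi_eqToHom_f (hobj P)
  have e2 : (eqToHom (hobj Q).symm).f = twistHom (T.act 1⁻¹) Q.p := karoubi_eqToHom_f (hobj Q).symm
  -- The transports are idempotents that any morphism of the completion absorbs.
  have e3 : twistHom (T.act 1⁻¹) s.f = P.p ≫ s.f ≫ twistHom (T.act 1⁻¹) Q.p := by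
    rw [twistHom_act_one, twistHom_act_one, s.comm]
  rw [Karoubi.comp_f, Karoubi.comp_f]
  exact e3.trans (by rw [← e1, ← e2]; rfl)

lemma action_mul (g h : G) : T.action (g * h) = T.action h ⋙ T.action g := by
  have hobj (P : Karoubi (Pre Γ)) : (T.action (g * h)).obj P = (T.action h ⋙ T.action g).obj P :=
    karoubi_mk_eq _ _ (T.twistHom_act_mul g h P.p)
  refine CategoryTheory.Functor.ext hobj fun P Q s => Karoubi.hom_ext _ _ ?_
  have e1 : (eqToHom (hobj P)).f = twistHom (T.act g⁻¹) (twistHom (T.act h⁻¹) P.p) :=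
    karoubi_eqToHom_f (hobj P)
  have e2 : (eqToHom (hobj Q).symm).f = twistHom (T.act (g * h)⁻¹) Q.p :=
    karoubi_eqToHom_f (hobj Q).symm
  have e3 : twistHom (T.act (g * h)⁻¹) s.f = twistHom (T.act g⁻¹) (twistHom (T.act h⁻¹) P.p) ≫
      twistHom (T.act g⁻¹) (twistHom (T.act h⁻¹) s.f) ≫ twistHom (T.act (g * h)⁻¹) Q.p := by
    rw [twistHom_act_mul, twistHom_act_mul, ← twistHom_comp, ← twistHom_comp, ← twistHom_comp,
      ← twistHom_comp, s.comm]
  rw [Karoubi.comp_f, Karoubi.comp_f]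
  exact e3.trans (by rw [← e1, ← e2]; rfl)

lemma action_unit (g : G) : (T.action g).obj (𝟙_ (Karoubi (Pre Γ))) = 𝟙_ (Karoubi (Pre Γ)) :=
  karoubi_mk_eq _ _ ((twist (T.act g⁻¹)).map_id (𝟙_ (Pre Γ)))

lemma action_tensor (g : G) (P Q : Karoubi (Pre Γ)) :
    (T.action g).obj (P ⊗ Q) = (T.action g).obj P ⊗ (T.action g).obj Q :=
  karoubi_mk_eq _ _ (twistHom_tensorHom _ P.p Q.p)

lemma action_tensorHom (g : G) {P P' Q Q' : Karoubi (Pre Γ)} (s : P ⟶ P') (t : Q ⟶ Q')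
    (h : (T.action g).obj (P ⊗ Q) = (T.action g).obj P ⊗ (T.action g).obj Q)
    (h' : (T.action g).obj P' ⊗ (T.action g).obj Q' = (T.action g).obj (P' ⊗ Q')) :
    (T.action g).map (s ⊗ₘ t) =
      eqToHom h ≫ ((T.action g).map s ⊗ₘ (T.action g).map t) ≫ eqToHom h' := by
  have e1 : (eqToHom h).f = (twistHom (T.act g⁻¹) P.p ⊗ₘ twistHom (T.act g⁻¹) Q.p) :=
    karoubi_eqToHom_f h
  have e2 : (eqToHom h').f = twistHom (T.act g⁻¹) (P'.p ⊗ₘ Q'.p) := karoubi_eqToHom_f h'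
  have e3 : twistHom (T.act g⁻¹) (s.f ⊗ₘ t.f) =
      (twistHom (T.act g⁻¹) P.p ⊗ₘ twistHom (T.act g⁻¹) Q.p) ≫
        (twistHom (T.act g⁻¹) s.f ⊗ₘ twistHom (T.act g⁻¹) t.f) ≫
          twistHom (T.act g⁻¹) (P'.p ⊗ₘ Q'.p) := by
    simp only [twistHom_tensorHom, tensorHom_comp_tensorHom, ← twistHom_comp, s.comm, t.comm]
  apply Karoubi.hom_ext
  rw [Karoubi.comp_f, Karoubi.comp_f]
  exact e3.trans (by rw [← e1, ← e2]; rfl)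

lemma action_associator (g : G) (P Q R : Karoubi (Pre Γ))
    (h : (T.action g).obj ((P ⊗ Q) ⊗ R) =
      ((T.action g).obj P ⊗ (T.action g).obj Q) ⊗ (T.action g).obj R)
    (h' : (T.action g).obj P ⊗ (T.action g).obj Q ⊗ (T.action g).obj R =
      (T.action g).obj (P ⊗ Q ⊗ R)) :
    (T.action g).map (α_ P Q R).hom = eqToHom h ≫
      (α_ ((T.action g).obj P) ((T.action g).obj Q) ((T.action g).obj R)).hom ≫ eqToHom h' := by
  let p := twistHom (T.act g⁻¹) P.p
  let q := twistHom (T.act g⁻¹) Q.p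
  let r := twistHom (T.act g⁻¹) R.p
  have hp : p ≫ p = p := by rw [← twistHom_comp, P.idem]
  have hq : q ≫ q = q := by rw [← twistHom_comp, Q.idem]
  have hr : r ≫ r = r := by rw [← twistHom_comp, R.idem]
  have e1 : (eqToHom h).f = ((p ⊗ₘ q) ⊗ₘ r) := karoubi_eqToHom_f h
  have e2 : (eqToHom h').f = twistHom (T.act g⁻¹) (P.p ⊗ₘ Q.p ⊗ₘ R.p) := karoubi_eqToHom_f h'
  have e0 : twistHom (T.act g⁻¹) (α_ P.X Q.X R.X).hom = (α_ P.X Q.X R.X).hom :=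
    twistHom_ofHom _ _
  have e3 : twistHom (T.act g⁻¹) (((P.p ⊗ₘ Q.p) ⊗ₘ R.p) ≫ (α_ P.X Q.X R.X).hom) =
      ((p ⊗ₘ q) ⊗ₘ r) ≫ (((p ⊗ₘ q) ⊗ₘ r) ≫ (α_ P.X Q.X R.X).hom) ≫
        twistHom (T.act g⁻¹) (P.p ⊗ₘ Q.p ⊗ₘ R.p) := by
    rw [twistHom_comp, e0]
    simp only [twistHom_tensorHom]
    change ((p ⊗ₘ q) ⊗ₘ r) ≫ _ = ((p ⊗ₘ q) ⊗ₘ r) ≫ (((p ⊗ₘ q) ⊗ₘ r) ≫ (α_ P.X Q.X R.X).hom) ≫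
      (p ⊗ₘ q ⊗ₘ r)
    simp only [Category.assoc, ← associator_naturality, tensorHom_comp_tensorHom_assoc,
      tensorHom_comp_tensorHom, hp, hq, hr]
  apply Karoubi.hom_ext
  rw [Karoubi.comp_f, Karoubi.comp_f]
  -- Only the first copy of the idempotent is the transport; the second belongs to the associator.
  exact e3.trans (by nth_rewrite 1 [← e1]; rw [← e2]; rfl)

lemma action_leftUnitor (g : G) (P : Karoubi (Pre Γ))
    (h : (T.action g).obj (𝟙_ _ ⊗ P) = 𝟙_ _ ⊗ (T.action g).obj P) :
    (T.action g).map (λ_ P).hom = eqToHom h ≫ (λ_ ((T.action g).obj P)).hom := by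
  let p := twistHom (T.act g⁻¹) P.p
  have hp : p ≫ p = p := by rw [← twistHom_comp, P.idem]
  have e1 : (eqToHom h).f = (𝟙 (𝟙_ (Pre Γ)) ⊗ₘ p) := karoubi_eqToHom_f h
  have e2 : twistHom (T.act g⁻¹) (𝟙 (𝟙_ (Pre Γ))) = 𝟙 _ := (twist (T.act g⁻¹)).map_id _
  have e0 : twistHom (T.act g⁻¹) (λ_ P.X).hom = (λ_ P.X).hom := twistHom_ofHom _ _
  have e3 : twistHom (T.act g⁻¹) ((𝟙 _ ⊗ₘ P.p) ≫ (λ_ P.X).hom) =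
      (𝟙 (𝟙_ (Pre Γ)) ⊗ₘ p) ≫ (𝟙 _ ⊗ₘ p) ≫ (λ_ P.X).hom := by
    rw [twistHom_comp, e0, twistHom_tensorHom, e2, tensorHom_comp_tensorHom_assoc, hp,
      Category.comp_id]
  apply Karoubi.hom_ext
  rw [Karoubi.comp_f]
  exact e3.trans (by nth_rewrite 1 [← e1]; rfl)

lemma action_rightUnitor (g : G) (P : Karoubi (Pre Γ))
    (h : (T.action g).obj (P ⊗ 𝟙_ _) = (T.action g).obj P ⊗ 𝟙_ _) :
    (T.action g).map (ρ_ P).hom = eqToHom h ≫ (ρ_ ((T.action g).obj P)).hom := by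
  let p := twistHom (T.act g⁻¹) P.p
  have hp : p ≫ p = p := by rw [← twistHom_comp, P.idem]
  have e1 : (eqToHom h).f = (p ⊗ₘ 𝟙 (𝟙_ (Pre Γ))) := karoubi_eqToHom_f h
  have e2 : twistHom (T.act g⁻¹) (𝟙 (𝟙_ (Pre Γ))) = 𝟙 _ := (twist (T.act g⁻¹)).map_id _
  have e0 : twistHom (T.act g⁻¹) (ρ_ P.X).hom = (ρ_ P.X).hom := twistHom_ofHom _ _
  have e3 : twistHom (T.act g⁻¹) ((P.p ⊗ₘ 𝟙 _) ≫ (ρ_ P.X).hom) =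
      (p ⊗ₘ 𝟙 (𝟙_ (Pre Γ))) ≫ (p ⊗ₘ 𝟙 _) ≫ (ρ_ P.X).hom := by
    rw [twistHom_comp, e0, twistHom_tensorHom, e2, tensorHom_comp_tensorHom_assoc, hp,
      Category.comp_id]
  apply Karoubi.hom_ext
  rw [Karoubi.comp_f]
  exact e3.trans (by nth_rewrite 1 [← e1]; rfl)

variable {T} {homog : ObjectProperty (Karoubi (Pre Γ))} {deg : homog.FullSubcategory → G}

/-- Being homogeneous enters only as being non-zero and having a grade, so all closure properties
split into a statement on grades and one on non-vanishing. Uniqueness of grades turns each grade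
computation into an equation for `deg`. -/
lemma isCrossedGCategory
    (hhomog : ∀ P, homog P ↔ P.p ≠ 0 ∧ ∃ g, T.IsOfGrade P g)
    (hdeg : ∀ X : homog.FullSubcategory, T.IsOfGrade X.obj (deg X))
    (hunit : 𝟙 (𝟙_ (Pre Γ)) ≠ 0)
    (htensor : ∀ {X X' Y Y' : Pre Γ} (p : X ⟶ X') (q : Y ⟶ Y'), p ≠ 0 → q ≠ 0 → (p ⊗ₘ q) ≠ 0)
    (hsum : ∀ P : Karoubi (Pre Γ), IsSumOfSimples P) :
    IsCrossedGCategory homog deg T.action := by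
  have hunique (X : homog.FullSubcategory) {g : G} (h : T.IsOfGrade X.obj g) : deg X = g :=
    (hdeg X).unique h ((hhomog _).1 X.property).1
  have hact (g : G) (P : Karoubi (Pre Γ)) (hP : homog P) : homog ((T.action g).obj P) := by
    obtain ⟨hP, h, hh⟩ := (hhomog P).1 hP
    exact (hhomog _).2 ⟨T.twistHom_act_ne_zero g hP, _, hh.twist g rfl⟩
  have hmon : homog.IsMonoidal :=
    { prop_unit := (hhomog _).2 ⟨hunit, 1, .unit⟩
      prop_tensor := fun P Q hP hQ => by
        obtain ⟨hP, g, hg⟩ := (hhomog P).1 hP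
        obtain ⟨hQ, h, hh⟩ := (hhomog Q).1 hQ
        exact (hhomog _).2 ⟨htensor _ _ hP hQ, _, hg.tensor hh⟩ }
  exact
    { isMonoidal := hmon
      deg_iso := fun X Y ⟨e⟩ => hunique X ((hdeg Y).of_retract e.hom e.inv e.hom_inv_id)
      γ_one := T.action_one
      γ_mul := T.action_mul
      γ_unit := T.action_unit
      γ_tensor := T.action_tensor
      γ_tensorHom := fun g _ _ _ _ s t => T.action_tensorHom g s t _ _
      γ_associator := fun g P Q R => T.action_associator g P Q R _ _
      γ_leftUnitor := fun g P => T.action_leftUnitor g P _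
      γ_rightUnitor := fun g P => T.action_rightUnitor g P _
      deg_tensor := fun X Y => hunique _ ((hdeg X).tensor (hdeg Y))
      γ_homog := hact
      deg_γ := fun g X => hunique _ ((hdeg X).twist g rfl)
      directSum := fun P => by
        obtain ⟨n, Y, hY, h⟩ := hsum P
        refine ⟨n, Y, fun i => ?_, h⟩
        have := hY i
        exact (hhomog _).2 ⟨fun h0 => id_nonzero (Y i) ((Karoubi.id_eq_zero_iff _).2 h0),
          T.exists_isOfGrade_of_simple (Y i)⟩ }

lemma isCrossedBraiding (h : IsCrossedGCategory homog deg T.action)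
    (hdeg : ∀ X : homog.FullSubcategory, T.IsOfGrade X.obj (deg X)) :
    IsCrossedBraiding h (fun X Y => crossedBraiding (hdeg X) Y) where
  hom_eq_zero X X' s hX := (hdeg X).hom_eq_zero (hdeg X') s hX
  naturality X X' Y Y' s t hX := by
    have h' : (T.action (deg X)).obj Y' = (T.action (deg X')).obj Y' := by rw [hX]
    have e1 : (eqToHom h').f = twistHom (T.act (deg X')⁻¹) Y'.p := karoubi_eqToHom_f h'
    -- Read off from the equality of objects, which avoids rewriting `deg` inside dependent terms.
    have e0 : twistHom (T.act (deg X')⁻¹) Y'.p = twistHom (T.act (deg X)⁻¹) Y'.p :=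
      karoubi_p_eq h'.symm
    have e2 : (s.f ⊗ₘ t.f) ≫ (X'.obj.p ⊗ₘ Y'.p) ≫
          (ofHom (β_ X'.obj.X.obj Y'.X.obj).hom : X'.obj.X ⊗ Y'.X ⟶ Y'.X ⊗ X'.obj.X) =
        ((X.obj.p ⊗ₘ Y.p) ≫
          (ofHom (β_ X.obj.X.obj Y.X.obj).hom : X.obj.X ⊗ Y.X ⟶ Y.X ⊗ X.obj.X)) ≫
          ((twistHom (T.act (deg X)⁻¹) t.f ≫ twistHom (T.act (deg X')⁻¹) Y'.p) ⊗ₘ s.f) := by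
      rw [e0, ← twistHom_comp, Category.assoc, ← (hdeg X).tensorHom_comp_braiding s,
        tensorHom_comp_tensorHom_assoc, tensorHom_comp_tensorHom_assoc]
      simp
    apply Karoubi.hom_ext
    rw [Karoubi.comp_f, Karoubi.comp_f, karoubi_tensorHom_f, karoubi_tensorHom_f, Karoubi.comp_f]
    exact e2.trans (by rw [← e1]; rfl)
  tensor_right X Z W := by
    let z' := twistHom (T.act (deg X)⁻¹) Z.p
    let t' := twistHom (T.act (deg X)⁻¹) W.p
    have e1 : (eqToHom (h.γ_tensor (deg X) Z W).symm).f =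
      twistHom (T.act (deg X)⁻¹) (Z.p ⊗ₘ W.p) := karoubi_eqToHom_f (h.γ_tensor (deg X) Z W).symm
    have e0 : twistHom (T.act (deg X)⁻¹) (Z.p ⊗ₘ W.p) = (z' ⊗ₘ t') := twistHom_tensorHom _ _ _
    have e2 := slide_tensor_right
      (ofHom (β_ X.obj.X.obj Z.X.obj).hom : X.obj.X ⊗ Z.X ⟶ Z.X ⊗ X.obj.X)
      (ofHom (β_ X.obj.X.obj W.X.obj).hom : X.obj.X ⊗ W.X ⟶ W.X ⊗ X.obj.X)
      X.obj.idem Z.idem W.idem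
      (z' := z') (t' := t') (by rw [← twistHom_comp, Z.idem]) (by rw [← twistHom_comp, W.idem])
      ((hdeg X).p_comp_braiding Z.p) ((hdeg X).p_comp_braiding W.p)
    have e3 := (hdeg X).p_comp_braiding (Z.p ⊗ₘ W.p)
    -- Now `e2` is the hexagon of `C̃_Γ` with the idempotents of all intermediate objects inserted.
    rw [← braiding_tensor_right, ← e0, ← e3, ← e1] at e2
    exact Karoubi.hom_ext _ _ e2.symm
  tensor_left X Y Z := by
    let z' := twistHom (T.act (deg Y)⁻¹) Z.p
    let z'' := twistHom (T.act (deg X)⁻¹) z'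
    have hz' : z' ≫ z' = z' := by rw [← twistHom_comp, Z.idem]
    have e1 : (eqToHom (h.obj_tensor X Y Z).symm).f =
      twistHom (T.act (deg (h.tensor X Y))⁻¹) Z.p := karoubi_eqToHom_f (h.obj_tensor X Y Z).symm
    -- This is where multiplicativity of the grade enters, through the equality of objects
    -- `obj_tensor`.
    have e0 : twistHom (T.act (deg (h.tensor X Y))⁻¹) Z.p = z'' :=
      karoubi_p_eq (h.obj_tensor X Y Z)
    have e2 := slide_tensor_left
      (ofHom (β_ Y.obj.X.obj Z.X.obj).hom : Y.obj.X ⊗ Z.X ⟶ Z.X ⊗ Y.obj.X)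
      (ofHom (β_ X.obj.X.obj Z.X.obj).hom : X.obj.X ⊗ Z.X ⟶ Z.X ⊗ X.obj.X)
      X.obj.idem Y.obj.idem Z.idem (z' := z') (z'' := z'') hz' (by rw [← twistHom_comp, hz'])
      ((hdeg Y).p_comp_braiding Z.p) ((hdeg X).p_comp_braiding z')
    have e3 : ((X.obj.p ⊗ₘ Y.obj.p) ⊗ₘ Z.p) ≫
        (ofHom (β_ (X.obj.X ⊗ Y.obj.X).obj Z.X.obj).hom :
          (X.obj.X ⊗ Y.obj.X) ⊗ Z.X ⟶ Z.X ⊗ X.obj.X ⊗ Y.obj.X) =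
        ofHom (β_ (X.obj.X ⊗ Y.obj.X).obj Z.X.obj).hom ≫
          (twistHom (T.act (deg (h.tensor X Y))⁻¹) Z.p ⊗ₘ X.obj.p ⊗ₘ Y.obj.p) :=
      (hdeg (h.tensor X Y)).p_comp_braiding Z.p
    rw [e0] at e1 e3
    rw [← braiding_tensor_left, ← e3] at e2
    nth_rewrite 2 [← e1] at e2
    exact Karoubi.hom_ext _ _ e2.symm
  γ_braiding g X Y := by
    let p := twistHom (T.act g⁻¹) X.obj.p
    let q := twistHom (T.act g⁻¹) Y.p
    let r := twistHom (T.act g⁻¹) (twistHom (T.act (deg X)⁻¹) Y.p)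
    have hp : p ≫ p = p := by rw [← twistHom_comp, X.obj.idem]
    have hq : q ≫ q = q := by rw [← twistHom_comp, Y.idem]
    have hr : r ≫ r = r := by rw [← twistHom_comp, ← twistHom_comp, Y.idem]
    have e1 : (eqToHom (h.γ_tensor g X.obj Y)).f = (p ⊗ₘ q) :=
      karoubi_eqToHom_f (h.γ_tensor g X.obj Y)
    have e2 : (eqToHom (h.obj_act g X Y).symm).f = r := karoubi_eqToHom_f (h.obj_act g X Y).symm
    have e3 : (eqToHom (h.γ_tensor g ((T.action (deg X)).obj Y) X.obj).symm).f =
        twistHom (T.act g⁻¹) (twistHom (T.act (deg X)⁻¹) Y.p ⊗ₘ X.obj.p) :=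
      karoubi_eqToHom_f (h.γ_tensor g ((T.action (deg X)).obj Y) X.obj).symm
    -- The conjugation rule for grades, in the form of an equality of idempotents. The braiding of
    -- `C` itself is fixed by twisting, by `twistHom_ofHom`.
    have e0 : r = twistHom (T.act (deg (h.act g X))⁻¹) q := karoubi_p_eq (h.obj_act g X Y)
    have e4 : (p ⊗ₘ q) ≫ (ofHom (β_ X.obj.X.obj Y.X.obj).hom : X.obj.X ⊗ Y.X ⟶ Y.X ⊗ X.obj.X) =
        ofHom (β_ X.obj.X.obj Y.X.obj).hom ≫ (r ⊗ₘ p) := by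
      rw [e0]
      exact (hdeg (h.act g X)).p_comp_braiding q
    have e5 : twistHom (T.act g⁻¹) ((X.obj.p ⊗ₘ Y.p) ≫
          (ofHom (β_ X.obj.X.obj Y.X.obj).hom : X.obj.X ⊗ Y.X ⟶ Y.X ⊗ X.obj.X)) =
        (p ⊗ₘ q) ≫ ((p ⊗ₘ q) ≫ ofHom (β_ X.obj.X.obj Y.X.obj).hom) ≫ (r ⊗ₘ p) ≫
          twistHom (T.act g⁻¹) (twistHom (T.act (deg X)⁻¹) Y.p ⊗ₘ X.obj.p) := by
      rw [twistHom_comp, twistHom_ofHom, twistHom_tensorHom, twistHom_tensorHom]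
      change (p ⊗ₘ q) ≫ _ = (p ⊗ₘ q) ≫ ((p ⊗ₘ q) ≫ _) ≫ (r ⊗ₘ p) ≫ (r ⊗ₘ p)
      rw [Category.assoc, tensorHom_comp_tensorHom_assoc, tensorHom_comp_tensorHom, hp, hq, hr,
        reassoc_of% e4, e4, tensorHom_comp_tensorHom, hp, hr]
    rw [← e3, ← e2] at e5
    nth_rewrite 1 [← e1] at e5
    exact Karoubi.hom_ext _ _ e5

end GaloisPairing

/-! ### Homogeneous objects and the main theorem -/

section Main

variable {F : Type u} [Field F] [CharZero F] {G : Type u} [Group G] [Fintype G]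
variable {C : Type w} [Category.{v} C] [MonoidalCategory C] [BraidedCategory C]
variable [Preadditive C] [MonoidalPreadditive C]
variable (K : FDRep F G ⥤ C) [K.Braided] [K.Additive]

lemma hasGrade_iff (P : GaloisExtension K) (g : G) :
    HasGrade K P g ↔ (galoisPairing K).IsOfGrade P g :=
  ((galoisPairing K).isOfGrade_iff_exists P g).symm

/-- A grade passes to summands, which are retracts, and back to sums, since `P.p` is a sum of
morphisms factoring through the summands. The non-emptiness of the sum corresponds to `P.p ≠ 0`. -/
lemma isHomogeneousOfGrade_iff (hsum : ∀ P : GaloisExtension K, IsSumOfSimples P)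
    (P : GaloisExtension K) (g : G) :
    IsHomogeneousOfGrade K P g ↔ P.p ≠ 0 ∧ (galoisPairing K).IsOfGrade P g := by
  constructor
  · rintro ⟨n, Y, hn, hY, h⟩
    obtain ⟨i, r, h₁, -, h₃⟩ := h.exists_maps
    refine ⟨fun h0 => ?_, ?_⟩
    · have := (hY ⟨0, hn⟩).1
      apply id_nonzero (Y ⟨0, hn⟩)
      rw [← h₁, ← Category.comp_id (i _), (Karoubi.id_eq_zero_iff P).2 h0, comp_zero, zero_comp]
    · have h4 : P.p = ∑ k, (r k ≫ i k).f := by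
        have h5 := congrArg Karoubi.Hom.f h₃
        simpa using h5.symm
      rw [GaloisPairing.IsOfGrade, h4, Preadditive.sum_comp]
      refine Finset.sum_congr rfl fun k _ => ?_
      rw [Karoubi.comp_f, Category.assoc, ((hasGrade_iff K _ _).1 (hY k).2).comp_proj' (i k)]
  · rintro ⟨hP, hg⟩
    obtain ⟨n, Y, hY, h⟩ := hsum P
    obtain ⟨i, r, h₁, -, h₃⟩ := h.exists_maps
    refine ⟨n, Y, Nat.pos_of_ne_zero ?_, fun k => ⟨hY k, (hasGrade_iff K _ _).2
      (hg.of_retract (i k) (r k) (h₁ k))⟩, h⟩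
    rintro rfl
    exact hP ((Karoubi.id_eq_zero_iff P).1 (by rw [← h₃]; simp))

variable [Linear F C] [MonoidalLinear F C]

lemma isSumOfSimples_galoisExtension
    (hfin : ∀ X Y : C, FiniteDimensional F (X ⟶ Y))
    (hC : ∀ {X Y : C} (f : X ⟶ Y), ∃ h : Y ⟶ X, f ≫ h ≫ f = f) (P : GaloisExtension K) :
    IsSumOfSimples P :=
  Karoubi.isSumOfSimples (F := F)
    (fun X Y => have := hfin (Gam K ⊗ X.obj) Y.obj
      Module.Finite.equiv (Pre.homEquiv (F := F) X Y).symm)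
    ((galoisPairing K).exists_quasi_inverse hC) P

/-- The Galois extension of `C` by a full image of `Rep G` is a braided crossed `G`-category. -/
theorem exists_crossedBraiding [RightRigidCategory C] [K.Full] [K.Faithful] [K.Linear F]
    (hfin : ∀ X Y : C, FiniteDimensional F (X ⟶ Y))
    (hC : ∀ {X Y : C} (f : X ⟶ Y), ∃ h : Y ⟶ X, f ≫ h ≫ f = f) :
    ∃ deg : (homogeneous K).FullSubcategory → G,
      (∀ X g, deg X = g ↔ IsHomogeneousOfGrade K X.obj g) ∧
      ∃ h : IsCrossedGCategory (homogeneous K) deg (galoisAction K),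
        ∃ c : ∀ (X : (homogeneous K).FullSubcategory) (Y : GaloisExtension K),
            X.obj ⊗ Y ≅ (galoisAction K (deg X)).obj Y ⊗ X.obj,
          (∀ X Y, (c X Y).hom.f = (X.obj.p ⊗ₘ Y.p) ≫ Pre.ofHom (β_ X.obj.X.obj Y.X.obj).hom) ∧
          IsCrossedBraiding h c := by
  have hsum := isSumOfSimples_galoisExtension K hfin hC
  have hiff := isHomogeneousOfGrade_iff K hsum
  -- The choice is harmless, as a non-zero object has at most one grade.
  let deg : (homogeneous K).FullSubcategory → G := fun X => X.property.choose
  have hdeg (X : (homogeneous K).FullSubcategory) :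
      X.obj.p ≠ 0 ∧ (galoisPairing K).IsOfGrade X.obj (deg X) :=
    (hiff X.obj _).1 X.property.choose_spec
  have h : IsCrossedGCategory (homogeneous K) deg (galoisPairing K).action :=
    GaloisPairing.isCrossedGCategory
      (fun P => ⟨fun ⟨g, hg⟩ => ⟨((hiff P g).1 hg).1, g, ((hiff P g).1 hg).2⟩,
        fun ⟨hP, g, hg⟩ => ⟨g, (hiff P g).2 ⟨hP, hg⟩⟩⟩)
      (fun X => (hdeg X).2) (id_unit_ne_zero K)
      (fun p q hp hq hpq => hq ((galoisPairing K).eq_zero_of_tensorHom_eq_zero hC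
        (exists_comp_eq_id K) p q hp hpq)) hsum
  refine ⟨deg, fun X g => ?_, h, fun X Y => GaloisPairing.crossedBraiding (hdeg X).2 Y,
    fun X Y => rfl, GaloisPairing.isCrossedBraiding h fun X => (hdeg X).2⟩
  rw [hiff]
  exact ⟨fun hg => hg ▸ hdeg X, fun hg => (hdeg X).2.unique hg.2 hg.1⟩

end Main

end GaloisExt

theorem mainTheorem1 {F : Type u} [Field F] [IsAlgClosed F] [CharZero F]
    {C : Type w} [Category.{v} C] [Abelian C] [Linear F C] [MonoidalCategory C]
    [MonoidalPreadditive C] [MonoidalLinear F C] [BraidedCategory C] [RigidCategory C]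
    (hC : GaloisExt.IsTensorCategory F C) (θ : GaloisExt.RibbonStructure C)
    (S : ObjectProperty C) [S.IsMonoidal] (hS : GaloisExt.IsFiniteSubSTC S)
    (hadm : GaloisExt.IsAdmissible F θ S)
    {G : Type u} [Group G] [Fintype G]
    (E : FDRep F G ≌ S.FullSubcategory) [E.functor.Braided] [E.functor.Linear F] :
    (Function.Injective (GaloisExt.translate (E.functor ⋙ S.ι)) ∧
      ∀ φ : GaloisExt.Gam (E.functor ⋙ S.ι) ⟶ GaloisExt.Gam (E.functor ⋙ S.ι),
        IsMonHom φ ↔ ∃ g : G, GaloisExt.translate (E.functor ⋙ S.ι) g = φ) ∧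
    ∃ deg : (GaloisExt.homogeneous (E.functor ⋙ S.ι)).FullSubcategory → G,
      (∀ X g, deg X = g ↔ GaloisExt.IsHomogeneousOfGrade (E.functor ⋙ S.ι) X.obj g) ∧
      ∃ h : GaloisExt.IsCrossedGCategory (GaloisExt.homogeneous (E.functor ⋙ S.ι)) deg
          (GaloisExt.galoisAction (E.functor ⋙ S.ι)),
        ∃ c : ∀ (X : (GaloisExt.homogeneous (E.functor ⋙ S.ι)).FullSubcategory)
            (Y : GaloisExt.GaloisExtension (E.functor ⋙ S.ι)),
            X.obj ⊗ Y ≅ (GaloisExt.galoisAction (E.functor ⋙ S.ι) (deg X)).obj Y ⊗ X.obj,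
          (∀ X Y, (c X Y).hom.f =
            (X.obj.p ⊗ₘ Y.p) ≫ GaloisExt.Pre.ofHom (β_ X.obj.X.obj Y.X.obj).hom) ∧
          GaloisExt.IsCrossedBraiding h c := by
  -- An equivalence preserves binary products and is therefore additive; the composite with the
  -- inclusion stays full, faithful, braided and linear.
  have hE : E.functor.Additive := Functor.additive_of_preserves_binary_products E.functor
  have : (E.functor ⋙ S.ι).Additive := inferInstance
  have : (E.functor ⋙ S.ι).Linear F := inferInstance
  exact ⟨⟨GaloisExt.translate_injective _, GaloisExt.isMonHom_iff_exists_translate _⟩,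
    GaloisExt.exists_crossedBraiding (F := F) _ hC.finiteDimensional
      (GaloisExt.exists_quasi_inverse_of_semisimple hC.semisimple)⟩
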